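/- Let $p\ge 3$ be a prime, $k$ a finite field with $q=p^f$ elements, $\Gamma=\mathrm{GL}_2(k)$, and $\mathbb F$ a field containing $k$. All representations are over $\mathbb F$. Write $V_r=\mathrm{Sym}^r\mathbb F^2$, and let $(\cdot)^{\mathrm{Fr}^i}$ denote the twist of a representation of $\Gamma$ by the map raising matrix entries to the power $p^i$. For $0\le r\le p-2$ let $R_r\subset V_{p-1-r}\otimes V_{p-1}$ be the $\Gamma$-stable direct summand which is the generalised $0$-eigenspace of the $\mathrm{GL}_2$-equivariant operator $(x_0y_1-x_1y_0)\left(\frac{\partial}{\partial x_0}\frac{\partial}{\partial y_1}-\frac{\partial}{\partial x_1}\frac{\partial}{\partial y_0}\right)$, where $V_{p-1-r}\otimes V_{p-1}$ is viewed as the space of polynomials of bidegree $(p-1-r,p-1)$ in $(x_0,x_1;y_0,y_1)$; it has dimension $2p$. Inside $R_r$ there are the subrepresentation isomorphic to $V_r\otimes\det^{p-1-r}$ (the image of the equivariant map $V_r\otimes\det^{p-1-r}\to R_r$) and the subrepresentation $W_r$ defined by the exact sequence $0\to W_r\to R_r\to V_r\otimes\det^{p-1-r}\to 0$; when $f\ge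 2$ or $r\ne 0$ the nonzero equivariant maps involved here are unique up to scalar. Let $\sigma=\bigotimes_{i=0}^{f-1}V_{r_i}^{\mathrm{Fr}^i}\otimes\det^a$ with $0\le r_i\le p-1$, $a\in\mathbb Z$, be a weight which is regular (no $r_i$ equals $p-1$) and of dimension at least $2$ (not all $r_i$ are $0$). Put $$R_\sigma=\Bigl(\bigotimes_{i=0}^{f-1}R_{r_i}^{\mathrm{Fr}^i}\Bigr)\otimes{\det}^{\,a+\sum_i p^ir_i},$$ and define the following subspaces of $R_\sigma$ (the twist does not change the underlying space): $$A_\sigma=\bigotimes_{i=0}^{f-1}W_{r_i}^{\mathrm{Fr}^i},\qquad A'_\sigma=\sum_{i=0}^{f-1}\Bigl(R_{r_i}^{\mathrm{Fr}^i}\otimes\bigotimes_{j\ne i}(V_{r_j}\otimes{\det}^{p-1-r_j})^{\mathrm{Fr}^j}\Bigr).$$ Let $M$ be a $\Gamma$-subrepresentation of $R_\sigma$. If $M\cap A'_\sigma\subseteq A_\sigma$, then $M\subseteq A_\sigma$. -/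

import Mathlib

open scoped TensorProduct
open MvPolynomial

noncomputable section

namespace SerreWeights

section Basic

variable (k F : Type*) [Field k] [Field F] [Algebra k F]

/-! ### Twists and symmetric powers -/

/-- The character `det ^ a` of `GL₂(k)`, with values in `F`. -/
def detPow (a : ℤ) : GL (Fin 2) k →* Fˣ :=
  (zpowGroupHom a).comp
    ((Units.map (algebraMap k F : k →* F)).comp Matrix.GeneralLinearGroup.det)

variable {F} in
/-- The twist `ρ ⊗ χ` of a representation by a character, on the same space. -/
def twist {G W : Type*} [Group G] [AddCommGroup W] [Module F W]
    (ρ : Representation F G W) (χ : G →* Fˣ) : Representation F G W where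
  toFun g := (χ g : F) • ρ g
  map_one' := by simp
  map_mul' g h := by
    ext v
    simp [smul_smul, mul_comm]

/-- `Sym^n F²`, realised as the homogeneous polynomials of degree `n` in two variables. -/
def Sym (n : ℕ) : Type _ := homogeneousSubmodule (Fin 2) F n

instance (n : ℕ) : AddCommGroup (Sym F n) :=
  inferInstanceAs (AddCommGroup (homogeneousSubmodule (Fin 2) F n))

instance (n : ℕ) : Module F (Sym F n) :=
  inferInstanceAs (Module F (homogeneousSubmodule (Fin 2) F n))

variable {F} in
/-- The linear substitution `X_j ↦ ∑ i, g i j • X_i`. -/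
def subst (g : Matrix (Fin 2) (Fin 2) F) :
    MvPolynomial (Fin 2) F →ₐ[F] MvPolynomial (Fin 2) F :=
  aeval fun j => ∑ i, C (g i j) * X i

variable {F} in
lemma subst_mem (g : Matrix (Fin 2) (Fin 2) F) (n : ℕ) (v : MvPolynomial (Fin 2) F)
    (hv : v ∈ homogeneousSubmodule (Fin 2) F n) :
    (subst g).toLinearMap v ∈ homogeneousSubmodule (Fin 2) F n := by
  rw [mem_homogeneousSubmodule] at hv ⊢
  have h := hv.aeval (fun j => ∑ i, C (g i j) * X i : Fin 2 → MvPolynomial (Fin 2) F) (n := 1)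
    (fun j => IsHomogeneous.sum _ _ _ fun i _ => by
      simpa using (isHomogeneous_C (Fin 2) (g i j)).mul (isHomogeneous_X F i))
  simpa [subst] using h

variable {F} in
lemma subst_one : subst (1 : Matrix (Fin 2) (Fin 2) F) = AlgHom.id F _ := by
  ext1 j
  fin_cases j <;> simp [subst]

variable {F} in
lemma subst_mul (g h : Matrix (Fin 2) (Fin 2) F) :
    subst (g * h) = (subst g).comp (subst h) := by
  ext1 j
  simp [subst, Fin.sum_univ_two, Matrix.mul_apply]
  ring

variable {F} in
/-- Restriction to `Sym^n F²` of an endomorphism of `F[X₀, X₁]` that preserves degree `n`. -/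
def Sym.restrict (n : ℕ) (φ : Module.End F (MvPolynomial (Fin 2) F))
    (hφ : ∀ v ∈ homogeneousSubmodule (Fin 2) F n, φ v ∈ homogeneousSubmodule (Fin 2) F n) :
    Module.End F (Sym F n) :=
  LinearMap.restrict (p := homogeneousSubmodule (Fin 2) F n)
    (q := homogeneousSubmodule (Fin 2) F n) φ hφ

/-- The representation `V_n = Sym^n F²` of `GL₂(k)`. -/
def symRep (n : ℕ) : Representation F (GL (Fin 2) k) (Sym F n) where
  toFun g := Sym.restrict n (subst (g.1.map (algebraMap k F))).toLinearMap (subst_mem _ n)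
  map_one' := by
    refine LinearMap.ext fun v => Subtype.ext ?_
    change subst _ v.1 = v.1
    simp [subst_one]
  map_mul' g h := by
    refine LinearMap.ext fun v => Subtype.ext ?_
    change subst _ v.1 = subst _ (subst _ v.1)
    simp [Matrix.map_mul, subst_mul]

/-! ### The representations `R_r`

On `V_m ⊗ V_n`, thought of as polynomials in `(x₀, x₁; y₀, y₁)` of bidegree `(m, n)`, consider the
`GL₂`-equivariant operator `K = D ∘ Ω`, where `D` is multiplication by the determinant
`x₀ y₁ - x₁ y₀` and `Ω = ∂/∂x₀ ∂/∂y₁ - ∂/∂x₁ ∂/∂y₀` is Cayley's operator. Up to sign and an additive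
constant it is the (split) Casimir operator of `𝔤𝔩₂`. -/

variable {F} in
lemma polar_mem (i j : Fin 2) (n : ℕ) (v : MvPolynomial (Fin 2) F)
    (hv : v ∈ homogeneousSubmodule (Fin 2) F n) :
    (LinearMap.mulLeft F (X i) ∘ₗ (pderiv j).toLinearMap) v ∈
      homogeneousSubmodule (Fin 2) F n := by
  rw [mem_homogeneousSubmodule] at hv ⊢
  change (X i * pderiv j v).IsHomogeneous n
  rcases n with _ | n
  · obtain ⟨c, rfl⟩ : ∃ c, v = C c :=
      ⟨_, totalDegree_eq_zero_iff_eq_C.mp ((totalDegree_zero_iff_isHomogeneous _).mpr hv)⟩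
    simpa using isHomogeneous_zero (Fin 2) F 0
  · simpa [add_comm] using (isHomogeneous_X F i).mul (hv.pderiv (i := j))

/-- The polarisation operator `X_i ∂/∂X_j` on `Sym^n F²`. -/
def polar (n : ℕ) (i j : Fin 2) : Module.End F (Sym F n) :=
  Sym.restrict n (LinearMap.mulLeft F (X i) ∘ₗ (pderiv j).toLinearMap) (polar_mem i j n)

/-- The operator `K = D ∘ Ω` on `Sym^m F² ⊗ Sym^n F²`. -/
def casimir (m n : ℕ) : Module.End F (Sym F m ⊗[F] Sym F n) :=
  TensorProduct.map (polar F m 0 0) (polar F n 1 1)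
    - TensorProduct.map (polar F m 0 1) (polar F n 1 0)
    - TensorProduct.map (polar F m 1 0) (polar F n 0 1)
    + TensorProduct.map (polar F m 1 1) (polar F n 0 0)

variable {F} in
lemma pderiv_subst (g : Matrix (Fin 2) (Fin 2) F) (j : Fin 2) (v : MvPolynomial (Fin 2) F) :
    pderiv j (subst g v) = ∑ l, C (g j l) * subst g (pderiv l v) := by
  induction v using MvPolynomial.induction_on with
  | C a => simp [subst]
  | add v w hv hw => simp [hv, hw, mul_add, Finset.sum_add_distrib]
  | mul_X v i hv =>
    have hX : pderiv j (subst g (X i)) = C (g j i) := by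
      fin_cases j <;> simp [subst, pderiv_X]
    rw [map_mul, Derivation.leibniz, hv, hX]
    fin_cases i <;> simp [pderiv_X, Pi.single_apply, Fin.sum_univ_two] <;> ring

variable {F} in
/-- Auxiliary: `v ↦ X_i · g(∂v/∂X_l)` on `Sym^n F²`. -/
lemma exists_aux (g : Matrix (Fin 2) (Fin 2) F) (n : ℕ) (v : Sym F n) :
    ∃ T : Fin 2 → Fin 2 → Sym F n,
      (∀ i j, polar F n i j (Sym.restrict n (subst g).toLinearMap (subst_mem g n) v)
        = g j 0 • T i 0 + g j 1 • T i 1) ∧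
      ∀ i l, Sym.restrict n (subst g).toLinearMap (subst_mem g n) (polar F n i l v)
        = g 0 i • T 0 l + g 1 i • T 1 l := by
  have hT : ∀ i l, X i * subst g (pderiv l v.1) ∈ homogeneousSubmodule (Fin 2) F n := by
    intro i l
    have hv := v.2
    rw [mem_homogeneousSubmodule] at hv ⊢
    rcases n with _ | n
    · obtain ⟨c, hc⟩ : ∃ c, v.1 = C c :=
        ⟨_, totalDegree_eq_zero_iff_eq_C.mp ((totalDegree_zero_iff_isHomogeneous _).mpr hv)⟩
      rw [hc]
      simpa using isHomogeneous_zero (Fin 2) F 0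
    · have := subst_mem g n _ ((mem_homogeneousSubmodule _ _).2 (hv.pderiv (i := l)))
      rw [mem_homogeneousSubmodule] at this
      simpa [add_comm] using (isHomogeneous_X F i).mul this
  have h₁ : ∀ i j, X i * pderiv j (subst g v.1) = g j 0 • (X i * subst g (pderiv 0 v.1))
      + g j 1 • (X i * subst g (pderiv 1 v.1)) := by
    intro i j
    rw [pderiv_subst, Fin.sum_univ_two, smul_eq_C_mul, smul_eq_C_mul]
    ring
  have h₂ : ∀ i l, subst g (X i * pderiv l v.1) = g 0 i • (X 0 * subst g (pderiv l v.1))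
      + g 1 i • (X 1 * subst g (pderiv l v.1)) := by
    intro i l
    have hX : subst g (X i) = C (g 0 i) * X 0 + C (g 1 i) * X 1 := by
      simp [subst, Fin.sum_univ_two]
    rw [map_mul, smul_eq_C_mul, smul_eq_C_mul, hX]
    ring
  exact ⟨fun i l => ⟨_, hT i l⟩, fun i j => Subtype.ext (h₁ i j), fun i l => Subtype.ext (h₂ i l)⟩

/-- `K` commutes with the action of `GL₂(k)` on `V_m ⊗ V_n`. -/
lemma casimir_commute (m n : ℕ) (g : GL (Fin 2) k) :
    Commute (casimir F m n) (((symRep k F m).tprod (symRep k F n)) g) := by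
  refine TensorProduct.ext' fun v w => ?_
  obtain ⟨T, hT, hT'⟩ := exists_aux (g.1.map (algebraMap k F)) m v
  obtain ⟨S, hS, hS'⟩ := exists_aux (g.1.map (algebraMap k F)) n w
  change casimir F m n (Sym.restrict m _ (subst_mem _ m) v ⊗ₜ[F] Sym.restrict n _ (subst_mem _ n) w)
    = TensorProduct.map (Sym.restrict m _ (subst_mem _ m)) (Sym.restrict n _ (subst_mem _ n))
      (casimir F m n (v ⊗ₜ[F] w))
  simp only [casimir, LinearMap.add_apply, LinearMap.sub_apply, TensorProduct.map_tmul, map_add,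
    map_sub, hT, hT', hS, hS', TensorProduct.add_tmul, TensorProduct.tmul_add,
    ← TensorProduct.smul_tmul', TensorProduct.tmul_smul]
  module

/-- The generalised `0`-eigenspace of `K` on `V_{p-1-r} ⊗ V_{p-1}`. As `K` acts on the
`GL₂`-subquotient `Sym^{2p-2-r-2j} ⊗ det^j` of `V_{p-1-r} ⊗ V_{p-1}` (`0 ≤ j ≤ p-1-r`) by
`-j (r + 1 + j)`, which vanishes in `F` only for `j = 0` and `j = p-1-r`, this is the direct summand
of dimension `2p` (for `r ≤ p - 2`) with graded pieces `V_r ⊗ det^{p-1-r}`,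
`V_{p-2-r} ⊗ V_1^{Fr}`, `V_r ⊗ det^{p-1-r}`. For `r = p - 1` it is all of `V_0 ⊗ V_{p-1}`. -/
def blockSubrep (p r : ℕ) :
    Subrepresentation ((symRep k F (p - 1 - r)).tprod (symRep k F (p - 1))) where
  toSubmodule := (casimir F (p - 1 - r) (p - 1)).maxGenEigenspace 0
  apply_mem_toSubmodule g _ hv :=
    Module.End.mapsTo_maxGenEigenspace_of_comm (casimir_commute k F _ _ g) 0 hv

/-- The underlying space of `R_r`. -/
def RSpace (p r : ℕ) : Type _ := (blockSubrep k F p r).toSubmodule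

instance (p r : ℕ) : AddCommGroup (RSpace k F p r) :=
  inferInstanceAs (AddCommGroup (blockSubrep k F p r).toSubmodule)

instance (p r : ℕ) : Module F (RSpace k F p r) :=
  inferInstanceAs (Module F (blockSubrep k F p r).toSubmodule)

/-- The representation `R_r ⊆ V_{p-1-r} ⊗ V_{p-1}` of `GL₂(k)`. -/
def RRep (p r : ℕ) : Representation F (GL (Fin 2) k) (RSpace k F p r) :=
  (blockSubrep k F p r).toRepresentation

/-- The representation `V_r ⊗ det^{p-1-r}` of `GL₂(k)`. -/
def twistedSym (p r : ℕ) : Representation F (GL (Fin 2) k) (Sym F r) :=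
  twist (symRep k F r) (detPow k F ((p : ℤ) - 1 - r))

/-- The subrepresentation `V_r ⊗ det^{p-1-r}` of `R_r`: the sum of the images of all equivariant
maps `V_r ⊗ det^{p-1-r} → R_r` (which are unique up to a scalar). -/
def VSub (p r : ℕ) : Submodule F (RSpace k F p r) :=
  ⨆ φ : (twistedSym k F p r).IntertwiningMap (RRep k F p r), LinearMap.range φ.toLinearMap

/-- The subrepresentation `W_r` of `R_r`, with `0 → W_r → R_r → V_r ⊗ det^{p-1-r} → 0` exact: the
common kernel of all equivariant maps `R_r → V_r ⊗ det^{p-1-r}` (which are unique up to a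
scalar). -/
def WSub (p r : ℕ) : Submodule F (RSpace k F p r) :=
  ⨅ φ : (RRep k F p r).IntertwiningMap (twistedSym k F p r), LinearMap.ker φ.toLinearMap

end Basic

/-! ### Tensor products over the embeddings -/

section Tensor

variable {F : Type*} [Field F] {ι : Type*} {U : ι → Type*} [∀ i, AddCommGroup (U i)]
  [∀ i, Module F (U i)]

/-- The tensor product of a family of representations of `G`. -/
def piRep {G : Type*} [Group G] (ρ : ∀ i, Representation F G (U i)) :
    Representation F G (⨂[F] i, U i) where
  toFun g := PiTensorProduct.map fun i => ρ i g
  map_one' := by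
    simp only [map_one]
    exact PiTensorProduct.map_one
  map_mul' g h := by
    simp only [map_mul]
    exact PiTensorProduct.map_mul _ _

/-- The subspace `⨂ N_i` of `⨂ U_i`. -/
def subTensor (N : ∀ i, Submodule F (U i)) : Submodule F (⨂[F] i, U i) :=
  LinearMap.range (PiTensorProduct.map fun i => (N i).subtype)

end Tensor

/-! ### Weights and the representations `R_σ`, `A_σ`, `A'_σ` -/

/-- The parameters of a weight `σ = (r_0, …, r_{f-1}) ⊗ det^a`. -/
structure Weight (p f : ℕ) where
  r : Fin f → ℕ
  r_le : ∀ i, r i ≤ p - 1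
  a : ℤ

namespace Weight

variable {p f : ℕ} (σ : Weight p f)

/-- A weight is regular if no `r_i` is equal to `p - 1`. -/
def IsRegular : Prop := ∀ i, σ.r i ≠ p - 1

section Reps

variable (k F : Type*) [Field k] [Field F] [Algebra k F] [Fact p.Prime] [CharP k p]

/-- The `i`-th power of the Frobenius of `GL₂(k)`, raising the matrix entries to the `p^i`. -/
def frob (p : ℕ) [Fact p.Prime] [CharP k p] (i : ℕ) : GL (Fin 2) k →* GL (Fin 2) k :=
  Matrix.GeneralLinearGroup.map (iterateFrobenius k p i)

/-- The weight `σ` itself, i.e. the representation `⨂ (Sym^{r_i} F²)^{Fr^i} ⊗ det^a`. -/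
def rep : Representation F (GL (Fin 2) k) (⨂[F] i, Sym F (σ.r i)) :=
  twist (piRep fun i => (symRep k F (σ.r i)).comp (frob k p i)) (detPow k F σ.a)

/-- The dimension of `σ`. -/
def dim : ℕ := Module.finrank F (⨂[F] i, Sym F (σ.r i))

/-- `R_σ = ⨂ R_{r_i}^{Fr^i}`, twisted by `det^(a + ∑ p^i r_i)`; there is no twist when
`a = -∑ p^i r_i`. -/
def R : Representation F (GL (Fin 2) k) (⨂[F] i, RSpace k F p (σ.r i)) :=
  twist (piRep fun i => (RRep k F p (σ.r i)).comp (frob k p i))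
    (detPow k F (σ.a + ∑ i : Fin f, (p : ℤ) ^ (i : ℕ) * σ.r i))

/-- `A_σ = ⨂ W_{r_i}^{Fr^i}`. -/
def A : Submodule F (⨂[F] i, RSpace k F p (σ.r i)) :=
  subTensor fun i => WSub k F p (σ.r i)

/-- `A'_{σ,i}`: the tensor product of `R_{r_i}^{Fr^i}` and of the
`(V_{r_j} ⊗ det^{p-1-r_j})^{Fr^j}` for `j ≠ i`. -/
def A'i (i : Fin f) : Submodule F (⨂[F] i, RSpace k F p (σ.r i)) :=
  subTensor (Function.update (fun j => VSub k F p (σ.r j)) i ⊤)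

/-- `A'_σ = ∑ i, A'_{σ,i}`. -/
def A' : Submodule F (⨂[F] i, RSpace k F p (σ.r i)) :=
  ⨆ i, σ.A'i k F i

end Reps

end Weight

end SerreWeights

end

/-! Everything is read off from the operator K = DΩ, where D is multiplication by x₀y₁ - x₁y₀ and Ω
is Cayley's operator. Put m = p-1-r and q = |k|. On V_m ⊗ V_{p-1} the Capelli-type identity
`iota_comp_cayleyPow` writes D^m Ω^m as a polynomial in K, and modulo p this polynomial is X·Q(X)
with Q(0) ≠ 0. Hence K² = 0 on R_r, and up to a nonzero scalar K is there the composite of Ω^m : R_r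
→ V_r ⊗ det^m with D^m : V_r ⊗ det^m → R_r. So K(R_r) lies in the copy of V_r
(`CayleyData.range_casimirR_le`) and ker K = W_r (`CayleyData.WSub_eq`); the second point requires
that every equivariant map R_r → V_r ⊗ det^m kills ker K.

Let L_i be K acting on the i-th factor. Then A_σ is the common kernel of the L_i
(`mem_subTensor_ker`), and A'_σ contains each T_i, the image of the tensor product of the K's on all
factors except the i-th. The image S of the tensor product of all the K's lies in every T_i.

The second input is that all nonzero subrepresentations share one vector h, the highest weight
vector of ⨂ V_{r_i} (`tprod_iotaR_mem`). Indeed a nonzero subrepresentation has a unipotent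
invariant; such an invariant is determined by its coordinates without y₁, of which L_i² = 0 leaves
few; the torus isolates one of them, and a combination of group elements carries the resulting
vector to h.

Suppose now that M is not inside A_σ, and let N be minimal among the subrepresentations of M not
inside A_σ. If L_i N ≠ 0, it contains h ∈ S, so N ∩ L_i⁻¹(S) is not inside A_σ and equals N; thus
L_i N ⊆ S for all i. Some L_i N is nonzero, and there is x ∈ N with L_i x = ℓ, the lowest weight
vector of the socle. Subtracting elements of the T_j from x gives a ∈ A_σ. Let E be the sum over the
torus diag(1, t) and u a unipotent element moving ℓ. The vector E a lies in the span of a u-fixed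
vector and ℓ (`sum_torGL_mem`), so (u-1)E a ∈ S. Therefore (u-1)E x ∈ N ∩ A'_σ ⊆ A_σ is killed by
L_i. But L_i (u-1)E x = -(u-1)ℓ ≠ 0, a contradiction. -/

open scoped TensorProduct
open MvPolynomial

noncomputable section

namespace SerreWeights

/-! ### Monomial coordinates on Sym^n and the action of elementary matrices. -/

section SymBasis

variable {F : Type*} [Field F]

/-- The inclusion of `Sym^n F²` in the polynomial ring. -/
def Sym.val (n : ℕ) : Sym F n →ₗ[F] MvPolynomial (Fin 2) F :=
  (homogeneousSubmodule (Fin 2) F n).subtype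

lemma Sym.val_injective (n : ℕ) : Function.Injective (Sym.val (F := F) n) :=
  Subtype.val_injective

lemma Sym.isHomogeneous_val {n : ℕ} (v : Sym F n) : (Sym.val n v).IsHomogeneous n :=
  (mem_homogeneousSubmodule _ _).1 v.2

/-- A homogeneous polynomial as an element of `Sym^n F²`. -/
def Sym.ofHomogeneous {n : ℕ} (v : MvPolynomial (Fin 2) F) (hv : v.IsHomogeneous n) : Sym F n :=
  (⟨v, (mem_homogeneousSubmodule _ _).2 hv⟩ : homogeneousSubmodule (Fin 2) F n)

lemma isHomogeneous_X_pow_mul_X_pow {n j : ℕ} (h : j ≤ n) :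
    (X 0 ^ (n - j) * X 1 ^ j : MvPolynomial (Fin 2) F).IsHomogeneous n := by
  have := (isHomogeneous_X_pow (R := F) (0 : Fin 2) (n - j)).mul
    (isHomogeneous_X_pow (R := F) (1 : Fin 2) j)
  rwa [Nat.sub_add_cancel h] at this

/-- The monomial `X₀^(n-j) X₁^j` of `Sym^n F²`, or `0` if `n < j`. -/
def mon (F : Type*) [Field F] (n j : ℕ) : Sym F n :=
  if h : j ≤ n then Sym.ofHomogeneous _ (isHomogeneous_X_pow_mul_X_pow h) else 0

lemma val_mon {n j : ℕ} (h : j ≤ n) : Sym.val n (mon F n j) = X 0 ^ (n - j) * X 1 ^ j := by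
  rw [mon, dif_pos h]; rfl

lemma mon_eq_zero {n j : ℕ} (h : n < j) : mon F n j = 0 := by
  rw [mon, dif_neg (by omega)]

/-- The coefficient of `X₀^(n-j) X₁^j`. -/
def coord (F : Type*) [Field F] (n j : ℕ) : Sym F n →ₗ[F] F :=
  lcoeff F (Finsupp.single 0 (n - j) + Finsupp.single 1 j) ∘ₗ Sym.val n

lemma coord_apply (n j : ℕ) (v : Sym F n) :
    coord F n j v = (Sym.val n v).coeff (Finsupp.single 0 (n - j) + Finsupp.single 1 j) := rfl

lemma X_pow_mul_X_pow (a b : ℕ) : (X 0 ^ a * X 1 ^ b : MvPolynomial (Fin 2) F)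
    = monomial (Finsupp.single 0 a + Finsupp.single 1 b) 1 := by
  rw [X_pow_eq_monomial, X_pow_eq_monomial, monomial_mul, one_mul]

lemma coord_mon {n i j : ℕ} (h : i ≤ n) : coord F n j (mon F n i) = if i = j then 1 else 0 := by
  rw [coord_apply, val_mon h, X_pow_mul_X_pow, coeff_monomial]
  refine if_congr ⟨fun h => ?_, fun h => h ▸ rfl⟩ rfl rfl
  simpa using DFunLike.congr_fun h 1

lemma coord_eq_zero {n j : ℕ} (h : n < j) (v : Sym F n) : coord F n j v = 0 := by
  refine (Sym.isHomogeneous_val v).coeff_eq_zero ?_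
  simp [Finsupp.degree_eq_sum, Fin.sum_univ_two]
  omega

lemma Sym.eq_sum_coord {n : ℕ} (v : Sym F n) :
    v = ∑ j ∈ Finset.range (n + 1), coord F n j v • mon F n j := by
  apply Sym.val_injective
  rw [map_sum]
  ext d
  rw [coeff_sum]
  by_cases hd : d.degree = n
  · have hd' : d 0 + d 1 = n := by simpa [Finsupp.degree_eq_sum, Fin.sum_univ_two] using hd
    have hde : d = Finsupp.single 0 (n - d 1) + Finsupp.single 1 (d 1) := by
      ext i
      fin_cases i
      · simp; omega
      · simp
    rw [Finset.sum_eq_single (d 1)]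
    · rw [map_smul, coeff_smul, val_mon (by omega), X_pow_mul_X_pow, ← hde, coeff_monomial,
        if_pos rfl, smul_eq_mul, mul_one, coord_apply, ← hde]
    · intro j hj hne
      rw [map_smul, coeff_smul, val_mon (by simpa [Nat.lt_succ_iff] using hj), X_pow_mul_X_pow,
        coeff_monomial, if_neg, smul_zero]
      intro h
      exact hne (by simpa using DFunLike.congr_fun h 1)
    · intro h
      exact absurd (Finset.mem_range.2 (by omega)) h
  · rw [(Sym.isHomogeneous_val v).coeff_eq_zero hd]
    refine (Finset.sum_eq_zero fun j _ => ?_).symm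
    rw [map_smul, coeff_smul, (Sym.isHomogeneous_val _).coeff_eq_zero hd, smul_zero]

lemma Sym.hom_ext {n : ℕ} {V : Type*} [AddCommGroup V] [Module F V] {φ ψ : Sym F n →ₗ[F] V}
    (h : ∀ j ≤ n, φ (mon F n j) = ψ (mon F n j)) : φ = ψ := by
  ext v
  rw [Sym.eq_sum_coord v, map_sum, map_sum]
  refine Finset.sum_congr rfl fun j hj => ?_
  rw [map_smul, map_smul, h j (by simpa [Nat.lt_succ_iff] using hj)]

lemma Sym.ext_coord {n : ℕ} {v w : Sym F n} (h : ∀ j ≤ n, coord F n j v = coord F n j w) :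
    v = w := by
  rw [Sym.eq_sum_coord v, Sym.eq_sum_coord w]
  refine Finset.sum_congr rfl fun j hj => ?_
  rw [h j (by simpa [Nat.lt_succ_iff] using hj)]

/-- The action of a matrix on `Sym^n F²`. -/
def symAct (n : ℕ) (g : Matrix (Fin 2) (Fin 2) F) : Module.End F (Sym F n) :=
  Sym.restrict n (subst g).toLinearMap (subst_mem g n)

lemma val_symAct (n : ℕ) (g : Matrix (Fin 2) (Fin 2) F) (v : Sym F n) :
    Sym.val n (symAct n g v) = subst g (Sym.val n v) := rfl

lemma symAct_mul (n : ℕ) (g h : Matrix (Fin 2) (Fin 2) F) :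
    symAct n (g * h) = symAct n g * symAct n h := by
  ext v
  apply Sym.val_injective
  simp [val_symAct, subst_mul]

lemma symAct_one (n : ℕ) : symAct n (1 : Matrix (Fin 2) (Fin 2) F) = 1 := by
  ext v
  apply Sym.val_injective
  simp [val_symAct, subst_one]

lemma subst_X (g : Matrix (Fin 2) (Fin 2) F) (j : Fin 2) :
    subst g (X j) = C (g 0 j) * X 0 + C (g 1 j) * X 1 := by
  simp [subst, Fin.sum_univ_two]

/-- Upper unipotent matrices. -/
def uni {R : Type*} [CommRing R] (μ : R) : Matrix (Fin 2) (Fin 2) R := !![1, μ; 0, 1]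

/-- The diagonal matrices `diag(1, t)`. -/
def tor {R : Type*} [CommRing R] (t : R) : Matrix (Fin 2) (Fin 2) R := !![1, 0; 0, t]

/-- The permutation matrix. -/
def weyl (R : Type*) [CommRing R] : Matrix (Fin 2) (Fin 2) R := !![0, 1; 1, 0]

lemma uni_mul {R : Type*} [CommRing R] (a b : R) : uni a * uni b = uni (a + b) := by
  simp [uni, add_comm]

lemma uni_zero {R : Type*} [CommRing R] : uni (0 : R) = 1 := by
  simp [uni, Matrix.one_fin_two]

/-- The divided power `X₀^t/t! ∂^t/∂X₁^t`. -/
def divPow (F : Type*) [Field F] (n t : ℕ) : Module.End F (Sym F n) :=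
  ∑ j ∈ Finset.range (n + 1), (coord F n j).smulRight ((j.choose t : F) • mon F n (j - t))

lemma divPow_mon {n j : ℕ} (t : ℕ) (h : j ≤ n) :
    divPow F n t (mon F n j) = (j.choose t : F) • mon F n (j - t) := by
  rw [divPow, LinearMap.sum_apply, Finset.sum_eq_single j]
  · simp [coord_mon h]
  · intro i _ hi
    simp [coord_mon h, hi.symm]
  · intro hj
    exact absurd (Finset.mem_range.2 (by omega)) hj

lemma divPow_eq_zero {n t : ℕ} (h : n < t) : divPow F n t = 0 :=
  Sym.hom_ext fun j hj => by
    rw [divPow_mon t hj, Nat.choose_eq_zero_of_lt (by omega)]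
    simp

lemma coord_divPow (n t a : ℕ) (v : Sym F n) :
    coord F n a (divPow F n t v) = ((a + t).choose t : F) * coord F n (a + t) v := by
  have : coord F n a ∘ₗ divPow F n t = ((a + t).choose t : F) • coord F n (a + t) := by
    refine Sym.hom_ext fun j hj => ?_
    simp only [LinearMap.comp_apply, divPow_mon t hj, map_smul, LinearMap.smul_apply,
      coord_mon hj, coord_mon (show j - t ≤ n by omega), smul_eq_mul]
    by_cases h : t ≤ j
    · by_cases h' : j = a + t
      · rw [if_pos (by omega), if_pos h', h']
      · rw [if_neg (by omega), if_neg h', mul_zero, mul_zero]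
    · rw [Nat.choose_eq_zero_of_lt (by omega), if_neg (show j ≠ a + t by omega)]
      simp
  simpa using LinearMap.congr_fun this v

/-- This is the binomial theorem. The bound `N` is left free so that factors of different degrees
can share one range of summation. -/
lemma symAct_uni (n : ℕ) (μ : F) {N : ℕ} (hN : n < N) :
    symAct n (uni μ) = ∑ t ∈ Finset.range N, μ ^ t • divPow F n t := by
  refine Sym.hom_ext fun j hj => ?_
  apply Sym.val_injective
  have h0 : subst (uni μ) (X 0 : MvPolynomial (Fin 2) F) = X 0 := by simp [subst_X, uni]
  have h1 : subst (uni μ) (X 1 : MvPolynomial (Fin 2) F) = C μ * X 0 + X 1 := by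
    simp [subst_X, uni]
  rw [val_symAct, val_mon hj, map_mul, map_pow, map_pow, h0, h1, add_pow, LinearMap.sum_apply,
    map_sum, Finset.mul_sum,
    ← Finset.sum_subset (Finset.range_subset_range.2 (show j + 1 ≤ N by omega))]
  · refine Finset.sum_congr rfl fun t ht => ?_
    have ht' : t ≤ j := by simpa [Nat.lt_succ_iff] using ht
    rw [LinearMap.smul_apply, divPow_mon t hj, smul_smul, map_smul, val_mon (by omega),
      smul_eq_C_mul, show n - (j - t) = n - j + t by omega, pow_add, mul_pow, map_mul, map_pow,
      map_natCast]
    ring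
  · intro t _ ht
    have ht' : j < t := by simpa [Nat.lt_succ_iff] using ht
    rw [LinearMap.smul_apply, divPow_mon t hj, Nat.choose_eq_zero_of_lt ht']
    simp

lemma symAct_tor_mon (n j : ℕ) (t : F) : symAct n (tor t) (mon F n j) = t ^ j • mon F n j := by
  by_cases hj : j ≤ n
  · apply Sym.val_injective
    have h0 : subst (tor t) (X 0 : MvPolynomial (Fin 2) F) = X 0 := by simp [subst_X, tor]
    have h1 : subst (tor t) (X 1 : MvPolynomial (Fin 2) F) = C t * X 1 := by simp [subst_X, tor]
    rw [val_symAct, map_smul, val_mon hj, map_mul, map_pow, map_pow, h0, h1, mul_pow,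
      smul_eq_C_mul, map_pow]
    ring
  · simp [mon_eq_zero (not_le.1 hj)]

lemma coord_symAct_tor (n j : ℕ) (t : F) (v : Sym F n) :
    coord F n j (symAct n (tor t) v) = t ^ j * coord F n j v := by
  have : coord F n j ∘ₗ symAct n (tor t) = t ^ j • coord F n j := by
    refine Sym.hom_ext fun i hi => ?_
    simp only [LinearMap.comp_apply, symAct_tor_mon, map_smul, LinearMap.smul_apply, coord_mon hi]
    split_ifs with h <;> simp [h]
  simpa using LinearMap.congr_fun this v

lemma symAct_weyl_mon {n j : ℕ} (hj : j ≤ n) :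
    symAct n (weyl F) (mon F n j) = mon F n (n - j) := by
  apply Sym.val_injective
  have h0 : subst (weyl F) (X 0 : MvPolynomial (Fin 2) F) = X 1 := by simp [subst_X, weyl]
  have h1 : subst (weyl F) (X 1 : MvPolynomial (Fin 2) F) = X 0 := by simp [subst_X, weyl]
  rw [val_symAct, val_mon hj, val_mon (by omega), map_mul, map_pow, map_pow, h0, h1,
    show n - (n - j) = j by omega, mul_comm]

lemma val_polar (n : ℕ) (i j : Fin 2) (v : Sym F n) :
    Sym.val n (polar F n i j v) = X i * pderiv j (Sym.val n v) := rfl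

lemma polar_zero_zero_mon {n j : ℕ} (hj : j ≤ n) :
    polar F n 0 0 (mon F n j) = ((n : F) - j) • mon F n j := by
  apply Sym.val_injective
  obtain ⟨d, rfl⟩ := Nat.exists_eq_add_of_le hj
  rw [val_polar, map_smul, val_mon hj, smul_eq_C_mul, Nat.add_sub_cancel_left]
  rcases d with _ | d
  · simp [pderiv_X]
  · simp [Derivation.leibniz, Derivation.leibniz_pow, pderiv_X]
    ring

lemma polar_one_one_mon {n j : ℕ} (hj : j ≤ n) :
    polar F n 1 1 (mon F n j) = (j : F) • mon F n j := by
  apply Sym.val_injective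
  rw [val_polar, map_smul, val_mon hj, smul_eq_C_mul]
  rcases j with _ | j
  · simp [Derivation.leibniz_pow, pderiv_X]
  · simp [Derivation.leibniz, Derivation.leibniz_pow, pderiv_X]
    ring

lemma polar_zero_one_mon {n j : ℕ} (hj : j ≤ n) :
    polar F n 0 1 (mon F n j) = (j : F) • mon F n (j - 1) := by
  apply Sym.val_injective
  rw [val_polar, map_smul, val_mon hj, val_mon (by omega), smul_eq_C_mul]
  rcases j with _ | j
  · simp [Derivation.leibniz_pow, pderiv_X]
  · obtain ⟨d, rfl⟩ := Nat.exists_eq_add_of_le hj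
    simp [Derivation.leibniz, Derivation.leibniz_pow, pderiv_X,
      show j + 1 + d - j = d + 1 by omega]
    ring

lemma polar_one_zero_mon {n j : ℕ} (hj : j ≤ n) :
    polar F n 1 0 (mon F n j) = ((n : F) - j) • mon F n (j + 1) := by
  apply Sym.val_injective
  obtain ⟨d, rfl⟩ := Nat.exists_eq_add_of_le hj
  rcases d with _ | d
  · rw [val_polar, map_smul, val_mon hj, smul_eq_C_mul]
    simp [Derivation.leibniz_pow, pderiv_X]
  · rw [val_polar, map_smul, val_mon hj, val_mon (by omega), smul_eq_C_mul,
      Nat.add_sub_cancel_left, show j + (d + 1) - (j + 1) = d by omega]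
    simp [Derivation.leibniz, Derivation.leibniz_pow, pderiv_X]
    ring

end SymBasis

/-! ### The operators D and Ω and the Capelli-type identity for D^m Ω^m. -/

section Cayley

variable {F : Type*} [Field F]

/-- Multiplication by `X_i`. -/
def mulX (F : Type*) [Field F] (n : ℕ) (i : Fin 2) : Sym F n →ₗ[F] Sym F (n + 1) :=
  LinearMap.restrict (p := homogeneousSubmodule (Fin 2) F n)
    (q := homogeneousSubmodule (Fin 2) F (n + 1)) (LinearMap.mulLeft F (X i)) fun v hv => by
      rw [mem_homogeneousSubmodule] at hv ⊢
      simpa [add_comm] using (isHomogeneous_X F i).mul hv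

/-- The partial derivative with respect to `X_i`. -/
def partialX (F : Type*) [Field F] (n : ℕ) (i : Fin 2) : Sym F (n + 1) →ₗ[F] Sym F n :=
  LinearMap.restrict (p := homogeneousSubmodule (Fin 2) F (n + 1))
    (q := homogeneousSubmodule (Fin 2) F n) (pderiv i).toLinearMap fun v hv => by
      rw [mem_homogeneousSubmodule] at hv ⊢
      simpa using hv.pderiv (i := i)

lemma val_mulX (n : ℕ) (i : Fin 2) (v : Sym F n) :
    Sym.val _ (mulX F n i v) = X i * Sym.val _ v := rfl

lemma val_partialX (n : ℕ) (i : Fin 2) (v : Sym F (n + 1)) :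
    Sym.val _ (partialX F n i v) = pderiv i (Sym.val _ v) := rfl

lemma partialX_mulX (n : ℕ) (i j : Fin 2) (v : Sym F n) :
    partialX F n j (mulX F n i v) = polar F n i j v + (if i = j then 1 else 0 : F) • v := by
  apply Sym.val_injective
  rw [map_add, map_smul, val_partialX, val_mulX, val_polar, Derivation.leibniz, pderiv_X,
    Pi.single_apply]
  split_ifs <;> simp_all

/-- Euler's identity for homogeneous polynomials; it makes ΩD - DΩ a scalar. -/
lemma polar_add_polar (n : ℕ) (v : Sym F n) :
    polar F n 1 1 v = (n : F) • v - polar F n 0 0 v := by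
  have : polar F n 1 1 = (n : F) • LinearMap.id - polar F n 0 0 := Sym.hom_ext fun j hj => by
    simp only [polar_one_one_mon hj, LinearMap.sub_apply, LinearMap.smul_apply,
      polar_zero_zero_mon hj, LinearMap.id_apply]
    module
  simpa using LinearMap.congr_fun this v

lemma symAct_mulX (n : ℕ) (g : Matrix (Fin 2) (Fin 2) F) (i : Fin 2) (v : Sym F n) :
    symAct (n + 1) g (mulX F n i v)
      = g 0 i • mulX F n 0 (symAct n g v) + g 1 i • mulX F n 1 (symAct n g v) := by
  apply Sym.val_injective
  simp only [val_symAct, val_mulX, map_add, map_smul, map_mul, subst_X, smul_eq_C_mul]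
  ring

lemma partialX_symAct (n : ℕ) (g : Matrix (Fin 2) (Fin 2) F) (i : Fin 2) (v : Sym F (n + 1)) :
    partialX F n i (symAct (n + 1) g v)
      = g i 0 • symAct n g (partialX F n 0 v) + g i 1 • symAct n g (partialX F n 1 v) := by
  apply Sym.val_injective
  simp only [val_symAct, val_partialX, map_add, map_smul, pderiv_subst, smul_eq_C_mul,
    Fin.sum_univ_two]

/-- The action of a matrix on `Sym^m F² ⊗ Sym^n F²`. -/
def tensorAct (m n : ℕ) (g : Matrix (Fin 2) (Fin 2) F) :
    Module.End F (Sym F m ⊗[F] Sym F n) :=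
  TensorProduct.map (symAct m g) (symAct n g)

@[simp] lemma tensorAct_tmul (m n : ℕ) (g : Matrix (Fin 2) (Fin 2) F) (v : Sym F m) (w : Sym F n) :
    tensorAct m n g (v ⊗ₜ w) = symAct m g v ⊗ₜ symAct n g w := rfl

lemma tensorAct_mul (m n : ℕ) (g h : Matrix (Fin 2) (Fin 2) F) :
    tensorAct m n (g * h) = tensorAct m n g * tensorAct m n h := by
  rw [tensorAct, symAct_mul, symAct_mul, TensorProduct.map_mul]; rfl

lemma tensorAct_one (m n : ℕ) : tensorAct m n (1 : Matrix (Fin 2) (Fin 2) F) = 1 := by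
  rw [tensorAct, symAct_one, symAct_one, TensorProduct.map_one]

/-- Multiplication by the determinant `x₀ y₁ - x₁ y₀`. -/
def detMul (F : Type*) [Field F] (m n : ℕ) :
    Sym F m ⊗[F] Sym F n →ₗ[F] Sym F (m + 1) ⊗[F] Sym F (n + 1) :=
  TensorProduct.map (mulX F m 0) (mulX F n 1) - TensorProduct.map (mulX F m 1) (mulX F n 0)

/-- Cayley's operator. -/
def cayley (F : Type*) [Field F] (m n : ℕ) :
    Sym F (m + 1) ⊗[F] Sym F (n + 1) →ₗ[F] Sym F m ⊗[F] Sym F n :=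
  TensorProduct.map (partialX F m 0) (partialX F n 1)
    - TensorProduct.map (partialX F m 1) (partialX F n 0)

lemma mulX_partialX (n : ℕ) (i j : Fin 2) (v : Sym F (n + 1)) :
    mulX F n i (partialX F n j v) = polar F (n + 1) i j v := rfl

lemma detMul_comp_cayley (m n : ℕ) :
    detMul F m n ∘ₗ cayley F m n = casimir F (m + 1) (n + 1) := by
  refine TensorProduct.ext' fun v w => ?_
  simp only [detMul, cayley, casimir, LinearMap.comp_apply, LinearMap.sub_apply,
    LinearMap.add_apply, TensorProduct.map_tmul, map_sub, mulX_partialX]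
  abel

lemma cayley_comp_detMul (m n : ℕ) :
    cayley F m n ∘ₗ detMul F m n = casimir F m n + ((m + n + 2 : ℕ) : F) • LinearMap.id := by
  refine TensorProduct.ext' fun v w => ?_
  simp only [detMul, cayley, casimir, LinearMap.comp_apply, LinearMap.sub_apply,
    LinearMap.add_apply, TensorProduct.map_tmul, map_sub, partialX_mulX, LinearMap.smul_apply,
    LinearMap.id_apply, polar_add_polar]
  simp only [TensorProduct.add_tmul, TensorProduct.tmul_add, TensorProduct.sub_tmul,
    TensorProduct.tmul_sub, ← TensorProduct.smul_tmul', TensorProduct.tmul_smul]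
  push_cast
  simp
  module

lemma tensorAct_detMul (m n : ℕ) (g : Matrix (Fin 2) (Fin 2) F) (x : Sym F m ⊗[F] Sym F n) :
    tensorAct (m + 1) (n + 1) g (detMul F m n x) = g.det • detMul F m n (tensorAct m n g x) := by
  suffices h : tensorAct (m + 1) (n + 1) g ∘ₗ detMul F m n
      = g.det • (detMul F m n ∘ₗ tensorAct m n g) from LinearMap.congr_fun h x
  refine TensorProduct.ext' fun v w => ?_
  simp only [detMul, LinearMap.comp_apply, LinearMap.sub_apply, TensorProduct.map_tmul, map_sub,
    LinearMap.smul_apply, tensorAct_tmul, symAct_mulX, Matrix.det_fin_two]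
  simp only [TensorProduct.add_tmul, TensorProduct.tmul_add, ← TensorProduct.smul_tmul',
    TensorProduct.tmul_smul]
  module

lemma cayley_tensorAct (m n : ℕ) (g : Matrix (Fin 2) (Fin 2) F)
    (x : Sym F (m + 1) ⊗[F] Sym F (n + 1)) :
    cayley F m n (tensorAct (m + 1) (n + 1) g x) = g.det • tensorAct m n g (cayley F m n x) := by
  suffices h : cayley F m n ∘ₗ tensorAct (m + 1) (n + 1) g
      = g.det • (tensorAct m n g ∘ₗ cayley F m n) from LinearMap.congr_fun h x
  refine TensorProduct.ext' fun v w => ?_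
  simp only [cayley, LinearMap.comp_apply, LinearMap.sub_apply, TensorProduct.map_tmul, map_sub,
    LinearMap.smul_apply, tensorAct_tmul, partialX_symAct, Matrix.det_fin_two]
  simp only [TensorProduct.add_tmul, TensorProduct.tmul_add, ← TensorProduct.smul_tmul',
    TensorProduct.tmul_smul]
  module

lemma casimir_zero_left (n : ℕ) : casimir F 0 n = 0 := by
  have h00 : polar F 0 0 0 = 0 := Sym.hom_ext fun j hj => by
    obtain rfl : j = 0 := by omega
    simp [polar_zero_zero_mon]
  have h01 : polar F 0 0 1 = 0 := Sym.hom_ext fun j hj => by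
    obtain rfl : j = 0 := by omega
    simp [polar_zero_one_mon]
  have h10 : polar F 0 1 0 = 0 := Sym.hom_ext fun j hj => by
    obtain rfl : j = 0 := by omega
    simp [polar_one_zero_mon]
  have h11 : polar F 0 1 1 = 0 := Sym.hom_ext fun j hj => by
    obtain rfl : j = 0 := by omega
    simp [polar_one_one_mon]
  simp [casimir, h00, h01, h10, h11]

/-- The map `v ↦ (x₀ y₁ - x₁ y₀)^m v(y)`. -/
def iota (F : Type*) [Field F] (r : ℕ) : (m : ℕ) → Sym F r →ₗ[F] Sym F m ⊗[F] Sym F (r + m)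
  | 0 => TensorProduct.mk F _ _ (mon F 0 0)
  | m + 1 => detMul F m (r + m) ∘ₗ iota F r m

/-- The `m`-th power of Cayley's operator. -/
def cayleyPow (F : Type*) [Field F] (r : ℕ) : (m : ℕ) → Sym F m ⊗[F] Sym F (r + m) →ₗ[F] Sym F r
  | 0 => (TensorProduct.lid F _).toLinearMap ∘ₗ TensorProduct.map (coord F 0 0) LinearMap.id
  | m + 1 => cayleyPow F r m ∘ₗ cayley F m (r + m)

lemma symAct_zero_mon (g : Matrix (Fin 2) (Fin 2) F) : symAct 0 g (mon F 0 0) = mon F 0 0 := by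
  apply Sym.val_injective
  simp [val_symAct, val_mon]

lemma symAct_zero (g : Matrix (Fin 2) (Fin 2) F) : symAct 0 g = LinearMap.id :=
  Sym.hom_ext fun j hj => by
    obtain rfl : j = 0 := by omega
    exact symAct_zero_mon g

lemma tensorAct_iota (r m : ℕ) (g : Matrix (Fin 2) (Fin 2) F) (v : Sym F r) :
    tensorAct m (r + m) g (iota F r m v) = g.det ^ m • iota F r m (symAct r g v) := by
  induction m with
  | zero => simp [iota, symAct_zero]
  | succ m ih =>
    change tensorAct (m + 1) (r + m + 1) g (detMul F m (r + m) (iota F r m v)) =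
      _ • detMul F m (r + m) (iota F r m (symAct r g v))
    rw [tensorAct_detMul, ih, map_smul, smul_smul, pow_succ']

lemma cayleyPow_tensorAct (r m : ℕ) (g : Matrix (Fin 2) (Fin 2) F)
    (x : Sym F m ⊗[F] Sym F (r + m)) :
    cayleyPow F r m (tensorAct m (r + m) g x) = g.det ^ m • symAct r g (cayleyPow F r m x) := by
  induction m with
  | zero =>
    induction x with
    | zero => simp
    | add x y hx hy => simp only [map_add, hx, hy, smul_add]
    | tmul v w => simp [cayleyPow, symAct_zero]
  | succ m ih =>
    change cayleyPow F r m (cayley F m (r + m) (tensorAct (m + 1) (r + m + 1) g x)) =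
      _ • symAct r g (cayleyPow F r m (cayley F m (r + m) x))
    rw [cayley_tensorAct, map_smul, ih, smul_smul, pow_succ']

/-- DΩD bracketed in two ways: multiplication by D shifts the eigenvalues of K by m + n + 2. -/
lemma casimir_detMul (m n : ℕ) : casimir F (m + 1) (n + 1) ∘ₗ detMul F m n
    = detMul F m n ∘ₗ (casimir F m n + ((m + n + 2 : ℕ) : F) • LinearMap.id) := by
  rw [← detMul_comp_cayley, LinearMap.comp_assoc, cayley_comp_detMul]

/-- The shifts produced by the m factors D add up to m(r + 1 + m). This vanishes in characteristic p
= r + 1 + m, which places the image of `iota` in ker K. -/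
lemma casimir_iota (r m : ℕ) (v : Sym F r) : casimir F m (r + m) (iota F r m v)
    = ((m * (r + 1 + m) : ℕ) : F) • iota F r m v := by
  induction m with
  | zero => simp [casimir_zero_left]
  | succ m ih =>
    change (casimir F (m + 1) (r + m + 1) ∘ₗ detMul F m (r + m)) (iota F r m v) =
      _ • detMul F m (r + m) (iota F r m v)
    rw [casimir_detMul, LinearMap.comp_apply, LinearMap.add_apply, ih, LinearMap.smul_apply,
      LinearMap.id_apply, ← add_smul, map_smul]
    congr 1
    push_cast
    ring

lemma comp_aeval_of_comp_eq {V W : Type*} [AddCommGroup V] [Module F V] [AddCommGroup W]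
    [Module F W] {A : Module.End F V} {B : Module.End F W} {D : V →ₗ[F] W}
    (h : D ∘ₗ A = B ∘ₗ D) (P : Polynomial F) :
    D ∘ₗ Polynomial.aeval A P = Polynomial.aeval B P ∘ₗ D := by
  induction P using Polynomial.induction_on with
  | C a => ext x; simp [Module.algebraMap_end_apply]
  | add P Q hP hQ => simp only [map_add, LinearMap.comp_add, LinearMap.add_comp, hP, hQ]
  | monomial n a ih =>
    ext x
    have h1 := LinearMap.congr_fun ih (A x)
    have h2 := LinearMap.congr_fun h x
    simp only [map_mul, Polynomial.aeval_C, map_pow, Polynomial.aeval_X, LinearMap.comp_apply,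
      Module.End.mul_apply, Module.algebraMap_end_apply, pow_succ] at h1 h2 ⊢
    rw [h1, h2]

/-- The polynomial expressing `D^m Ω^m` in terms of `D Ω`. -/
def capelli (F : Type*) [Field F] (r m : ℕ) : Polynomial F :=
  ∏ i ∈ Finset.range m, (Polynomial.X - Polynomial.C ((i : F) * (r + 2 * m + 1 - i)))

/-- Mirrors D(D^m Ω^m)Ω: carrying the outer D through a polynomial in K replaces K by K - (r + 2m +
2), and DΩ supplies the factor X. -/
lemma capelli_succ (r m : ℕ) : capelli F r (m + 1)
    = Polynomial.X * (capelli F r m).comp (Polynomial.X - Polynomial.C (r + 2 * m + 2 : F)) := by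
  rw [capelli, Finset.prod_range_succ', mul_comm, capelli, Polynomial.prod_comp]
  congr 1
  · simp
  · refine Finset.prod_congr rfl fun i _ => ?_
    simp only [Polynomial.sub_comp, Polynomial.X_comp, Polynomial.C_comp, sub_sub,
      ← Polynomial.C_add]
    congr 2
    push_cast
    ring

lemma iota_comp_cayleyPow (r m : ℕ) :
    iota F r m ∘ₗ cayleyPow F r m = Polynomial.aeval (casimir F m (r + m)) (capelli F r m) := by
  induction m with
  | zero =>
    simp only [capelli, Finset.range_zero, Finset.prod_empty, map_one]
    refine TensorProduct.ext' fun v w => ?_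
    have hv : v = coord F 0 0 v • mon F 0 0 := by
      conv_lhs => rw [Sym.eq_sum_coord v]
      simp
    simp only [iota, cayleyPow, LinearMap.comp_apply, TensorProduct.map_tmul, LinearEquiv.coe_coe,
      TensorProduct.lid_tmul, LinearMap.id_apply, map_smul, TensorProduct.mk_apply,
      Module.End.one_apply]
    conv_rhs => rw [hv]
    rw [TensorProduct.smul_tmul']
  | succ m ih =>
    have h : detMul F m (r + m) ∘ₗ casimir F m (r + m)
        = (casimir F (m + 1) (r + m + 1)
          - algebraMap F (Module.End F _) (r + 2 * m + 2 : F)) ∘ₗ detMul F m (r + m) := by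
      rw [LinearMap.sub_comp, casimir_detMul]
      refine LinearMap.ext fun x => ?_
      simp [Module.algebraMap_end_apply]
      module
    change detMul F m (r + m) ∘ₗ (iota F r m ∘ₗ cayleyPow F r m) ∘ₗ cayley F m (r + m) =
      Polynomial.aeval (casimir F (m + 1) (r + m + 1)) _
    rw [ih, ← LinearMap.comp_assoc, comp_aeval_of_comp_eq h, LinearMap.comp_assoc,
      detMul_comp_cayley, capelli_succ, mul_comm Polynomial.X, map_mul, Polynomial.aeval_comp]
    simp only [Polynomial.aeval_X, map_sub, Polynomial.aeval_C]
    rfl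

lemma partialX_zero_mon (n j : ℕ) (hj : j ≤ n) :
    partialX F n 0 (mon F (n + 1) j) = ((n : F) + 1 - j) • mon F n j := by
  apply Sym.val_injective
  obtain ⟨d, rfl⟩ := Nat.exists_eq_add_of_le hj
  rw [val_partialX, map_smul, val_mon hj, val_mon (by omega), smul_eq_C_mul,
    Nat.add_sub_cancel_left, show j + d + 1 - j = d + 1 by omega]
  simp [Derivation.leibniz, Derivation.leibniz_pow, pderiv_X]
  ring

lemma partialX_one_mon (n j : ℕ) (hj : j ≤ n) :
    partialX F n 1 (mon F (n + 1) (j + 1)) = ((j : F) + 1) • mon F n j := by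
  apply Sym.val_injective
  rw [val_partialX, map_smul, val_mon hj, val_mon (by omega), smul_eq_C_mul,
    show n + 1 - (j + 1) = n - j by omega]
  simp [Derivation.leibniz, Derivation.leibniz_pow, pderiv_X]
  ring

lemma partialX_one_mon_zero (n : ℕ) : partialX F n 1 (mon F (n + 1) 0) = 0 := by
  apply Sym.val_injective
  rw [val_partialX, val_mon (by omega)]
  simp [Derivation.leibniz_pow, pderiv_X]

/-- Without x₁ only the term ∂/∂x₀ ∂/∂y₁ of Ω contributes. For m < p the value is nonzero, and this
is the source of a preimage of `iota F r m (mon F r 0)` under K. -/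
lemma cayleyPow_mon (r m : ℕ) : cayleyPow F r m (mon F m 0 ⊗ₜ mon F (r + m) m)
    = ((m.factorial : F) ^ 2) • mon F r 0 := by
  induction m with
  | zero => simp [cayleyPow, coord_mon]
  | succ m ih =>
    change cayleyPow F r m (cayley F m (r + m) (mon F (m + 1) 0 ⊗ₜ mon F (r + m + 1) (m + 1))) = _
    rw [cayley, LinearMap.sub_apply, TensorProduct.map_tmul, TensorProduct.map_tmul,
      partialX_one_mon_zero, partialX_zero_mon _ _ (by omega), partialX_one_mon _ _ (by omega),
      TensorProduct.zero_tmul, sub_zero, ← TensorProduct.smul_tmul', TensorProduct.tmul_smul,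
      map_smul, map_smul, ih, smul_smul, smul_smul, Nat.factorial_succ]
    congr 1
    push_cast
    ring

end Cayley

/-! ### Coordinates and weights on Sym^m ⊗ Sym^n; the kernel of K in weight m. -/

section Coordinates

variable {F : Type*} [Field F]

lemma coord_polar_zero_zero (n a : ℕ) (v : Sym F n) :
    coord F n a (polar F n 0 0 v) = ((n : F) - a) * coord F n a v := by
  have : coord F n a ∘ₗ polar F n 0 0 = ((n : F) - a) • coord F n a :=
    Sym.hom_ext fun j hj => by
      simp only [LinearMap.comp_apply, polar_zero_zero_mon hj, map_smul, LinearMap.smul_apply,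
        coord_mon hj, smul_eq_mul]
      split_ifs with h <;> simp [h]
  simpa using LinearMap.congr_fun this v

lemma coord_polar_one_one (n a : ℕ) (v : Sym F n) :
    coord F n a (polar F n 1 1 v) = (a : F) * coord F n a v := by
  have : coord F n a ∘ₗ polar F n 1 1 = (a : F) • coord F n a :=
    Sym.hom_ext fun j hj => by
      simp only [LinearMap.comp_apply, polar_one_one_mon hj, map_smul, LinearMap.smul_apply,
        coord_mon hj, smul_eq_mul]
      split_ifs with h <;> simp [h]
  simpa using LinearMap.congr_fun this v

lemma coord_polar_zero_one (n a : ℕ) (v : Sym F n) :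
    coord F n a (polar F n 0 1 v) = ((a : F) + 1) * coord F n (a + 1) v := by
  have : coord F n a ∘ₗ polar F n 0 1 = ((a : F) + 1) • coord F n (a + 1) :=
    Sym.hom_ext fun j hj => by
      simp only [LinearMap.comp_apply, polar_zero_one_mon hj, map_smul, LinearMap.smul_apply,
        coord_mon hj, coord_mon (show j - 1 ≤ n by omega), smul_eq_mul]
      rcases j with _ | j
      · simp
      · simp only [Nat.add_sub_cancel, add_left_inj]
        split_ifs with h <;> simp [h]
  simpa using LinearMap.congr_fun this v

lemma coord_polar_one_zero_zero (n : ℕ) (v : Sym F n) :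
    coord F n 0 (polar F n 1 0 v) = 0 := by
  have : coord F n 0 ∘ₗ polar F n 1 0 = 0 :=
    Sym.hom_ext fun j hj => by
      simp only [LinearMap.comp_apply, polar_one_zero_mon hj, map_smul, LinearMap.zero_apply]
      by_cases h : j + 1 ≤ n
      · simp [coord_mon h]
      · simp [mon_eq_zero (not_le.1 h)]
  simpa using LinearMap.congr_fun this v

lemma coord_polar_one_zero_succ (n a : ℕ) (v : Sym F n) :
    coord F n (a + 1) (polar F n 1 0 v) = ((n : F) - a) * coord F n a v := by
  have : coord F n (a + 1) ∘ₗ polar F n 1 0 = ((n : F) - a) • coord F n a :=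
    Sym.hom_ext fun j hj => by
      simp only [LinearMap.comp_apply, polar_one_zero_mon hj, map_smul, LinearMap.smul_apply,
        coord_mon hj, smul_eq_mul]
      by_cases h : j + 1 ≤ n
      · simp only [coord_mon h, add_left_inj]
        split_ifs with h <;> simp [h]
      · obtain rfl : j = n := by omega
        simp only [mon_eq_zero (not_le.1 h), map_zero, mul_zero, sub_self]
        split_ifs with h <;> simp [h]
  simpa using LinearMap.congr_fun this v

lemma coord_mulX_zero (n a : ℕ) (v : Sym F n) : coord F (n + 1) a (mulX F n 0 v) = coord F n a v := by
  have hm : ∀ j ≤ n, mulX F n 0 (mon F n j) = mon F (n + 1) j := fun j hj => by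
    apply Sym.val_injective
    rw [val_mulX, val_mon hj, val_mon (by omega), ← mul_assoc, ← pow_succ',
      show n + 1 - j = n - j + 1 by omega]
  have : coord F (n + 1) a ∘ₗ mulX F n 0 = coord F n a := Sym.hom_ext fun j hj => by
    rw [LinearMap.comp_apply, hm j hj, coord_mon hj, coord_mon (by omega)]
  exact LinearMap.congr_fun this v

lemma mulX_one_mon {n j : ℕ} (hj : j ≤ n) : mulX F n 1 (mon F n j) = mon F (n + 1) (j + 1) := by
  apply Sym.val_injective
  rw [val_mulX, val_mon hj, val_mon (by omega), show n + 1 - (j + 1) = n - j by omega]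
  ring

lemma coord_mulX_one_zero (n : ℕ) (v : Sym F n) : coord F (n + 1) 0 (mulX F n 1 v) = 0 := by
  have : coord F (n + 1) 0 ∘ₗ mulX F n 1 = 0 := Sym.hom_ext fun j hj => by
    rw [LinearMap.comp_apply, mulX_one_mon hj, coord_mon (by omega)]
    simp
  exact LinearMap.congr_fun this v

lemma coord_mulX_one_succ (n a : ℕ) (v : Sym F n) :
    coord F (n + 1) (a + 1) (mulX F n 1 v) = coord F n a v := by
  have : coord F (n + 1) (a + 1) ∘ₗ mulX F n 1 = coord F n a := Sym.hom_ext fun j hj => by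
    rw [LinearMap.comp_apply, mulX_one_mon hj, coord_mon hj, coord_mon (by omega)]
    simp
  exact LinearMap.congr_fun this v

/-- The tensor product of two linear forms. -/
def tmulDual {V W : Type*} [AddCommGroup V] [Module F V] [AddCommGroup W] [Module F W]
    (φ : V →ₗ[F] F) (ψ : W →ₗ[F] F) : V ⊗[F] W →ₗ[F] F :=
  (TensorProduct.lid F F).toLinearMap ∘ₗ TensorProduct.map φ ψ

@[simp] lemma tmulDual_tmul {V W : Type*} [AddCommGroup V] [Module F V] [AddCommGroup W]
    [Module F W] (φ : V →ₗ[F] F) (ψ : W →ₗ[F] F) (v : V) (w : W) :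
    tmulDual φ ψ (v ⊗ₜ w) = φ v * ψ w := by
  simp [tmulDual]

/-- The coefficient of `x₀^(m-a) x₁^a y₀^(n-b) y₁^b`. -/
def tcoord (F : Type*) [Field F] (m n a b : ℕ) : Sym F m ⊗[F] Sym F n →ₗ[F] F :=
  tmulDual (coord F m a) (coord F n b)

@[simp] lemma tcoord_tmul (m n a b : ℕ) (v : Sym F m) (w : Sym F n) :
    tcoord F m n a b (v ⊗ₜ w) = coord F m a v * coord F n b w := by
  simp [tcoord]

lemma tcoord_eq_zero {m n a b : ℕ} (h : m < a ∨ n < b) (x : Sym F m ⊗[F] Sym F n) :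
    tcoord F m n a b x = 0 := by
  induction x with
  | zero => simp
  | add x y hx hy => simp [hx, hy]
  | tmul v w => rcases h with h | h <;> simp [coord_eq_zero h]

lemma eq_sum_tcoord {m n : ℕ} (x : Sym F m ⊗[F] Sym F n) :
    x = ∑ a ∈ Finset.range (m + 1), ∑ b ∈ Finset.range (n + 1),
      tcoord F m n a b x • (mon F m a ⊗ₜ[F] mon F n b) := by
  induction x with
  | zero => simp
  | add x y hx hy =>
    conv_lhs => rw [hx, hy]
    simp only [map_add, add_smul, Finset.sum_add_distrib]
  | tmul v w =>
    conv_lhs => rw [Sym.eq_sum_coord v, Sym.eq_sum_coord w, TensorProduct.sum_tmul]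
    refine Finset.sum_congr rfl fun a _ => ?_
    rw [TensorProduct.tmul_sum]
    refine Finset.sum_congr rfl fun b _ => ?_
    rw [tcoord_tmul, TensorProduct.smul_tmul_smul]

lemma ext_tcoord {m n : ℕ} {x y : Sym F m ⊗[F] Sym F n}
    (h : ∀ a b, tcoord F m n a b x = tcoord F m n a b y) : x = y := by
  rw [eq_sum_tcoord x, eq_sum_tcoord y]
  simp only [h]

/-- K preserves a + b and is tridiagonal in each weight. The conditionals guard the truncated
subtractions `b - 1` and `a - 1`. -/
lemma tcoord_casimir (m n a b : ℕ) (x : Sym F m ⊗[F] Sym F n) :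
    tcoord F m n a b (casimir F m n x) =
      (((m : F) - a) * b + a * ((n : F) - b)) * tcoord F m n a b x
      - (if b = 0 then 0 else ((a : F) + 1) * (n - b + 1) * tcoord F m n (a + 1) (b - 1) x)
      - (if a = 0 then 0 else ((m : F) - a + 1) * (b + 1) * tcoord F m n (a - 1) (b + 1) x) := by
  induction x with
  | zero => simp
  | add x y hx hy =>
    rw [map_add, map_add, hx, hy]
    simp only [map_add]
    split_ifs <;> ring
  | tmul v w =>
    simp only [casimir, LinearMap.sub_apply, LinearMap.add_apply, TensorProduct.map_tmul, map_sub,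
      map_add, tcoord_tmul, coord_polar_zero_zero, coord_polar_one_one, coord_polar_zero_one]
    rcases a with _ | a <;> rcases b with _ | b <;>
      simp only [coord_polar_one_zero_zero, coord_polar_one_zero_succ, if_true, if_neg,
        Nat.succ_ne_zero, not_false_eq_true, Nat.add_sub_cancel] <;> push_cast <;> ring

lemma tcoord_tensorAct_tor (m n a b : ℕ) (t : F) (x : Sym F m ⊗[F] Sym F n) :
    tcoord F m n a b (tensorAct m n (tor t) x) = t ^ (a + b) * tcoord F m n a b x := by
  induction x with
  | zero => simp
  | add x y hx hy => simp only [map_add, hx, hy, mul_add]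
  | tmul v w =>
    simp only [tensorAct_tmul, tcoord_tmul, coord_symAct_tor, pow_add]
    ring

/-- The component of weight `N`, i.e. of total degree `N` in `x₁, y₁`. -/
def wtProj (F : Type*) [Field F] (m n N : ℕ) : Module.End F (Sym F m ⊗[F] Sym F n) :=
  ∑ ab ∈ Finset.HasAntidiagonal.antidiagonal N,
    (tcoord F m n ab.1 ab.2).smulRight (mon F m ab.1 ⊗ₜ[F] mon F n ab.2)

lemma tcoord_mon_tmul_mon (m n a b c d : ℕ) :
    tcoord F m n a b (mon F m c ⊗ₜ mon F n d)
      = if (c, d) = (a, b) ∧ a ≤ m ∧ b ≤ n then 1 else 0 := by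
  rw [tcoord_tmul]
  by_cases hc : c ≤ m
  · by_cases hd : d ≤ n
    · rw [coord_mon hc, coord_mon hd, ite_zero_mul_ite_zero]
      simp only [mul_one, Prod.mk.injEq]
      refine if_congr ⟨?_, fun h => h.1⟩ rfl rfl
      rintro ⟨rfl, rfl⟩
      exact ⟨⟨rfl, rfl⟩, hc, hd⟩
    · rw [mon_eq_zero (not_le.1 hd), map_zero, mul_zero, if_neg]
      rintro ⟨h, -, h2⟩
      rw [Prod.mk.injEq] at h
      omega
  · rw [mon_eq_zero (not_le.1 hc), map_zero, zero_mul, if_neg]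
    rintro ⟨h, h1, -⟩
    rw [Prod.mk.injEq] at h
    omega

lemma tcoord_wtProj (m n N a b : ℕ) (x : Sym F m ⊗[F] Sym F n) :
    tcoord F m n a b (wtProj F m n N x) = if a + b = N then tcoord F m n a b x else 0 := by
  rw [wtProj, LinearMap.sum_apply, map_sum]
  simp only [LinearMap.smulRight_apply, map_smul, tcoord_mon_tmul_mon, smul_eq_mul]
  by_cases hab : a ≤ m ∧ b ≤ n
  · simp only [hab, and_self, and_true, mul_ite, mul_one, mul_zero]
    rw [Finset.sum_ite_eq']
    simp
  · rw [tcoord_eq_zero (by omega), ite_self]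
    exact Finset.sum_eq_zero fun _ _ => by rw [if_neg (fun h => hab h.2), mul_zero]

lemma sum_wtProj {m n M : ℕ} (h : m + n < M) (x : Sym F m ⊗[F] Sym F n) :
    x = ∑ N ∈ Finset.range M, wtProj F m n N x := by
  refine ext_tcoord fun a b => ?_
  rw [map_sum]
  simp only [tcoord_wtProj]
  rw [Finset.sum_ite_eq]
  split_ifs with hab
  · rfl
  · rw [Finset.mem_range] at hab
    exact tcoord_eq_zero (by omega) x

lemma wtProj_eq_zero {m n N : ℕ} (h : m + n < N) (x : Sym F m ⊗[F] Sym F n) :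
    wtProj F m n N x = 0 := by
  refine ext_tcoord fun a b => ?_
  rw [tcoord_wtProj, map_zero]
  split_ifs with hab
  · exact tcoord_eq_zero (by omega) x
  · rfl

lemma casimir_wtProj (m n N : ℕ) (x : Sym F m ⊗[F] Sym F n) :
    casimir F m n (wtProj F m n N x) = wtProj F m n N (casimir F m n x) := by
  refine ext_tcoord fun a b => ?_
  simp only [tcoord_casimir, tcoord_wtProj]
  by_cases h : a + b = N
  · simp only [h, if_true]
    congr 1
    · congr 1
      split_ifs <;> first | rfl | omega
    · split_ifs <;> first | rfl | omega
  · simp only [h, if_false, mul_zero]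
    rcases a with _ | a <;> rcases b with _ | b
    · simp
    · simp [show ¬ 0 + 1 + b = N by omega]
    · simp [show ¬ a + (0 + 1) = N by omega]
    · simp [show ¬ a + 1 + 1 + b = N by omega, show ¬ a + (b + 1 + 1) = N by omega]

lemma tensorAct_tor_of_wt {m n N : ℕ} {x : Sym F m ⊗[F] Sym F n} (hx : wtProj F m n N x = x)
    (t : F) : tensorAct m n (tor t) x = t ^ N • x := by
  refine ext_tcoord fun a b => ?_
  rw [tcoord_tensorAct_tor, ← hx, map_smul, tcoord_wtProj, smul_eq_mul]
  split_ifs with h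
  · rw [h]
  · simp

lemma wtProj_wtProj (m n N : ℕ) (x : Sym F m ⊗[F] Sym F n) :
    wtProj F m n N (wtProj F m n N x) = wtProj F m n N x := by
  refine ext_tcoord fun a b => ?_
  simp only [tcoord_wtProj]
  split_ifs <;> rfl

lemma coord_symAct_weyl {n a : ℕ} (ha : a ≤ n) (v : Sym F n) :
    coord F n a (symAct n (weyl F) v) = coord F n (n - a) v := by
  have : coord F n a ∘ₗ symAct n (weyl F) = coord F n (n - a) := Sym.hom_ext fun j hj => by
    rw [LinearMap.comp_apply, symAct_weyl_mon hj, coord_mon hj, coord_mon (by omega)]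
    exact if_congr (by omega) rfl rfl
  exact LinearMap.congr_fun this v

lemma tcoord_tensorAct_weyl {m n a b : ℕ} (ha : a ≤ m) (hb : b ≤ n) (x : Sym F m ⊗[F] Sym F n) :
    tcoord F m n a b (tensorAct m n (weyl F) x) = tcoord F m n (m - a) (n - b) x := by
  induction x with
  | zero => simp
  | add x y hx hy => simp only [map_add, hx, hy]
  | tmul v w => simp only [tensorAct_tmul, tcoord_tmul, coord_symAct_weyl ha, coord_symAct_weyl hb]

lemma tcoord_detMul (m n a b : ℕ) (x : Sym F m ⊗[F] Sym F n) :
    tcoord F (m + 1) (n + 1) a b (detMul F m n x) =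
      (if b = 0 then 0 else tcoord F m n a (b - 1) x)
      - if a = 0 then 0 else tcoord F m n (a - 1) b x := by
  induction x with
  | zero => simp
  | add x y hx hy =>
    rw [map_add, map_add, hx, hy]
    simp only [map_add]
    split_ifs <;> ring
  | tmul v w =>
    simp only [detMul, LinearMap.sub_apply, TensorProduct.map_tmul, map_sub, tcoord_tmul,
      coord_mulX_zero]
    rcases a with _ | a <;> rcases b with _ | b <;>
      simp [coord_mulX_one_zero, coord_mulX_one_succ]

/-- Expansion of (x₀y₁ - x₁y₀)^m y₀^r; the induction step is Pascal's rule. -/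
lemma tcoord_iota (r m a b : ℕ) : tcoord F m (r + m) a b (iota F r m (mon F r 0))
    = if a + b = m then (-1) ^ a * (m.choose a : F) else 0 := by
  induction m generalizing a b with
  | zero =>
    change tcoord F 0 r a b (mon F 0 0 ⊗ₜ mon F r 0) = _
    rw [tcoord_tmul, coord_mon le_rfl, coord_mon (Nat.zero_le _)]
    rcases a with _ | a <;> rcases b with _ | b <;> simp
  | succ m ih =>
    change tcoord F (m + 1) (r + m + 1) a b (detMul F m (r + m) (iota F r m (mon F r 0))) = _
    rw [tcoord_detMul, ih, ih]
    rcases a with _ | a <;> rcases b with _ | b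
    · simp
    · simp
    · simp only [if_true, Nat.succ_ne_zero, if_false, Nat.add_sub_cancel, add_zero, zero_sub,
        Nat.succ_inj]
      split_ifs with h
      · subst h
        simp [pow_succ]
      · simp
    · simp only [Nat.succ_ne_zero, if_false, Nat.add_sub_cancel]
      by_cases h : a + 1 + b = m
      · rw [if_pos h, if_pos (by omega), if_pos (by omega), Nat.choose_succ_succ]
        push_cast
        ring
      · rw [if_neg h, if_neg (by omega), if_neg (by omega), sub_zero]

/-- The kernel of the Casimir operator in weight `m` is a line when `n = -1` in `F`. -/
lemma eq_smul_iota_of_casimir_eq_zero {r m : ℕ} (hn : ((r + m : ℕ) : F) = -1)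
    (hm : ∀ j : ℕ, 0 < j → j ≤ m → (j : F) ≠ 0) {x : Sym F m ⊗[F] Sym F (r + m)}
    (hx : wtProj F m (r + m) m x = x) (hK : casimir F m (r + m) x = 0) :
    x = tcoord F m (r + m) 0 m x • iota F r m (mon F r 0) := by
  -- These relations say that the raising operator x₀∂/∂x₁ + y₀∂/∂y₁ kills x. Since n = -1 in F, the
  -- three-term relation Kx = 0 is a combination of two consecutive ones, so they follow by
  -- induction on a.
  have hz : ∀ a b : ℕ, a + 1 + b = m → ((a : F) + 1) * tcoord F m (r + m) (a + 1) b x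
      + (b + 1) * tcoord F m (r + m) a (b + 1) x = 0 := by
    intro a
    induction a with
    | zero =>
      intro b hb
      have h := tcoord_casimir m (r + m) 0 (b + 1) x
      have h0 : ((b : F) + 1) ≠ 0 := by
        have := hm (b + 1) (by omega) (by omega)
        rwa [Nat.cast_add, Nat.cast_one] at this
      rw [hK, map_zero, hn] at h
      simp only [Nat.succ_ne_zero, if_false, if_true, Nat.add_sub_cancel] at h
      have hmb : (m : F) = 0 + 1 + b := by rw [← hb]; push_cast; ring
      refine (mul_eq_zero.1 ?_).resolve_left h0
      rw [hmb] at h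
      push_cast at h ⊢
      linear_combination -h
    | succ a ih =>
      intro b hb
      have h := tcoord_casimir m (r + m) (a + 1) (b + 1) x
      have h0 : ((b : F) + 1) ≠ 0 := by
        have := hm (b + 1) (by omega) (by omega)
        rwa [Nat.cast_add, Nat.cast_one] at this
      rw [hK, map_zero, hn] at h
      simp only [Nat.succ_ne_zero, if_false, Nat.add_sub_cancel] at h
      have hmb : (m : F) = a + 1 + 1 + b := by rw [← hb]; push_cast; ring
      have h' := ih (b + 1) (by omega)
      refine (mul_eq_zero.1 ?_).resolve_left h0
      rw [hmb] at h
      push_cast at h h' ⊢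
      linear_combination -h + (b + 2) * h'
  -- The two-term recurrence determines all coordinates from the one at a = 0.
  have hc : ∀ a b : ℕ, a + b = m → tcoord F m (r + m) a b x
      = (-1) ^ a * (m.choose a : F) * tcoord F m (r + m) 0 m x := by
    intro a
    induction a with
    | zero =>
      intro b hb
      obtain rfl : b = m := by omega
      simp
    | succ a ih =>
      intro b hb
      have h := hz a b hb
      have h0 : ((a : F) + 1) ≠ 0 := by
        have := hm (a + 1) (by omega) (by omega)
        rwa [Nat.cast_add, Nat.cast_one] at this
      rw [ih (b + 1) (by omega)] at h
      have hch : (m.choose (a + 1) : F) * (a + 1) = m.choose a * (b + 1) := by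
        have := Nat.choose_succ_right_eq m a
        rw [show m - a = b + 1 by omega] at this
        exact_mod_cast congrArg (Nat.cast (R := F)) this
      refine mul_left_cancel₀ h0 ?_
      rw [pow_succ]
      linear_combination h + (-1) ^ a * tcoord F m (r + m) 0 m x * hch
  refine ext_tcoord fun a b => ?_
  rw [map_smul, tcoord_iota, smul_eq_mul]
  split_ifs with h
  · rw [hc a b h, mul_comm]
  · rw [← hx, tcoord_wtProj, if_neg h, mul_zero]

end Coordinates

/-! ### The generalised 0-eigenspace of K. -/

section Block

variable {F : Type*} [Field F]

instance (n : ℕ) : FiniteDimensional F (Sym F n) :=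
  Module.Finite.of_surjective
    (Fintype.linearCombination F fun j : Fin (n + 1) => mon F n j) fun v => by
      refine ⟨fun j => coord F n j v, ?_⟩
      rw [Fintype.linearCombination_apply, Fin.sum_univ_eq_sum_range
        (fun j => coord F n j v • mon F n j) (n + 1), ← Sym.eq_sum_coord]

/-- The maps `V_r → V_m ⊗ V_n → V_r` whose composite describes the Casimir operator on its
generalised `0`-eigenspace. -/
structure CayleyData (F : Type*) [Field F] (m n r : ℕ) where
  iota : Sym F r →ₗ[F] Sym F m ⊗[F] Sym F n
  pi : Sym F m ⊗[F] Sym F n →ₗ[F] Sym F r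
  c : F
  c_ne_zero : c ≠ 0
  act_iota : ∀ g v, tensorAct m n g (iota v) = g.det ^ m • iota (symAct r g v)
  pi_act : ∀ g x, pi (tensorAct m n g x) = g.det ^ m • symAct r g (pi x)
  casimir_iota : ∀ v, casimir F m n (iota v) = 0
  iota_pi : ∀ x, casimir F m n (casimir F m n x) = 0 → iota (pi x) = c • casimir F m n x
  exists_casimir_eq : ∃ v, casimir F m n (casimir F m n v) = 0 ∧ casimir F m n v = iota (mon F r 0)
  mem_iff : ∀ x, x ∈ (casimir F m n).maxGenEigenspace 0 ↔ casimir F m n (casimir F m n x) = 0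
  tcoord_iota : ∀ a b, tcoord F m n a b (iota (mon F r 0))
    = if a + b = m then (-1) ^ a * (m.choose a : F) else 0
  eq_smul_iota : ∀ x, wtProj F m n m x = x → casimir F m n x = 0 →
    x = tcoord F m n 0 m x • iota (mon F r 0)

lemma aeval_apply_of_apply_eq_zero {V : Type*} [AddCommGroup V] [Module F V] {A : Module.End F V}
    {x : V} (h : A x = 0) (P : Polynomial F) : Polynomial.aeval A P x = P.eval 0 • x := by
  induction P using Polynomial.induction_on' with
  | add P Q hP hQ => simp only [map_add, LinearMap.add_apply, hP, hQ, Polynomial.eval_add, add_smul]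
  | monomial n a =>
    rcases n with _ | n
    · simp [Module.algebraMap_end_apply]
    · simp [pow_succ, h]

/-- With M = m + 1, the root i(r + 2M + 1 - i) equals i(M - i) modulo p, which is nonzero for 0 < i
< M. So 0 is a simple root. -/
lemma exists_capelli_eq {p r m : ℕ} [Fact p.Prime] [CharP F p] (hp : p = r + (m + 1) + 1) :
    ∃ Q : Polynomial F, capelli F r (m + 1) = Polynomial.X * Q ∧ Q.eval 0 ≠ 0 := by
  refine ⟨∏ i ∈ Finset.range m, (Polynomial.X - Polynomial.C
    (((i + 1 : ℕ) : F) * (r + 2 * (m + 1 : ℕ) + 1 - (i + 1 : ℕ)))), ?_, ?_⟩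
  · rw [capelli, Finset.prod_range_succ', mul_comm]
    simp
  · rw [Polynomial.eval_prod, Finset.prod_ne_zero_iff]
    intro i hi
    rw [Finset.mem_range] at hi
    have hp0 : ((r : F) + (m + 1) + 1) = 0 := by
      have := CharP.cast_eq_zero F p
      rw [hp] at this
      exact_mod_cast this
    have h1 : ((i + 1 : ℕ) : F) ≠ 0 := fun h =>
      absurd (Nat.le_of_dvd (by omega) ((CharP.cast_eq_zero_iff F p _).1 h)) (by omega)
    have h2 : ((m - i : ℕ) : F) ≠ 0 := fun h =>
      absurd (Nat.le_of_dvd (by omega) ((CharP.cast_eq_zero_iff F p _).1 h)) (by omega)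
    rw [Polynomial.eval_sub, Polynomial.eval_X, Polynomial.eval_C, zero_sub]
    refine neg_ne_zero.2 (mul_ne_zero h1 ?_)
    convert h2 using 1
    rw [Nat.cast_sub hi.le]
    push_cast
    linear_combination hp0

/-- The structure of the generalised `0`-eigenspace of the Casimir operator. -/
theorem nonempty_cayleyData {p m n r : ℕ} [Fact p.Prime] [CharP F p] (hm : 0 < m) (hn : n = r + m)
    (hp : p = n + 1) : Nonempty (CayleyData F m n r) := by
  subst hn
  have hchar : ∀ j : ℕ, 0 < j → j < p → (j : F) ≠ 0 := fun j h0 hj h =>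
    absurd (Nat.le_of_dvd h0 ((CharP.cast_eq_zero_iff F p _).1 h)) (by omega)
  obtain ⟨m, rfl⟩ : ∃ m', m = m' + 1 := ⟨m - 1, by omega⟩
  obtain ⟨Q, hQ, hQ0⟩ := exists_capelli_eq (F := F) hp
  set K := casimir F (m + 1) (r + (m + 1)) with hK
  have hp0 : ((r + (m + 1) : ℕ) : F) + 1 = 0 := by
    have := CharP.cast_eq_zero F p
    rw [hp] at this
    exact_mod_cast this
  have hKι : ∀ v, K (iota F r (m + 1) v) = 0 := fun v => by
    rw [hK, casimir_iota]
    convert zero_smul F _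
    push_cast at hp0 ⊢
    linear_combination (m + 1 : F) * hp0
  have hιπ : ∀ x, iota F r (m + 1) (cayleyPow F r (m + 1) x) = Polynomial.aeval K Q (K x) := by
    intro x
    have := LinearMap.congr_fun (iota_comp_cayleyPow (F := F) r (m + 1)) x
    rw [hQ, mul_comm, map_mul, Polynomial.aeval_X] at this
    exact this
  have hQK : ∀ x, Polynomial.aeval K Q (K x) = K (Polynomial.aeval K Q x) := fun x => by
    have : Polynomial.aeval K (Q * Polynomial.X) x = Polynomial.aeval K (Polynomial.X * Q) x := by
      rw [mul_comm]
    simpa using this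
  -- Since Q(0) ≠ 0, Q(K) is invertible on the generalised 0-eigenspace, so this relation will force
  -- K² = 0 there.
  have hKKQ : ∀ x, Polynomial.aeval K Q (K (K x)) = 0 := fun x => by rw [hQK, ← hιπ, hKι]
  obtain ⟨α, β, hαβ⟩ : IsCoprime (Polynomial.X ^ 2) Q := by
    refine IsCoprime.pow_left ((Polynomial.prime_X.irreducible.coprime_iff_not_dvd).2 ?_)
    rwa [Polynomial.X_dvd_iff, Polynomial.coeff_zero_eq_eval_zero]
  have hβ : β.eval 0 * Q.eval 0 = 1 := by
    have := congrArg (Polynomial.eval 0) hαβ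
    simpa using this
  refine ⟨⟨iota F r (m + 1), cayleyPow F r (m + 1), Q.eval 0, hQ0, fun g v => tensorAct_iota _ _ g v,
    fun g x => cayleyPow_tensorAct _ _ g x, hKι, fun x hx => ?_, ?_, fun x => ⟨fun hx => ?_,
    fun hx => ?_⟩, fun a b => tcoord_iota _ _ a b,
    fun x hx hx0 => eq_smul_iota_of_casimir_eq_zero (by linear_combination hp0)
      (fun j h0 hj => hchar j h0 (by omega)) hx hx0⟩⟩
  · rw [hιπ, aeval_apply_of_apply_eq_zero hx]
  · set d : F := ((m + 1).factorial : F) ^ 2 with hd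
    have hd0 : d ≠ 0 := pow_ne_zero _ fun h => by
      have := (CharP.cast_eq_zero_iff F p _).1 h
      rw [(Fact.out : p.Prime).dvd_factorial] at this
      omega
    set u := mon F (m + 1) 0 ⊗ₜ[F] mon F (r + (m + 1)) (m + 1)
    have hu : cayleyPow F r (m + 1) u = d • mon F r 0 := cayleyPow_mon r (m + 1)
    -- The witness is β(K)Q(K)u, the component of u in ker K², up to rescaling: K sends it to
    -- β(K)ι(π(u)), and β(K) acts on ker K as β(0).
    have h2 : K (Polynomial.aeval K β (Polynomial.aeval K Q u))
        = (β.eval 0 * d) • iota F r (m + 1) (mon F r 0) := by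
      have : K (Polynomial.aeval K β (Polynomial.aeval K Q u))
          = Polynomial.aeval K β (K (Polynomial.aeval K Q u)) := by
        have : Polynomial.aeval K (Polynomial.X * β) (Polynomial.aeval K Q u)
          = Polynomial.aeval K (β * Polynomial.X) (Polynomial.aeval K Q u) := by rw [mul_comm]
        simpa using this
      rw [this, ← hQK, ← hιπ, hu, map_smul, map_smul, aeval_apply_of_apply_eq_zero (hKι _),
        smul_smul, mul_comm]
    have hne : β.eval 0 * d ≠ 0 := mul_ne_zero (left_ne_zero_of_mul_eq_one hβ) hd0
    refine ⟨(β.eval 0 * d)⁻¹ • Polynomial.aeval K β (Polynomial.aeval K Q u), ?_, ?_⟩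
    · rw [map_smul, h2, map_smul, map_smul, hKι, smul_zero, smul_zero]
    · rw [map_smul, h2, smul_smul, inv_mul_cancel₀ hne, one_smul]
  · rw [Module.End.mem_maxGenEigenspace] at hx
    obtain ⟨N, hN⟩ := hx
    rw [zero_smul, sub_zero] at hN
    -- Bézout for X^N and Q expresses K²x through K^N K²x and Q(K)K²x, both zero.
    obtain ⟨α', β', h'⟩ : IsCoprime (Polynomial.X ^ N) Q := by
      refine IsCoprime.pow_left ((Polynomial.prime_X.irreducible.coprime_iff_not_dvd).2 ?_)
      rwa [Polynomial.X_dvd_iff, Polynomial.coeff_zero_eq_eval_zero]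
    have h1 : ∀ y, K (K y) = Polynomial.aeval K α' ((K ^ N) (K (K y))) := fun y => by
      have := congrArg (fun P => Polynomial.aeval K P (K (K y))) h'
      simp only [map_add, map_mul, map_pow, Polynomial.aeval_X, map_one, LinearMap.add_apply,
        Module.End.mul_apply, Module.End.one_apply, hKKQ, map_zero, add_zero] at this
      exact this.symm
    have h2 : (K ^ N) (K (K x)) = K (K ((K ^ N) x)) := by
      have : K ^ N * (K * K) = K * K * K ^ N := 
        ((Commute.pow_self K N).mul_right (Commute.pow_self K N)).eq
      simpa [mul_assoc] using LinearMap.congr_fun this x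
    rw [h1, h2, hN, map_zero, map_zero, map_zero]
  · rw [Module.End.mem_maxGenEigenspace]
    exact ⟨2, by simpa [pow_two] using hx⟩

end Block

/-! ### Power sums over k and extraction of coefficients. -/

section FiniteField

variable {k F : Type*} [Field k] [Fintype k] [Field F] [Algebra k F]

lemma sum_units_algebraMap_pow [DecidableEq k] (e : ℕ) :
    ∑ t : kˣ, algebraMap k F t ^ e = if Fintype.card k - 1 ∣ e then -1 else 0 := by
  classical
  have := congrArg (algebraMap k F) (FiniteField.sum_pow_units k e)
  rw [map_sum] at this
  simp only [map_pow] at this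
  rw [this]
  split_ifs <;> simp

/-- The exponent 0 is exceptional because 0^0 = 1: the sum is then q = 0 instead of -1. -/
lemma sum_algebraMap_pow (e : ℕ) :
    ∑ t : k, algebraMap k F t ^ e = if e ≠ 0 ∧ Fintype.card k - 1 ∣ e then -1 else 0 := by
  classical
  by_cases he : e = 0
  · have h := congrArg (algebraMap k F) (FiniteField.cast_card_eq_zero k)
    rw [map_natCast, map_zero] at h
    simp [he, h]
  · have h : ∑ t : k, algebraMap k F t ^ e = ∑ t : kˣ, algebraMap k F t ^ e := by
      rw [← Finset.sum_subset (Finset.subset_univ (Finset.univ.erase (0 : k)))]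
      · refine Finset.sum_bij' (fun t ht => Units.mk0 t (Finset.ne_of_mem_erase ht))
          (fun t _ => (t : k)) ?_ ?_ ?_ ?_ ?_ <;> simp
      · intro t _ ht
        obtain rfl : t = 0 := by simpa using ht
        simp [he]
    rw [h, sum_units_algebraMap_pow]
    simp [he]

variable {V : Type*} [AddCommGroup V] [Module F V]

lemma sum_smul_expansion {T S : Type*} [Fintype S] (a : S → F) (s : Finset T) (w : T → ℕ)
    (x : T → V) (e : ℕ) : ∑ t : S, a t ^ e • ∑ i ∈ s, a t ^ w i • x i
      = ∑ i ∈ s, (∑ t : S, a t ^ (e + w i)) • x i := by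
  simp only [Finset.smul_sum, smul_smul, ← pow_add, Finset.sum_smul]
  exact Finset.sum_comm

/-- Extraction of a coefficient of a polynomial function of bounded degree on a finite field. -/
lemma sum_pow_smul_eq_neg {T : Type*} (s : Finset T) (w : T → ℕ) (x : T → V) {t₀ : T}
    (ht₀ : t₀ ∈ s) (h₀ : w t₀ ≤ Fintype.card k - 1)
    (h : ∀ t ∈ s, t ≠ t₀ → x t ≠ 0 → w t ≠ w t₀ ∧ w t < w t₀ + (Fintype.card k - 1)) :
    ∑ l : k, algebraMap k F l ^ (Fintype.card k - 1 - w t₀) • ∑ t ∈ s, algebraMap k F l ^ w t • x t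
      = -x t₀ := by
  have hq : 1 < Fintype.card k := Fintype.one_lt_card
  rw [sum_smul_expansion, Finset.sum_eq_single t₀]
  · rw [sum_algebraMap_pow, if_pos, neg_one_smul]
    rw [Nat.sub_add_cancel h₀]
    exact ⟨by omega, dvd_rfl⟩
  · intro t ht hne
    by_cases hx : x t = 0
    · rw [hx, smul_zero]
    · obtain ⟨h1, h2⟩ := h t ht hne hx
      rw [sum_algebraMap_pow, if_neg, zero_smul]
      rintro ⟨h3, c, hc⟩
      -- The exponent is below 2(q - 1), so as a positive multiple of q - 1 it could only be q - 1,
      -- which would force equal weights.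
      have hc1 : c < 2 := by
        by_contra hc2
        have : (Fintype.card k - 1) * 2 ≤ (Fintype.card k - 1) * c :=
          Nat.mul_le_mul_left _ (by omega)
        omega
      interval_cases c <;> omega
  · exact fun h => absurd ht₀ h

end FiniteField

/-! ### Unipotent, diagonal and permutation elements of GL₂(k). -/

section Group

variable (k : Type*) [Field k]

/-- Upper unipotent elements of `GL₂(k)`. -/
def uniGL {k : Type*} [Field k] (a : k) : GL (Fin 2) k :=
  Matrix.GeneralLinearGroup.mkOfDetNeZero (uni a) (by simp [uni])

/-- The elements `diag(1, t)` of `GL₂(k)`. -/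
def torGL {k : Type*} [Field k] (t : kˣ) : GL (Fin 2) k :=
  Matrix.GeneralLinearGroup.mkOfDetNeZero (tor t) (by simp [tor])

/-- The nontrivial permutation matrix in `GL₂(k)`. -/
def weylGL : GL (Fin 2) k :=
  Matrix.GeneralLinearGroup.mkOfDetNeZero (weyl k) (by simp [weyl])

variable {k} {F : Type*} [Field F] [Algebra k F]

variable (F) in
/-- The image of an element of `GL₂(k)` in `M₂(F)`. -/
def toMat (g : GL (Fin 2) k) : Matrix (Fin 2) (Fin 2) F := g.1.map (algebraMap k F)

lemma toMat_uniGL (a : k) : toMat F (uniGL a) = uni (algebraMap k F a) := by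
  change (uni _).map _ = _
  ext i j
  fin_cases i <;> fin_cases j <;> simp [uni]

lemma toMat_torGL (t : kˣ) : toMat F (torGL t) = tor (algebraMap k F t) := by
  change (tor _).map _ = _
  ext i j
  fin_cases i <;> fin_cases j <;> simp [tor]

lemma toMat_weylGL : toMat F (weylGL k) = weyl F := by
  change (weyl k).map _ = _
  ext i j
  fin_cases i <;> fin_cases j <;> simp [weyl]

lemma det_toMat (g : GL (Fin 2) k) :
    (toMat F g).det = algebraMap k F (Matrix.GeneralLinearGroup.det g : k) := by
  rw [toMat, Matrix.GeneralLinearGroup.val_det_apply, RingHom.map_det]; rfl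

lemma det_uni {R : Type*} [CommRing R] (a : R) : (uni a).det = 1 := by simp [uni]
lemma det_tor {R : Type*} [CommRing R] (a : R) : (tor a).det = a := by simp [tor]
lemma det_weyl {R : Type*} [CommRing R] : (weyl R).det = -1 := by simp [weyl]

lemma weyl_mul_weyl {R : Type*} [CommRing R] : weyl R * weyl R = 1 := by
  simp [weyl, Matrix.one_fin_two]

lemma casimir_tensorAct_toMat (m n : ℕ) (g : GL (Fin 2) k) (x : Sym F m ⊗[F] Sym F n) :
    casimir F m n (tensorAct m n (toMat F g) x) = tensorAct m n (toMat F g) (casimir F m n x) :=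
  LinearMap.congr_fun (casimir_commute k F m n g).eq x

lemma casimir_tensorAct_weyl (m n : ℕ) (x : Sym F m ⊗[F] Sym F n) :
    casimir F m n (tensorAct m n (weyl F) x) = tensorAct m n (weyl F) (casimir F m n x) := by
  have := casimir_tensorAct_toMat m n (weylGL F) x
  rwa [toMat_weylGL] at this

end Group

/-! ### Divided powers on tensor products and extreme weight vectors. -/

section Unipotent

variable {F : Type*} [Field F]

/-- The divided powers of the unipotent action on `Sym^m F² ⊗ Sym^n F²`. -/
def tdivPow (F : Type*) [Field F] (m n t : ℕ) : Module.End F (Sym F m ⊗[F] Sym F n) :=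
  ∑ ab ∈ Finset.HasAntidiagonal.antidiagonal t,
    TensorProduct.map (divPow F m ab.1) (divPow F n ab.2)

lemma tensorAct_uni {m n N : ℕ} (hN : m + n < N) (μ : F) :
    tensorAct m n (uni μ) = ∑ t ∈ Finset.range N, μ ^ t • tdivPow F m n t := by
  have h1 : tensorAct m n (uni μ) = ∑ ab ∈ Finset.range (m + 1) ×ˢ Finset.range (n + 1),
      μ ^ (ab.1 + ab.2) • TensorProduct.map (divPow F m ab.1) (divPow F n ab.2) := by
    refine TensorProduct.ext' fun v w => ?_
    rw [tensorAct_tmul, symAct_uni m μ (Nat.lt_succ_self m), symAct_uni n μ (Nat.lt_succ_self n),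
      Finset.sum_product, LinearMap.sum_apply, LinearMap.sum_apply, TensorProduct.sum_tmul,
      LinearMap.sum_apply]
    refine Finset.sum_congr rfl fun a _ => ?_
    rw [TensorProduct.tmul_sum, LinearMap.sum_apply]
    refine Finset.sum_congr rfl fun b _ => ?_
    simp only [LinearMap.smul_apply, TensorProduct.map_tmul, TensorProduct.smul_tmul_smul, pow_add]
  rw [h1, ← Finset.sum_fiberwise_of_maps_to (t := Finset.range N) (g := fun ab : ℕ × ℕ => ab.1 + ab.2)]
  · refine Finset.sum_congr rfl fun t _ => ?_
    rw [tdivPow, Finset.smul_sum]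
    have h2 : ∀ ab ∈ Finset.HasAntidiagonal.antidiagonal t, μ ^ t • TensorProduct.map
        (divPow F m ab.1) (divPow F n ab.2) = μ ^ (ab.1 + ab.2) • TensorProduct.map
        (divPow F m ab.1) (divPow F n ab.2) := fun ab hab => by
      rw [Finset.HasAntidiagonal.mem_antidiagonal.1 hab]
    rw [Finset.sum_congr rfl h2]
    refine Finset.sum_subset ?_ ?_
    · intro ab hab
      rw [Finset.HasAntidiagonal.mem_antidiagonal]
      exact (Finset.mem_filter.1 hab).2
    · intro ab hab hab'
      rw [Finset.HasAntidiagonal.mem_antidiagonal] at hab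
      simp only [Finset.mem_filter, Finset.mem_product, Finset.mem_range, hab, and_true] at hab'
      by_cases h : ab.1 < m + 1
      · rw [divPow_eq_zero (show n < ab.2 by omega), TensorProduct.map_zero_right, smul_zero]
      · rw [divPow_eq_zero (show m < ab.1 by omega), TensorProduct.map_zero_left, smul_zero]
  · intro ab hab
    simp only [Finset.mem_product, Finset.mem_range] at hab ⊢
    omega

lemma tdivPow_eq_zero {m n t : ℕ} (h : m + n < t) : tdivPow F m n t = 0 := by
  refine Finset.sum_eq_zero fun ab hab => ?_
  rw [Finset.HasAntidiagonal.mem_antidiagonal] at hab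
  by_cases h : m < ab.1
  · rw [divPow_eq_zero h, TensorProduct.map_zero_left]
  · rw [divPow_eq_zero (show n < ab.2 by omega), TensorProduct.map_zero_right]

lemma tcoord_tdivPow_mon (m n t a b : ℕ) (ha : a ≤ m) (hb : b ≤ n) (hab : a + b + t = m + n) :
    tcoord F m n a b (tdivPow F m n t (mon F m m ⊗ₜ mon F n n))
      = (m.choose a : F) * n.choose b := by
  rw [tdivPow, LinearMap.sum_apply, map_sum, Finset.sum_eq_single (m - a, n - b)]
  · simp only [TensorProduct.map_tmul, tcoord_tmul, divPow_mon _ le_rfl, map_smul, smul_eq_mul]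
    rw [coord_mon (by omega), coord_mon (by omega), if_pos (by omega), if_pos (by omega),
      Nat.choose_symm ha, Nat.choose_symm hb, mul_one, mul_one]
  · intro cd hcd hne
    rw [Finset.HasAntidiagonal.mem_antidiagonal] at hcd
    simp only [TensorProduct.map_tmul, tcoord_tmul, divPow_mon _ le_rfl, map_smul, smul_eq_mul]
    rw [coord_mon (by omega), coord_mon (by omega)]
    by_cases h : m - cd.1 = a
    · by_cases h' : n - cd.2 = b
      · by_cases h1 : m < cd.1
        · rw [Nat.choose_eq_zero_of_lt h1]; simp
        · by_cases h2 : n < cd.2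
          · rw [Nat.choose_eq_zero_of_lt h2]; simp
          · exact absurd (Prod.ext (show cd.1 = m - a by omega) (show cd.2 = n - b by omega)) hne
      · simp [h']
    · simp [h]
  · intro h
    exact absurd (Finset.HasAntidiagonal.mem_antidiagonal.2 (show m - a + (n - b) = t by omega)) h

lemma wtProj_tdivPow_mon (m n t N : ℕ) (h : t + N = m + n) :
    wtProj F m n N (tdivPow F m n t (mon F m m ⊗ₜ mon F n n))
      = tdivPow F m n t (mon F m m ⊗ₜ mon F n n) := by
  refine ext_tcoord fun a b => ?_
  rw [tcoord_wtProj]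
  split_ifs with hab
  · rfl
  · rw [tdivPow, LinearMap.sum_apply, map_sum]
    refine (Finset.sum_eq_zero fun cd hcd => ?_).symm
    rw [Finset.HasAntidiagonal.mem_antidiagonal] at hcd
    simp only [TensorProduct.map_tmul, tcoord_tmul, divPow_mon _ le_rfl, map_smul, smul_eq_mul]
    rw [coord_mon (by omega), coord_mon (by omega)]
    by_cases h1 : m < cd.1
    · rw [Nat.choose_eq_zero_of_lt h1]; simp
    · by_cases h2 : n < cd.2
      · rw [Nat.choose_eq_zero_of_lt h2]; simp
      · by_cases h3 : m - cd.1 = a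
        · rw [if_neg (show ¬ n - cd.2 = b by omega)]; simp
        · simp [h3]

/-- Every term of K differentiates in x₀ or y₀, and x₁^m y₁^n contains neither. -/
lemma casimir_mon_self (m n : ℕ) : casimir F m n (mon F m m ⊗ₜ mon F n n) = 0 := by
  simp [casimir, polar_zero_zero_mon, polar_one_zero_mon]

lemma tensorAct_uni_mon_zero (m n : ℕ) (μ : F) :
    tensorAct m n (uni μ) (mon F m 0 ⊗ₜ mon F n 0) = mon F m 0 ⊗ₜ mon F n 0 := by
  have : ∀ n, symAct n (uni μ) (mon F n 0) = mon F n 0 := fun n => by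
    apply Sym.val_injective
    simp [val_symAct, val_mon, subst_X, uni]
  rw [tensorAct_tmul, this, this]

lemma wtProj_zero (m n : ℕ) (x : Sym F m ⊗[F] Sym F n) :
    wtProj F m n 0 x = tcoord F m n 0 0 x • (mon F m 0 ⊗ₜ mon F n 0) := by
  simp [wtProj]

/-- The Weyl element exchanges the weights m and n and commutes with K, so the line found in weight
m is carried to weight n. -/
lemma CayleyData.exists_eq_smul {m n r : ℕ} (D : CayleyData F m n r)
    {x : Sym F m ⊗[F] Sym F n} (hx : wtProj F m n n x = x) (hK : casimir F m n x = 0) :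
    ∃ c : F, x = c • D.iota (mon F r r) := by
  have h1 : wtProj F m n m (tensorAct m n (weyl F) x) = tensorAct m n (weyl F) x := by
    refine ext_tcoord fun a b => ?_
    rw [tcoord_wtProj]
    split_ifs with hab
    · rfl
    · by_cases h : a ≤ m ∧ b ≤ n
      · rw [tcoord_tensorAct_weyl h.1 h.2, ← hx, tcoord_wtProj, if_neg (by omega)]
      · rw [tcoord_eq_zero (by omega)]
  have h2 := D.eq_smul_iota _ h1 (by rw [casimir_tensorAct_weyl, hK, map_zero])
  have h3 := congrArg (tensorAct m n (weyl F)) h2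
  rw [← Module.End.mul_apply, ← tensorAct_mul, weyl_mul_weyl, tensorAct_one, map_smul, D.act_iota,
    symAct_weyl_mon (Nat.zero_le _), smul_smul] at h3
  exact ⟨_, h3⟩

end Unipotent

/-! ### K on R_r: image inside V_r, kernel equal to W_r. -/

section RSpace

variable (k F : Type*) [Field k] [Field F] [Algebra k F] (p r : ℕ)

/-- The inclusion `R_r ⊆ V_{p-1-r} ⊗ V_{p-1}`. -/
def RSpace.incl : RSpace k F p r →ₗ[F] Sym F (p - 1 - r) ⊗[F] Sym F (p - 1) :=
  (blockSubrep k F p r).toSubmodule.subtype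

lemma RSpace.incl_injective : Function.Injective (RSpace.incl k F p r) := Subtype.val_injective

lemma RSpace.incl_mem (x : RSpace k F p r) :
    RSpace.incl k F p r x ∈ (casimir F (p - 1 - r) (p - 1)).maxGenEigenspace 0 := x.2

variable {F} in
lemma RSpace.exists_incl_eq {x : Sym F (p - 1 - r) ⊗[F] Sym F (p - 1)}
    (hx : x ∈ (casimir F (p - 1 - r) (p - 1)).maxGenEigenspace 0) :
    ∃ y, RSpace.incl k F p r y = x := ⟨⟨x, hx⟩, rfl⟩

lemma RSpace.incl_RRep (g : GL (Fin 2) k) (x : RSpace k F p r) :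
    RSpace.incl k F p r (RRep k F p r g x)
      = tensorAct (p - 1 - r) (p - 1) (toMat F g) (RSpace.incl k F p r x) := rfl

/-- The operator `K` on `R_r`. -/
def casimirR : Module.End F (RSpace k F p r) :=
  LinearMap.restrict (p := (blockSubrep k F p r).toSubmodule)
    (q := (blockSubrep k F p r).toSubmodule) (casimir F (p - 1 - r) (p - 1)) fun _ hv =>
      Module.End.mapsTo_maxGenEigenspace_of_comm (Commute.refl _) 0 hv

lemma RSpace.incl_casimirR (x : RSpace k F p r) : RSpace.incl k F p r (casimirR k F p r x)
    = casimir F (p - 1 - r) (p - 1) (RSpace.incl k F p r x) := rfl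

lemma casimirR_RRep (g : GL (Fin 2) k) (x : RSpace k F p r) :
    casimirR k F p r (RRep k F p r g x) = RRep k F p r g (casimirR k F p r x) := by
  apply RSpace.incl_injective
  rw [RSpace.incl_casimirR, RSpace.incl_RRep, RSpace.incl_RRep, RSpace.incl_casimirR,
    casimir_tensorAct_toMat]

variable {p r} in
lemma twistedSym_apply (hr : r + 2 ≤ p) (g : GL (Fin 2) k) (v : Sym F r) :
    twistedSym k F p r g v = (toMat F g).det ^ (p - 1 - r) • symAct r (toMat F g) v := by
  have h : ((detPow k F ((p : ℤ) - 1 - r) g : Fˣ) : F) = (toMat F g).det ^ (p - 1 - r) := by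
    rw [show (p : ℤ) - 1 - r = ((p - 1 - r : ℕ) : ℤ) by omega, det_toMat]
    simp [detPow]
  rw [← h]
  rfl

variable {k F p r} (D : CayleyData F (p - 1 - r) (p - 1) r)
include D

variable (k) in
/-- The embedding `V_r → R_r`. -/
def CayleyData.iotaR (D : CayleyData F (p - 1 - r) (p - 1) r) : Sym F r →ₗ[F] RSpace k F p r :=
  LinearMap.codRestrict (blockSubrep k F p r).toSubmodule D.iota fun v =>
    (D.mem_iff _).2 (by rw [D.casimir_iota, map_zero])

lemma CayleyData.incl_iotaR (v : Sym F r) : RSpace.incl k F p r (D.iotaR k v) = D.iota v := rfl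

lemma CayleyData.casimirR_casimirR (x : RSpace k F p r) :
    casimirR k F p r (casimirR k F p r x) = 0 := by
  apply RSpace.incl_injective
  rw [RSpace.incl_casimirR, RSpace.incl_casimirR, map_zero]
  exact (D.mem_iff _).1 (RSpace.incl_mem k F p r x)

lemma CayleyData.iotaR_pi (x : RSpace k F p r) :
    D.iotaR k (D.pi (RSpace.incl k F p r x)) = D.c • casimirR k F p r x := by
  apply RSpace.incl_injective
  rw [D.incl_iotaR, D.iota_pi _ ((D.mem_iff _).1 (RSpace.incl_mem k F p r x)), map_smul,
    RSpace.incl_casimirR]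

lemma CayleyData.RRep_iotaR (g : GL (Fin 2) k) (v : Sym F r) : RRep k F p r g (D.iotaR k v)
    = (toMat F g).det ^ (p - 1 - r) • D.iotaR k (symAct r (toMat F g) v) := by
  apply RSpace.incl_injective
  rw [RSpace.incl_RRep, D.incl_iotaR, D.act_iota, map_smul, D.incl_iotaR]

/-- Puts the highest weight vector of the socle in the image of the tensor product of the operators
K. -/
lemma CayleyData.exists_casimirR_eq :
    ∃ v, casimirR k F p r v = D.iotaR k (mon F r 0) := by
  obtain ⟨v, hv, hv'⟩ := D.exists_casimir_eq
  obtain ⟨w, rfl⟩ := RSpace.exists_incl_eq k p r ((D.mem_iff v).2 hv)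
  exact ⟨w, RSpace.incl_injective k F p r hv'⟩

/-- K is a multiple of ιπ, and ι is equivariant for the twist in `twistedSym`. Equality is not
needed: the hypothesis on M ∩ A'_σ is only used on images of K. -/
lemma CayleyData.range_casimirR_le (hr : r + 2 ≤ p) :
    LinearMap.range (casimirR k F p r) ≤ VSub k F p r := by
  let φ : (twistedSym k F p r).IntertwiningMap (RRep k F p r) :=
    { D.iotaR k with
      isIntertwining' := fun g => LinearMap.ext fun v => by
        change D.iotaR k (twistedSym k F p r g v) = RRep k F p r g (D.iotaR k v)
        rw [twistedSym_apply k F hr, D.RRep_iotaR, map_smul] }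
  rintro _ ⟨x, rfl⟩
  refine Submodule.mem_iSup_of_mem φ ⟨D.c⁻¹ • D.pi (RSpace.incl k F p r x), ?_⟩
  change D.iotaR k _ = _
  rw [map_smul, D.iotaR_pi, smul_smul, inv_mul_cancel₀ D.c_ne_zero, one_smul]

/-- The single equivariant map π suffices, since ιπ = cK with c ≠ 0. -/
lemma CayleyData.WSub_le (hr : r + 2 ≤ p) :
    WSub k F p r ≤ LinearMap.ker (casimirR k F p r) := by
  let φ : (RRep k F p r).IntertwiningMap (twistedSym k F p r) :=
    { D.pi ∘ₗ RSpace.incl k F p r with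
      isIntertwining' := fun g => LinearMap.ext fun v => by
        change D.pi (RSpace.incl k F p r (RRep k F p r g v))
          = twistedSym k F p r g (D.pi (RSpace.incl k F p r v))
        rw [twistedSym_apply k F hr, RSpace.incl_RRep, D.pi_act] }
  intro x hx
  have h : D.pi (RSpace.incl k F p r x) = 0 := (Submodule.mem_iInf _).1 hx φ
  have := D.iotaR_pi x
  rw [h, map_zero] at this
  exact (smul_eq_zero.1 this.symm).resolve_left D.c_ne_zero

variable [Fintype k] [Fact p.Prime] [CharP F p]

/-- The socle generator of `R_r` is obtained from the extreme weight vector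
`x₁^(p-1-r) y₁^(p-1)` by a divided power. -/
lemma CayleyData.exists_tdivPow_eq (hr : r + 2 ≤ p) (hq : p ≤ Fintype.card k)
    (hqr : p < Fintype.card k ∨ r ≠ 0) :
    ∃ c : F, c ≠ 0 ∧ tdivPow F (p - 1 - r) (p - 1) (p - 1)
      (mon F (p - 1 - r) (p - 1 - r) ⊗ₜ mon F (p - 1) (p - 1)) = c • D.iota (mon F r 0) := by
  have hK : casimir F (p - 1 - r) (p - 1) (tdivPow F (p - 1 - r) (p - 1) (p - 1) (mon F (p - 1 - r) (p - 1 - r) ⊗ₜ mon F (p - 1) (p - 1))) = 0 := by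
    -- Up to sign the divided power is a combination of translates of x₁^(p-1-r) y₁^(p-1), which K
    -- kills. Extracting it needs p - 1 - r < q - 1, which is what `hqr` provides.
    have h := sum_pow_smul_eq_neg (k := k) (F := F) (Finset.range ((p - 1 - r) + (p - 1) + 1)) (fun t => t)
      (fun t => tdivPow F (p - 1 - r) (p - 1) t (mon F (p - 1 - r) (p - 1 - r) ⊗ₜ mon F (p - 1) (p - 1))) (t₀ := (p - 1))
      (Finset.mem_range.2 (by omega)) (show (p - 1) ≤ _ by omega) (fun t ht hne _ => by
        rw [Finset.mem_range] at ht
        exact ⟨hne, by omega⟩)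
    rw [← neg_eq_zero, ← map_neg, ← h, map_sum]
    refine Finset.sum_eq_zero fun l _ => ?_
    have h2 : tensorAct (p - 1 - r) (p - 1) (toMat F (uniGL l)) (mon F (p - 1 - r) (p - 1 - r) ⊗ₜ mon F (p - 1) (p - 1))
        = ∑ t ∈ Finset.range ((p - 1 - r) + (p - 1) + 1), algebraMap k F l ^ t •
          tdivPow F (p - 1 - r) (p - 1) t (mon F (p - 1 - r) (p - 1 - r) ⊗ₜ mon F (p - 1) (p - 1)) := by
      rw [toMat_uniGL, tensorAct_uni (Nat.lt_succ_self _)]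
      simp
    rw [← h2, map_smul, casimir_tensorAct_toMat, casimir_mon_self, map_zero, smul_zero]
  -- The constant is the coordinate at (0, p-1-r), the binomial coefficient of p - 1 over p - 1 - r,
  -- a unit modulo p.
  refine ⟨_, ?_, D.eq_smul_iota _ (wtProj_tdivPow_mon (p - 1 - r) (p - 1) (p - 1) (p - 1 - r) (by omega)) hK⟩
  rw [tcoord_tdivPow_mon (p - 1 - r) (p - 1) (p - 1) 0 (p - 1 - r) (by omega) (by omega) (by omega), Nat.choose_zero_right,
    Nat.cast_one, one_mul]
  intro h
  have h1 := (CharP.cast_eq_zero_iff F p _).1 h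
  have h2 : p ∣ (p - 1).factorial := by
    rw [← Nat.choose_mul_factorial_mul_factorial (show (p - 1 - r) ≤ (p - 1) by omega), mul_assoc]
    exact Dvd.dvd.mul_right h1 _
  rw [(Fact.out : p.Prime).dvd_factorial] at h2
  omega

/-- Equivariant maps `R_r → V_r ⊗ det^(p-1-r)` vanish on the kernel of `K`. -/
theorem CayleyData.eq_zero_of_casimirR_eq_zero (hr : r + 2 ≤ p) (hq : p ≤ Fintype.card k)
    (hqr : p < Fintype.card k ∨ r ≠ 0)
    (ψ : (RRep k F p r).IntertwiningMap (twistedSym k F p r)) {x : RSpace k F p r}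
    (hx : casimirR k F p r x = 0) : ψ.toLinearMap x = 0 := by
  classical
  set m := p - 1 - r with hm
  set n := p - 1 with hn
  have hψ : ∀ g v, ψ.toLinearMap (RRep k F p r g v)
      = (toMat F g).det ^ m • symAct r (toMat F g) (ψ.toLinearMap v) := fun g v => by
    rw [hm, hn, ← twistedSym_apply k F hr]
    exact LinearMap.congr_fun (ψ.isIntertwining' g) v
  have hψu : ∀ (l : k) v, ψ.toLinearMap (RRep k F p r (uniGL l) v)
      = symAct r (uni (algebraMap k F l)) (ψ.toLinearMap v) := fun l v => by
    rw [hψ, toMat_uniGL, det_uni, one_pow, one_smul]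
  -- the image of the extreme weight vector
  obtain ⟨e, he⟩ := RSpace.exists_incl_eq k p r ((D.mem_iff (mon F m m ⊗ₜ mon F n n)).2
    (by rw [casimir_mon_self, map_zero]))
  have hy : ψ.toLinearMap e = coord F r 0 (ψ.toLinearMap e) • mon F r 0 := by
    -- Once det^m is cancelled, ψ(e) has torus weight p - 1 modulo q - 1. Among the exponents 0, …,
    -- r ≤ p - 2 only 0 can be congruent to it.
    have htor : ∀ t : kˣ, symAct r (tor (algebraMap k F t)) (ψ.toLinearMap e)
        = algebraMap k F t ^ n • ψ.toLinearMap e := fun t => by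
      have h1 : RRep k F p r (torGL t) e = algebraMap k F t ^ (m + n) • e := by
        apply RSpace.incl_injective
        rw [RSpace.incl_RRep, map_smul, he, tensorAct_tmul, toMat_torGL, symAct_tor_mon,
          symAct_tor_mon, TensorProduct.smul_tmul_smul, pow_add]
      have h2 := hψ (torGL t) e
      rw [h1, map_smul, toMat_torGL, det_tor, pow_add, mul_smul] at h2
      refine (smul_right_injective _ (pow_ne_zero m ?_) h2).symm
      simp
    refine Sym.ext_coord fun j hj => ?_
    rw [map_smul, coord_mon (Nat.zero_le _)]
    by_cases hj0 : 0 = j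
    · rw [if_pos hj0, ← hj0, smul_eq_mul, mul_one]
    · rw [if_neg hj0, smul_zero]
      have h1 : ∀ t : kˣ, algebraMap k F t ^ (Fintype.card k - 1 - n + j)
          * coord F r j (ψ.toLinearMap e) = algebraMap k F t ^ (Fintype.card k - 1)
          * coord F r j (ψ.toLinearMap e) := fun t => by
        have := congrArg (coord F r j) (htor t)
        rw [coord_symAct_tor, map_smul, smul_eq_mul] at this
        rw [pow_add, mul_assoc, this, ← mul_assoc, ← pow_add,
          Nat.sub_add_cancel (show n ≤ Fintype.card k - 1 by omega)]
      have h2 := Finset.sum_congr rfl fun t (_ : t ∈ (Finset.univ : Finset kˣ)) => h1 t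
      rw [← Finset.sum_mul, ← Finset.sum_mul, sum_units_algebraMap_pow, sum_units_algebraMap_pow,
        if_neg, if_pos dvd_rfl, zero_mul] at h2
      · simpa using h2.symm
      · exact fun h => absurd (Nat.le_of_dvd (by omega) h) (by omega)
  -- hence `ψ` vanishes on the socle
  have hs : ψ.toLinearMap (D.iotaR k (mon F r 0)) = 0 := by
    obtain ⟨c, hc, hP⟩ := D.exists_tdivPow_eq (k := k) hr hq hqr
    have h := sum_pow_smul_eq_neg (k := k) (F := F) (Finset.range (m + n + 1)) (fun t => t)
      (fun t => tdivPow F m n t (mon F m m ⊗ₜ mon F n n)) (t₀ := n)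
      (Finset.mem_range.2 (by omega)) (show n ≤ _ by omega) (fun t ht hne _ => by
        rw [Finset.mem_range] at ht
        exact ⟨hne, by omega⟩)
    have h1 : ∑ l : k, algebraMap k F l ^ (Fintype.card k - 1 - n) • RRep k F p r (uniGL l) e
        = -(c • D.iotaR k (mon F r 0)) := by
      apply RSpace.incl_injective
      rw [map_neg, map_smul, D.incl_iotaR, ← hP, ← h, map_sum]
      refine Finset.sum_congr rfl fun l _ => ?_
      rw [map_smul, RSpace.incl_RRep, he, toMat_uniGL]
      change _ • tensorAct m n (uni _) _ = _
      rw [tensorAct_uni (Nat.lt_succ_self (m + n))]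
      simp
    have h2 := congrArg ψ.toLinearMap h1
    rw [map_neg, map_smul, map_sum] at h2
    -- X₀^r is fixed by the unipotent matrices, so the combination becomes a power sum times ψ(e).
    -- Its exponent q - p is 0 or not divisible by q - 1, and the sum vanishes.
    have h3 : ∀ l : k, ψ.toLinearMap (algebraMap k F l ^ (Fintype.card k - 1 - n) •
        RRep k F p r (uniGL l) e) = algebraMap k F l ^ (Fintype.card k - 1 - n) •
        ψ.toLinearMap e := fun l => by
      rw [map_smul, hψu, hy, map_smul, symAct_uni r _ (Nat.lt_succ_self r), LinearMap.sum_apply,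
        Finset.sum_eq_single 0]
      · simp [divPow_mon]
      · intro t _ ht
        rw [LinearMap.smul_apply, divPow_mon _ (Nat.zero_le _),
          Nat.choose_eq_zero_of_lt (by omega)]
        simp
      · intro h; simp at h
    rw [Finset.sum_congr rfl fun l _ => h3 l, ← Finset.sum_smul, sum_algebraMap_pow, if_neg,
      zero_smul] at h2
    · exact (smul_eq_zero.1 (neg_eq_zero.1 h2.symm)).resolve_left hc
    · rintro ⟨h4, h5⟩
      exact absurd (Nat.le_of_dvd (by omega) h5) (by omega)
  have hs' : ψ.toLinearMap (D.iotaR k (mon F r r)) = 0 := by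
    have h1 := D.RRep_iotaR (weylGL k) (mon F r 0)
    have h2 := hψ (weylGL k) (D.iotaR k (mon F r 0))
    rw [hs, map_zero, smul_zero, h1, map_smul, toMat_weylGL, symAct_weyl_mon (Nat.zero_le _)] at h2
    exact (smul_eq_zero.1 h2).resolve_left (pow_ne_zero _ (by rw [det_weyl]; simp))
  by_contra hne
  -- a vector of the kernel of `K` mapping to a multiple of `X₁^r`
  obtain ⟨x₂, d, hd, hx₂, hψx₂⟩ : ∃ (x₂ : RSpace k F p r) (d : F), d ≠ 0 ∧
      casimirR k F p r x₂ = 0 ∧ ψ.toLinearMap x₂ = d • mon F r r := by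
    -- For the top exponent j of ψ(x), the j-th divided power leaves only a multiple of X₀^r, and
    -- the Weyl element turns it into X₁^r.
    obtain ⟨j, hj, hjne, hjmax⟩ : ∃ j ≤ r, coord F r j (ψ.toLinearMap x) ≠ 0 ∧
        ∀ i, j < i → coord F r i (ψ.toLinearMap x) = 0 := by
      obtain ⟨j, hj⟩ : ∃ j, coord F r j (ψ.toLinearMap x) ≠ 0 := by
        by_contra! h
        exact hne (Sym.ext_coord fun j _ => by rw [h, map_zero])
      have hjr : ∀ j, coord F r j (ψ.toLinearMap x) ≠ 0 → j ≤ r := fun j hj => by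
        by_contra! h
        exact hj (coord_eq_zero h _)
      refine ⟨Nat.findGreatest (fun j => coord F r j (ψ.toLinearMap x) ≠ 0) r,
        Nat.findGreatest_le _,
        Nat.findGreatest_spec (P := fun j => coord F r j (ψ.toLinearMap x) ≠ 0) (hjr j hj) hj, fun i hi => ?_⟩
      by_contra h
      exact Nat.findGreatest_is_greatest hi (hjr i h) h
    have h := sum_pow_smul_eq_neg (k := k) (F := F) (Finset.range (r + 1)) (fun t => t)
      (fun t => divPow F r t (ψ.toLinearMap x)) (t₀ := j)
      (Finset.mem_range.2 (by omega)) (show j ≤ _ by omega) (fun t ht hne _ => by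
        rw [Finset.mem_range] at ht
        exact ⟨hne, by omega⟩)
    have hE : divPow F r j (ψ.toLinearMap x) = coord F r j (ψ.toLinearMap x) • mon F r 0 := by
      refine Sym.ext_coord fun a _ => ?_
      rw [coord_divPow, map_smul, coord_mon (Nat.zero_le _)]
      split_ifs with ha
      · simp [← ha]
      · rw [hjmax _ (by omega), mul_zero, smul_zero]
    refine ⟨RRep k F p r (weylGL k) (∑ l : k, algebraMap k F l ^ (Fintype.card k - 1 - j) •
      RRep k F p r (uniGL l) x), -((-1) ^ m * coord F r j (ψ.toLinearMap x)), ?_, ?_, ?_⟩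
    · exact neg_ne_zero.2 (mul_ne_zero (pow_ne_zero _ (by simp)) hjne)
    · rw [casimirR_RRep, map_sum, Finset.sum_eq_zero, map_zero]
      intro l _
      rw [map_smul, casimirR_RRep, hx, map_zero, smul_zero]
    · have h1 : ψ.toLinearMap (∑ l : k, algebraMap k F l ^ (Fintype.card k - 1 - j) •
          RRep k F p r (uniGL l) x) = -(coord F r j (ψ.toLinearMap x) • mon F r 0) := by
        rw [← hE, ← h, map_sum]
        refine Finset.sum_congr rfl fun l _ => ?_
        rw [map_smul, hψu, symAct_uni r _ (Nat.lt_succ_self r)]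
        simp
      rw [hψ, h1, toMat_weylGL, det_weyl, map_neg, map_smul, symAct_weyl_mon (Nat.zero_le _),
        smul_neg, smul_smul, neg_smul]
      rfl
  -- its component of `diag(1, t)`-weight `p - 1`
  set y := RSpace.incl k F p r x₂ with hy₂
  have hKy : casimir F m n y = 0 := by
    rw [hy₂, ← RSpace.incl_casimirR, hx₂, map_zero]
  set x₃ := ∑ t : kˣ, algebraMap k F t ^ (Fintype.card k - 1 - n) • RRep k F p r (torGL t) x₂
    with hx₃
  have hψx₃ : ψ.toLinearMap x₃ = -(d • mon F r r) := by
    rw [hx₃, map_sum]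
    have : ∀ t : kˣ, ψ.toLinearMap (algebraMap k F t ^ (Fintype.card k - 1 - n) •
        RRep k F p r (torGL t) x₂) = algebraMap k F t ^ (Fintype.card k - 1) • d • mon F r r := by
      intro t
      rw [map_smul, hψ, toMat_torGL, det_tor, hψx₂, map_smul, symAct_tor_mon, smul_comm d,
        smul_smul, smul_smul, ← pow_add, ← pow_add]
      congr 2
      omega
    rw [Finset.sum_congr rfl fun t _ => this t, ← Finset.sum_smul, sum_units_algebraMap_pow,
      if_pos dvd_rfl, neg_one_smul]
  have hinc : RSpace.incl k F p r x₃ = ∑ N ∈ Finset.range (m + n + 1),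
      (if Fintype.card k - 1 ∣ Fintype.card k - 1 - n + N then -1 else 0 : F) •
        wtProj F m n N y := by
    have h1 : ∀ t : kˣ, tensorAct m n (tor (algebraMap k F t)) y
        = ∑ N ∈ Finset.range (m + n + 1), algebraMap k F t ^ N • wtProj F m n N y := fun t => by
      conv_lhs => rw [sum_wtProj (Nat.lt_succ_self (m + n)) y]
      rw [map_sum]
      exact Finset.sum_congr rfl fun N _ => tensorAct_tor_of_wt (wtProj_wtProj _ _ _ _) _
    rw [hx₃, map_sum]
    simp only [← sum_units_algebraMap_pow (k := k) (F := F)]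
    rw [← sum_smul_expansion (fun t : kˣ => algebraMap k F t)]
    refine Finset.sum_congr rfl fun t _ => ?_
    rw [map_smul, RSpace.incl_RRep, toMat_torGL, ← h1 t]
  obtain ⟨c, hc⟩ := D.exists_eq_smul (wtProj_wtProj m n n y)
    (by rw [casimir_wtProj, hKy, map_zero])
  -- The weights in [0, m + n] congruent to p - 1 modulo q - 1 are p - 1 and, only when q = p, also
  -- 0; the latter contributes a multiple of x₀^m y₀^n.
  obtain ⟨c', hc', hc0⟩ : ∃ c' : F, RSpace.incl k F p r x₃
      = -(c • D.iota (mon F r r)) + c' • (mon F m 0 ⊗ₜ mon F n 0) ∧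
        (p < Fintype.card k → c' = 0) := by
    have hNn : ∀ N ∈ Finset.range (m + n + 1), N ≠ n → N ≠ 0 →
        (if Fintype.card k - 1 ∣ Fintype.card k - 1 - n + N then -1 else 0 : F) •
          wtProj F m n N y = 0 := fun N hN h1 h2 => by
      rw [Finset.mem_range] at hN
      rw [if_neg, zero_smul]
      rintro ⟨b, hb⟩
      have hb1 : b < 2 := by
        by_contra hb2
        have : (Fintype.card k - 1) * 2 ≤ (Fintype.card k - 1) * b :=
          Nat.mul_le_mul_left _ (by omega)
        omega
      interval_cases b <;> omega
    rw [Finset.sum_eq_add_of_mem n 0 (Finset.mem_range.2 (by omega))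
      (Finset.mem_range.2 (by omega)) (by omega) (fun N hN h => hNn N hN h.1 h.2),
      Nat.sub_add_cancel (show n ≤ Fintype.card k - 1 by omega), if_pos dvd_rfl, hc, neg_one_smul,
      wtProj_zero, smul_smul] at hinc
    refine ⟨_, hinc, fun h => ?_⟩
    rw [if_neg, zero_mul]
    exact fun h' => absurd (Nat.le_of_dvd (by omega) h') (by omega)
  have hd0 : -(d • mon F r r) ≠ 0 := by
    refine neg_ne_zero.2 (smul_ne_zero hd fun h => ?_)
    have := congrArg (coord F r r) h
    rw [coord_mon le_rfl, if_pos rfl, map_zero] at this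
    exact one_ne_zero this
  by_cases hpk : p < Fintype.card k
  · rw [hc0 hpk, zero_smul, add_zero] at hc'
    have : x₃ = -(c • D.iotaR k (mon F r r)) := by
      apply RSpace.incl_injective
      rw [hc', map_neg, map_smul, D.incl_iotaR]
    rw [this, map_neg, map_smul, hs', smul_zero, neg_zero] at hψx₃
    exact hd0 hψx₃.symm
  -- For q = p the operator u(1) - 1 removes the invariant x₀^m y₀^n, but it does not kill X₁^r
  -- because r ≠ 0.
  · have hr0 := hqr.resolve_left hpk
    have h1 : RRep k F p r (uniGL 1) x₃ - x₃
        = -(c • (RRep k F p r (uniGL 1) (D.iotaR k (mon F r r)) - D.iotaR k (mon F r r))) := by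
      apply RSpace.incl_injective
      rw [map_sub, RSpace.incl_RRep, hc', map_neg, map_smul, map_sub, RSpace.incl_RRep,
        D.incl_iotaR, map_add, map_neg, map_smul, map_smul, toMat_uniGL, tensorAct_uni_mon_zero]
      module
    have h2 := congrArg ψ.toLinearMap h1
    rw [map_sub, hψu, map_neg, map_smul, map_sub, hψu, hs', map_zero, sub_zero, smul_zero,
      neg_zero, hψx₃, map_neg, map_smul, map_one] at h2
    have h3 := congrArg (coord F r 0) h2
    rw [map_sub, map_neg, map_neg, map_smul, map_smul, symAct_uni r _ (Nat.lt_succ_self r),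
      LinearMap.sum_apply, map_sum, Finset.sum_eq_single r] at h3
    · rw [LinearMap.smul_apply, divPow_mon r le_rfl, coord_mon le_rfl, if_neg hr0] at h3
      simp [coord_mon, hd] at h3
    · intro t ht htr
      rw [Finset.mem_range] at ht
      rw [LinearMap.smul_apply, divPow_mon t le_rfl, map_smul, map_smul, coord_mon (by omega),
        if_neg (by omega), smul_zero, smul_zero]
    · exact fun h => absurd (Finset.mem_range.2 (Nat.lt_succ_self r)) h

lemma CayleyData.WSub_eq (hr : r + 2 ≤ p) (hq : p ≤ Fintype.card k)
    (hqr : p < Fintype.card k ∨ r ≠ 0) : WSub k F p r = LinearMap.ker (casimirR k F p r) :=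
  le_antisymm (D.WSub_le hr) (le_iInf fun ψ _ hx => D.eq_zero_of_casimirR_eq_zero hr hq hqr ψ hx)

end RSpace

/-! ### Tensor products over a finite index set: one-factor operators, coordinates, kernels. -/

section PiTensor

variable {F : Type*} [Field F] {ι : Type*}
  {U U' : ι → Type*} [∀ i, AddCommGroup (U i)] [∀ i, Module F (U i)]
  [∀ i, AddCommGroup (U' i)] [∀ i, Module F (U' i)]

lemma map_eq_zero_of_apply_eq_zero {φ : ∀ j, U j →ₗ[F] U' j} (i : ι) (h : φ i = 0) :
    PiTensorProduct.map φ = 0 := by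
  refine PiTensorProduct.ext (MultilinearMap.ext fun x => ?_)
  simp only [LinearMap.compMultilinearMap_apply, PiTensorProduct.map_tprod]
  exact (PiTensorProduct.tprod F).map_coord_zero i (by simp [h])

lemma range_map_le_subTensor {φ : ∀ j, U j →ₗ[F] U' j} {N : ∀ i, Submodule F (U' i)}
    (h : ∀ i, LinearMap.range (φ i) ≤ N i) :
    LinearMap.range (PiTensorProduct.map φ) ≤ subTensor N := by
  have : φ = fun i => (N i).subtype ∘ₗ (φ i).codRestrict (N i) fun x => h i ⟨x, rfl⟩ := by
    ext1 i; rfl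
  rw [this, PiTensorProduct.map_comp]
  exact LinearMap.range_comp_le_range _ _

/-- A generalised inverse h makes 1 - hg a projection onto ker g, the tool for intersecting kernels
in a tensor product. -/
lemma exists_comp_comp_eq {V W : Type*} [AddCommGroup V] [Module F V] [AddCommGroup W] [Module F W]
    (g : V →ₗ[F] W) : ∃ h : W →ₗ[F] V, g ∘ₗ h ∘ₗ g = g := by
  obtain ⟨s, hs⟩ := LinearMap.exists_rightInverse_of_surjective g.rangeRestrict
    (LinearMap.range_rangeRestrict g)
  obtain ⟨h, hh⟩ := LinearMap.exists_extend s
  refine ⟨h, LinearMap.ext fun x => ?_⟩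
  have h1 := LinearMap.congr_fun hh (g.rangeRestrict x)
  have h2 := congrArg Subtype.val (LinearMap.congr_fun hs (g.rangeRestrict x))
  simp only [LinearMap.comp_apply] at h1 h2 ⊢
  change h (g x) = _ at h1
  rw [h1]
  exact h2

lemma map_injective {φ : ∀ j, U j →ₗ[F] U' j} (h : ∀ i, Function.Injective (φ i)) :
    Function.Injective (PiTensorProduct.map φ) := by
  choose s hs using fun i => LinearMap.exists_leftInverse_of_injective (φ i)
    (LinearMap.ker_eq_bot.2 (h i))
  refine Function.LeftInverse.injective (g := PiTensorProduct.map s) fun x => ?_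
  rw [← LinearMap.comp_apply, ← PiTensorProduct.map_comp]
  simp [hs, PiTensorProduct.map_id]

/-- The tensor product of a family of linear forms. -/
def tprodDual [Fintype ι] (φ : ∀ i, Module.Dual F (U i)) : Module.Dual F (⨂[F] i, U i) :=
  PiTensorProduct.dualDistrib (PiTensorProduct.tprod F φ)

@[simp] lemma tprodDual_tprod [Fintype ι] (φ : ∀ i, Module.Dual F (U i)) (x : ∀ i, U i) :
    tprodDual φ (PiTensorProduct.tprod F x) = ∏ i, φ i (x i) :=
  PiTensorProduct.dualDistrib_apply φ x

lemma tprodDual_smul [Fintype ι] (c : ι → F) (φ : ∀ i, Module.Dual F (U i)) :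
    tprodDual (fun i => c i • φ i) = (∏ i, c i) • tprodDual φ := by
  rw [tprodDual, MultilinearMap.map_smul_univ, map_smul, tprodDual]

lemma tprodDual_map [Fintype ι] (φ : ∀ i, Module.Dual F (U' i)) (g : ∀ i, U i →ₗ[F] U' i)
    (x : ⨂[F] i, U i) :
    tprodDual φ (PiTensorProduct.map g x) = tprodDual (fun i => φ i ∘ₗ g i) x := by
  have : tprodDual φ ∘ₗ PiTensorProduct.map g = tprodDual (fun i => φ i ∘ₗ g i) := by
    refine PiTensorProduct.ext (MultilinearMap.ext fun x => ?_)
    simp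
  exact LinearMap.congr_fun this x

variable [DecidableEq ι]

/-- The operator acting by `g` on the `i`-th factor of a tensor product. -/
def atIdx (i : ι) (g : Module.End F (U i)) : Module.End F (⨂[F] i, U i) :=
  PiTensorProduct.map (Function.update (fun _ => LinearMap.id) i g)

lemma map_comp_atIdx (i : ι) (g : Module.End F (U i)) (φ : ∀ j, U j →ₗ[F] U' j) :
    PiTensorProduct.map φ ∘ₗ atIdx i g
      = PiTensorProduct.map (Function.update φ i (φ i ∘ₗ g)) := by
  rw [atIdx, ← PiTensorProduct.map_comp]
  congr 1
  ext1 j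
  by_cases h : j = i
  · subst h; simp
  · simp [h]

lemma atIdx_comp_map (i : ι) (g : Module.End F (U' i)) (φ : ∀ j, U j →ₗ[F] U' j) :
    atIdx i g ∘ₗ PiTensorProduct.map φ
      = PiTensorProduct.map (Function.update φ i (g ∘ₗ φ i)) := by
  rw [atIdx, ← PiTensorProduct.map_comp]
  congr 1
  ext1 j
  by_cases h : j = i
  · subst h; simp
  · simp [h]

lemma atIdx_map_comm (i : ι) {g : Module.End F (U i)} {g' : Module.End F (U' i)}
    {φ : ∀ j, U j →ₗ[F] U' j} (h : g' ∘ₗ φ i = φ i ∘ₗ g) (x : ⨂[F] i, U i) :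
    atIdx i g' (PiTensorProduct.map φ x) = PiTensorProduct.map φ (atIdx i g x) := by
  rw [← LinearMap.comp_apply, ← LinearMap.comp_apply, atIdx_comp_map, map_comp_atIdx, h]

lemma atIdx_atIdx (i : ι) (g h : Module.End F (U i)) (x : ⨂[F] i, U i) :
    atIdx i g (atIdx i h x) = atIdx i (g ∘ₗ h) x := by
  conv_lhs => rw [atIdx, atIdx, ← LinearMap.comp_apply, ← PiTensorProduct.map_comp]
  rw [atIdx]
  congr 2
  ext1 j
  by_cases hj : j = i
  · subst hj; simp
  · simp [hj]

lemma atIdx_zero (i : ι) : atIdx i (0 : Module.End F (U i)) = 0 :=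
  map_eq_zero_of_apply_eq_zero i (by simp)

lemma atIdx_sub (i : ι) (g h : Module.End F (U i)) : atIdx i (g - h) = atIdx i g - atIdx i h :=
  (PiTensorProduct.mapMultilinear F U U).map_update_sub _ _ _ _

lemma atIdx_id (i : ι) : atIdx i (LinearMap.id : Module.End F (U i)) = LinearMap.id := by
  rw [atIdx, Function.update_eq_self, PiTensorProduct.map_id]

lemma subTensor_le_ker_atIdx {N : ∀ i, Submodule F (U i)} (i : ι) {g : Module.End F (U i)}
    (h : N i ≤ LinearMap.ker g) : subTensor N ≤ LinearMap.ker (atIdx i g) := by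
  rintro _ ⟨x, rfl⟩
  rw [LinearMap.mem_ker, ← LinearMap.comp_apply, atIdx_comp_map,
    map_eq_zero_of_apply_eq_zero i, LinearMap.zero_apply]
  rw [Function.update_self]
  ext y
  exact h y.2

variable [Fintype ι]

/-- The intersection of the kernels of operators acting on the different factors. -/
lemma mem_subTensor_ker {g : ∀ i, Module.End F (U i)} {x : ⨂[F] i, U i}
    (hx : ∀ i, atIdx i (g i) x = 0) : x ∈ subTensor fun i => LinearMap.ker (g i) := by
  choose h hh using fun i => exists_comp_comp_eq (g i)
  -- As g_i on the i-th factor kills x, the projection 1 - h_i g_i there fixes x; hence so does the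
  -- product of these projections over any set of factors.
  have hS : ∀ S : Finset ι, PiTensorProduct.map
      (fun i => if i ∈ S then LinearMap.id - h i ∘ₗ g i else LinearMap.id) x = x := by
    intro S
    induction S using Finset.induction_on with
    | empty => simp [PiTensorProduct.map_id]
    | insert i S hi ih =>
      have h1 : (fun j => if j ∈ insert i S then LinearMap.id - h j ∘ₗ g j else LinearMap.id)
          = Function.update (fun j => if j ∈ S then LinearMap.id - h j ∘ₗ g j else LinearMap.id) i
            ((LinearMap.id - h i ∘ₗ g i) ∘ₗ
              (if i ∈ S then LinearMap.id - h i ∘ₗ g i else LinearMap.id)) := by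
        ext1 j
        by_cases hj : j = i
        · subst hj; simp [hi]
        · simp [hj]
      rw [h1, ← atIdx_comp_map, LinearMap.comp_apply, ih, atIdx_sub, LinearMap.sub_apply,
        ← atIdx_atIdx, hx, map_zero, sub_zero, atIdx_id, LinearMap.id_apply]
  refine range_map_le_subTensor (φ := fun i => LinearMap.id - h i ∘ₗ g i) (fun i => ?_) ⟨x, ?_⟩
  · rintro _ ⟨y, rfl⟩
    have := LinearMap.congr_fun (hh i) y
    simp only [LinearMap.comp_apply] at this
    simp [this]
  · simpa using hS Finset.univ

lemma tprod_sum_smul (s : Finset ℕ) (μ : ι → F) (P : ∀ i, ℕ → U i) :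
    PiTensorProduct.tprod F (fun i => ∑ t ∈ s, μ i ^ t • P i t)
      = ∑ t ∈ Fintype.piFinset fun _ : ι => s, (∏ i, μ i ^ t i) •
        PiTensorProduct.tprod F fun i => P i (t i) := by
  rw [MultilinearMap.map_sum_finset]
  exact Finset.sum_congr rfl fun t _ => MultilinearMap.map_smul_univ _ _ _

lemma tprodDual_sum_smul (s : Finset ℕ) (μ : ι → F) (P : ∀ i, ℕ → Module.Dual F (U i)) :
    tprodDual (fun i => ∑ t ∈ s, μ i ^ t • P i t)
      = ∑ t ∈ Fintype.piFinset fun _ : ι => s, (∏ i, μ i ^ t i) •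
        tprodDual fun i => P i (t i) := by
  simp only [tprodDual, tprod_sum_smul s μ P, map_sum, map_smul]

lemma tprodDual_atIdx (φ : ∀ i, Module.Dual F (U i)) (i : ι) (g : Module.End F (U i))
    (x : ⨂[F] i, U i) :
    tprodDual φ (atIdx i g x) = tprodDual (Function.update φ i (φ i ∘ₗ g)) x := by
  rw [atIdx, tprodDual_map]
  congr 2
  ext1 j
  by_cases h : j = i
  · subst h; simp
  · simp [h]

lemma tprodDual_update_add_smul (φ : ∀ i, Module.Dual F (U i)) (i : ι) (a b : F)
    (ψ ψ' : Module.Dual F (U i)) :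
    tprodDual (Function.update φ i (a • ψ + b • ψ')) = a • tprodDual (Function.update φ i ψ)
      + b • tprodDual (Function.update φ i ψ') := by
  have h := (PiTensorProduct.tprod F (s := fun i => Module.Dual F (U i))).map_update_add φ i
    (a • ψ) (b • ψ')
  rw [MultilinearMap.map_update_smul, MultilinearMap.map_update_smul] at h
  rw [tprodDual, h, map_add, map_smul, map_smul]
  rfl

/-- Coordinates determine the elements of a tensor product. -/
lemma eq_zero_of_tprodDual {κ : Type*} {s : ι → Finset κ} {e : ∀ i, κ → Module.Dual F (U i)}
    {v : ∀ i, κ → U i} (h : ∀ i u, u = ∑ c ∈ s i, e i c u • v i c) {x : ⨂[F] i, U i}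
    (hx : ∀ c ∈ Fintype.piFinset s, tprodDual (fun i => e i (c i)) x = 0) : x = 0 := by
  have h1 : (LinearMap.id : Module.End F (⨂[F] i, U i)) = ∑ c ∈ Fintype.piFinset s,
      (tprodDual fun i => e i (c i)).smulRight (PiTensorProduct.tprod F fun i => v i (c i)) := by
    refine PiTensorProduct.ext (MultilinearMap.ext fun u => ?_)
    simp only [LinearMap.compMultilinearMap_apply, LinearMap.id_apply, LinearMap.sum_apply,
      LinearMap.smulRight_apply, tprodDual_tprod]
    conv_lhs => rw [show u = fun i => ∑ c ∈ s i, e i c (u i) • v i c from funext fun i => h i (u i)]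
    rw [MultilinearMap.map_sum_finset]
    exact Finset.sum_congr rfl fun t _ => MultilinearMap.map_smul_univ _ _ _
  have h2 := LinearMap.congr_fun h1 x
  rw [LinearMap.id_apply, LinearMap.sum_apply] at h2
  rw [h2]
  exact Finset.sum_eq_zero fun c hc => by rw [LinearMap.smulRight_apply, hx c hc, zero_smul]

end PiTensor

/-! ### Digit expansions and exponents modulo q - 1. -/

section Digits

/-- The integer with `p`-adic digits `t i`. -/
def ofDigits (p : ℕ) {f : ℕ} (t : Fin f → ℕ) : ℕ := ∑ i : Fin f, p ^ (i : ℕ) * t i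

lemma ofDigits_succ (p : ℕ) {f : ℕ} (t : Fin (f + 1) → ℕ) :
    ofDigits p t = t 0 + p * ofDigits p fun i => t i.succ := by
  rw [ofDigits, Fin.sum_univ_succ, ofDigits, Finset.mul_sum]
  simp [pow_succ', mul_assoc]

/-- Entries may exceed p - 1: differences below p are enough for congruence modulo p to force
equality digit by digit. Weights up to 2p - 2 have to be compared. -/
lemma ofDigits_injective {p f : ℕ} {t n : Fin f → ℕ} (h1 : ∀ i, t i < n i + p)
    (h2 : ∀ i, n i < t i + p) (h : ofDigits p t = ofDigits p n) : t = n := by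
  induction f with
  | zero => exact Subsingleton.elim _ _
  | succ f ih =>
    rw [ofDigits_succ, ofDigits_succ] at h
    have h0 : t 0 = n 0 := by
      have h1 := h1 0
      have h2 := h2 0
      have h3 : (t 0 : ℤ) - n 0 = p * ((ofDigits p fun i : Fin f => n i.succ)
        - (ofDigits p fun i : Fin f => t i.succ)) := by
        have : ((t 0 : ℤ) + p * ofDigits p fun i : Fin f => t i.succ)
          = n 0 + p * ofDigits p fun i : Fin f => n i.succ := by exact_mod_cast h
        linarith
      have h4 : (t 0 : ℤ) - n 0 = 0 := by
        refine Int.eq_zero_of_abs_lt_dvd ⟨_, h3⟩ ?_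
        rw [abs_lt]
        constructor <;> omega
      omega
    have hp : 0 < p := by have := h1 0; omega
    have := ih (fun i => h1 i.succ) (fun i => h2 i.succ)
      (Nat.eq_of_mul_eq_mul_left hp (by omega))
    ext i
    refine Fin.cases ?_ (fun i => ?_) i
    · exact h0
    · exact congrFun this i

lemma ofDigits_sub_one {p : ℕ} (hp : 0 < p) (f : ℕ) :
    (ofDigits p fun _ : Fin f => p - 1) = p ^ f - 1 := by
  have : (ofDigits p fun _ : Fin f => p - 1) + 1 = p ^ f := by
    induction f with
    | zero => simp [ofDigits]
    | succ f ih =>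
      rw [ofDigits_succ, pow_succ', ← ih, mul_add]
      omega
  omega

lemma ofDigits_mono (p : ℕ) {f : ℕ} {t n : Fin f → ℕ} (h : ∀ i, t i ≤ n i) :
    ofDigits p t ≤ ofDigits p n :=
  Finset.sum_le_sum fun i _ => Nat.mul_le_mul_left _ (h i)

lemma ofDigits_lt {p : ℕ} (hp : 0 < p) {f : ℕ} {t n : Fin f → ℕ} (h : ∀ i, t i ≤ n i) (i : Fin f)
    (hi : t i < n i) : ofDigits p t < ofDigits p n :=
  Finset.sum_lt_sum (fun i _ => Nat.mul_le_mul_left _ (h i))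
    ⟨i, Finset.mem_univ _, Nat.mul_lt_mul_of_pos_left hi (pow_pos hp _)⟩

lemma ofDigits_add (p : ℕ) {f : ℕ} (t n : Fin f → ℕ) :
    (ofDigits p fun i => t i + n i) = ofDigits p t + ofDigits p n := by
  simp [ofDigits, mul_add, Finset.sum_add_distrib]

lemma prod_pow_pow_eq {F : Type*} [CommMonoid F] (a : F) (p : ℕ) {f : ℕ} (t : Fin f → ℕ) :
    ∏ i : Fin f, (a ^ p ^ (i : ℕ)) ^ t i = a ^ ofDigits p t := by
  simp only [← pow_mul, ofDigits, Finset.prod_pow_eq_pow_sum]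

/-- A polynomial function of degree less than `q` determines its coefficients. -/
lemma eq_zero_of_sum_ofDigits {k F : Type*} [Field k] [Fintype k] [Field F] [Algebra k F]
    {V : Type*} [AddCommGroup V] [Module F V] {p f : ℕ} (hp : 0 < p)
    (hk : Fintype.card k = p ^ f) (z : (Fin f → ℕ) → V)
    (h : ∀ l : k, ∑ t ∈ Fintype.piFinset fun _ : Fin f => Finset.range p,
      algebraMap k F l ^ ofDigits p t • z t = 0)
    (t₀ : Fin f → ℕ) (ht₀ : ∀ i, t₀ i < p) : z t₀ = 0 := by
  have hle : ∀ t : Fin f → ℕ, (∀ i, t i < p) → ofDigits p t ≤ Fintype.card k - 1 := fun t ht => by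
    rw [hk, ← ofDigits_sub_one hp]
    exact ofDigits_mono p fun i => Nat.le_sub_one_of_lt (ht i)
  have hinj : ∀ t : Fin f → ℕ, (∀ i, t i < p) → ofDigits p t = ofDigits p t₀ → t = t₀ :=
    fun t ht h => ofDigits_injective (fun i => by have := ht i; omega)
      (fun i => by have := ht₀ i; omega) h
  have hmem : t₀ ∈ Fintype.piFinset fun _ : Fin f => Finset.range p := by simpa using ht₀
  -- The exponents 0 and q - 1 give the same function on kˣ, so the constant coefficient is read off
  -- at l = 0.
  by_cases h0 : ofDigits p t₀ = 0
  · have h1 := h 0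
    rw [Finset.sum_eq_single t₀ _ (fun h => absurd hmem h)] at h1
    · simpa [h0] using h1
    · intro t ht hne
      rw [map_zero, zero_pow, zero_smul]
      exact fun h' => hne (hinj t (by simpa using ht) (h'.trans h0.symm))
  · have h1 := sum_pow_smul_eq_neg (k := k) (F := F)
      (Fintype.piFinset fun _ : Fin f => Finset.range p) (ofDigits p) z hmem (hle t₀ ht₀)
      fun t ht hne _ => by
        have ht' : ∀ i, t i < p := by simpa using ht
        exact ⟨fun h' => hne (hinj t ht' h'), by have := hle t ht'; omega⟩
    simp only [h, smul_zero, Finset.sum_const_zero] at h1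
    exact neg_eq_zero.1 h1.symm

end Digits

/-! ### Common fixed vectors of commuting unipotent operators. -/

section FixedVector

/-- Commuting operators `u` with `(u - 1)^N = 0` have a common fixed vector in every nonzero stable
subspace. -/
lemma exists_fixed_vector {F V S : Type*} [Field F] [AddCommGroup V] [Module F V] [Finite S]
    (u : S → Module.End F V) (hu : ∀ s t, Commute (u s) (u t)) (N : ℕ)
    (hN : ∀ s, (u s - 1) ^ N = 0) (M : Submodule F V) (hM : ∀ s, ∀ x ∈ M, u s x ∈ M)
    (h0 : M ≠ ⊥) : ∃ x ∈ M, x ≠ 0 ∧ ∀ s, u s x = x := by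
  classical
  have := Fintype.ofFinite S
  suffices h : ∀ T : Finset S, ∃ x ∈ M, x ≠ 0 ∧ ∀ s ∈ T, u s x = x by
    obtain ⟨x, hx, hx0, h⟩ := h Finset.univ
    exact ⟨x, hx, hx0, fun s => h s (Finset.mem_univ s)⟩
  intro T
  induction T using Finset.induction_on with
  | empty =>
    obtain ⟨x, hx, hx0⟩ := (Submodule.ne_bot_iff M).1 h0
    exact ⟨x, hx, hx0, by simp⟩
  | insert s T hs ih =>
    obtain ⟨x, hx, hx0, hxT⟩ := ih
    -- The last nonzero vector (u_s - 1)^n x is fixed by u_s, and by commutativity it remains fixed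
    -- by the earlier operators.
    have hex : ∃ n, ((u s - 1 : Module.End F V) ^ n) x = 0 := ⟨N, by rw [hN]; rfl⟩
    obtain ⟨n, hn⟩ : ∃ n, Nat.find hex = n + 1 := by
      refine Nat.exists_eq_succ_of_ne_zero fun h => hx0 ?_
      have := Nat.find_spec hex
      rw [h] at this
      simpa using this
    have hmem : ∀ n, ((u s - 1 : Module.End F V) ^ n) x ∈ M := fun n => by
      induction n with
      | zero => simpa using hx
      | succ n ih =>
        rw [pow_succ', Module.End.mul_apply, LinearMap.sub_apply]
        exact M.sub_mem (hM s _ ih) ih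
    refine ⟨((u s - 1 : Module.End F V) ^ n) x, hmem n, Nat.find_min hex (by omega), fun t ht => ?_⟩
    rcases Finset.mem_insert.1 ht with rfl | ht
    · have := Nat.find_spec hex
      rw [hn, pow_succ', Module.End.mul_apply, LinearMap.sub_apply] at this
      exact sub_eq_zero.1 this
    · have hc : Commute (u t) ((u s - 1 : Module.End F V) ^ n) :=
        ((hu t s).sub_right (Commute.one_right _)).pow_right n
      have := LinearMap.congr_fun hc.eq x
      rw [Module.End.mul_apply, Module.End.mul_apply, hxT t ht] at this
      exact this

end FixedVector

/-! ### Unipotent invariants are determined by their coordinates without y₁. -/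

section Invariants

variable {F : Type*} [Field F]

/-- Packs all coordinates (a, t) into one polynomial in μ. The companion for the left factor only
involves coordinates with b = 0. -/
lemma tcoord_comp_map_right {m n N : ℕ} (hN : n < N) (a : ℕ) (μ : F) :
    tcoord F m n a 0 ∘ₗ TensorProduct.map LinearMap.id (symAct n (uni μ))
      = ∑ t ∈ Finset.range N, μ ^ t • tcoord F m n a t := by
  refine TensorProduct.ext' fun v w => ?_
  rw [LinearMap.comp_apply, TensorProduct.map_tmul, tcoord_tmul, symAct_uni n μ hN,
    LinearMap.sum_apply, LinearMap.sum_apply, map_sum, Finset.mul_sum]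
  refine Finset.sum_congr rfl fun t _ => ?_
  rw [LinearMap.smul_apply, LinearMap.smul_apply, map_smul, coord_divPow, tcoord_tmul]
  simp
  ring

lemma tcoord_comp_map_left {m n N : ℕ} (hN : m < N) (a : ℕ) (μ : F) :
    tcoord F m n a 0 ∘ₗ TensorProduct.map (symAct m (uni (-μ))) LinearMap.id
      = ∑ t ∈ Finset.range N, μ ^ t • (((-1) ^ t * ((a + t).choose t : F)) •
        tcoord F m n (a + t) 0) := by
  refine TensorProduct.ext' fun v w => ?_
  rw [LinearMap.comp_apply, TensorProduct.map_tmul, tcoord_tmul, symAct_uni m _ hN,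
    LinearMap.sum_apply, LinearMap.sum_apply, map_sum, Finset.sum_mul]
  refine Finset.sum_congr rfl fun t _ => ?_
  rw [LinearMap.smul_apply, LinearMap.smul_apply, LinearMap.smul_apply, map_smul, coord_divPow,
    tcoord_tmul, LinearMap.id_apply, neg_pow]
  simp only [smul_eq_mul]
  ring

lemma tcoord_comp_casimir {m n : ℕ} (hn : (n : F) = -1) (a : ℕ) :
    tcoord F m n a 0 ∘ₗ casimir F m n = (-(a : F)) • tcoord F m n a 0
      + (if a = 0 then 0 else -((m : F) - a + 1)) • tcoord F m n (a - 1) 1 := by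
  refine LinearMap.ext fun x => ?_
  rw [LinearMap.comp_apply, tcoord_casimir, hn]
  simp only [LinearMap.add_apply, LinearMap.smul_apply, smul_eq_mul]
  split_ifs <;> simp <;> ring

lemma tcoord_comp_tensorAct_tor (m n a b : ℕ) (t : F) :
    tcoord F m n a b ∘ₗ tensorAct m n (tor t) = t ^ (a + b) • tcoord F m n a b :=
  LinearMap.ext fun x => tcoord_tensorAct_tor m n a b t x

/-- On an invariant tensor, u(μ) acting on the y-variables therefore agrees with u(-μ) acting on the
x-variables, which expresses coordinates with b > 0 through those with b = 0. -/
lemma tensorAct_uni_eq (m n : ℕ) (μ : F) :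
    TensorProduct.map (symAct m (uni (-μ))) LinearMap.id ∘ₗ tensorAct m n (uni μ)
      = TensorProduct.map LinearMap.id (symAct n (uni μ)) := by
  rw [tensorAct, ← TensorProduct.map_comp, LinearMap.id_comp]
  congr 1
  change symAct m (uni (-μ)) * symAct m (uni μ) = _
  rw [← symAct_mul, uni_mul, neg_add_cancel, uni_zero, symAct_one]
  rfl

variable {p f : ℕ} {m : Fin f → ℕ} {k : Type*} [Field k] [Fintype k] [Algebra k F]

/-- The coordinates on a tensor product of the spaces `V_{m_i} ⊗ V_{p-1}`. -/
def mcoord (F : Type*) [Field F] (p : ℕ) {f : ℕ} (m a b : Fin f → ℕ) :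
    Module.Dual F (⨂[F] i, (Sym F (m i) ⊗[F] Sym F (p - 1))) :=
  tprodDual fun i => tcoord F (m i) (p - 1) (a i) (b i)

/-- The action of a family of matrices. -/
def multiAct (p : ℕ) {f : ℕ} (m : Fin f → ℕ) (g : Fin f → Matrix (Fin 2) (Fin 2) F) :
    Module.End F (⨂[F] i, (Sym F (m i) ⊗[F] Sym F (p - 1))) :=
  PiTensorProduct.map fun i => tensorAct (m i) (p - 1) (g i)

lemma mcoord_eq_zero {a b : Fin f → ℕ} {i : Fin f} (h : m i < a i ∨ p - 1 < b i)
    (x : ⨂[F] i, (Sym F (m i) ⊗[F] Sym F (p - 1))) : mcoord F p m a b x = 0 := by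
  have h0 : tcoord F (m i) (p - 1) (a i) (b i) = 0 := LinearMap.ext fun x => tcoord_eq_zero h x
  have : mcoord F p m a b = 0 := by
    rw [mcoord, tprodDual]
    rw [(PiTensorProduct.tprod F (s := fun i =>
      Module.Dual F (Sym F (m i) ⊗[F] Sym F (p - 1)))).map_coord_zero i h0, map_zero]
  rw [this, LinearMap.zero_apply]

lemma mcoord_tor (a b : Fin f → ℕ) (t : F) (x : ⨂[F] i, (Sym F (m i) ⊗[F] Sym F (p - 1))) :
    mcoord F p m a b (multiAct p m (fun i => tor (t ^ p ^ (i : ℕ))) x)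
      = t ^ ofDigits p (fun i => a i + b i) * mcoord F p m a b x := by
  rw [mcoord, multiAct, tprodDual_map]
  simp only [tcoord_comp_tensorAct_tor]
  rw [tprodDual_smul, prod_pow_pow_eq]
  rfl

lemma eq_zero_of_mcoord {x : ⨂[F] i, (Sym F (m i) ⊗[F] Sym F (p - 1))}
    (h : ∀ a b : Fin f → ℕ, (∀ i, b i < p) → mcoord F p m a b x = 0) (hp : 0 < p) : x = 0 := by
  refine eq_zero_of_tprodDual (κ := ℕ × ℕ)
    (s := fun i => Finset.range (m i + 1) ×ˢ Finset.range (p - 1 + 1))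
    (e := fun i c => tcoord F (m i) (p - 1) c.1 c.2)
    (v := fun i c => mon F (m i) c.1 ⊗ₜ mon F (p - 1) c.2) (fun i u => ?_) fun c hc => ?_
  · rw [Finset.sum_product]
    exact eq_sum_tcoord u
  · refine h (fun i => (c i).1) (fun i => (c i).2) fun i => ?_
    have := Fintype.mem_piFinset.1 hc i
    simp only [Finset.mem_product, Finset.mem_range] at this
    omega

/-- The coordinates of a unipotent invariant are determined by those with `b = 0`. -/
lemma mcoord_of_invariant (hp : 0 < p) (hk : Fintype.card k = p ^ f) (hm : ∀ i, m i < p)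
    {x : ⨂[F] i, (Sym F (m i) ⊗[F] Sym F (p - 1))}
    (hx : ∀ l : k, multiAct p m (fun i => uni (algebraMap k F l ^ p ^ (i : ℕ))) x = x)
    (a b : Fin f → ℕ) (hb : ∀ i, b i < p) :
    mcoord F p m a b x = (∏ i, (-1) ^ b i * ((a i + b i).choose (b i) : F)) *
      mcoord F p m (fun i => a i + b i) 0 x := by
  rw [← sub_eq_zero]
  -- Both expressions are polynomials in l with exponents ∑ p^i t_i, t_i < p, so equality of the
  -- functions on k gives equality of coefficients.
  refine eq_zero_of_sum_ofDigits (k := k) (F := F) hp hk (fun b => mcoord F p m a b x -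
    (∏ i, (-1) ^ b i * ((a i + b i).choose (b i) : F)) *
      mcoord F p m (fun i => a i + b i) 0 x) (fun l => ?_) b hb
  set μ : Fin f → F := fun i => algebraMap k F l ^ p ^ (i : ℕ) with hμ
  have h1 : tprodDual (fun i => tcoord F (m i) (p - 1) (a i) 0)
      (PiTensorProduct.map (fun i => TensorProduct.map LinearMap.id (symAct (p - 1) (uni (μ i)))) x)
      = ∑ t ∈ Fintype.piFinset fun _ : Fin f => Finset.range p,
        algebraMap k F l ^ ofDigits p t • mcoord F p m a t x := by
    rw [tprodDual_map]
    simp only [tcoord_comp_map_right (show p - 1 < p by omega)]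
    rw [tprodDual_sum_smul, LinearMap.sum_apply]
    refine Finset.sum_congr rfl fun t _ => ?_
    rw [LinearMap.smul_apply, prod_pow_pow_eq]
    rfl
  have h2 : tprodDual (fun i => tcoord F (m i) (p - 1) (a i) 0)
      (PiTensorProduct.map (fun i => TensorProduct.map (symAct (m i) (uni (-(μ i))))
        LinearMap.id) x)
      = ∑ t ∈ Fintype.piFinset fun _ : Fin f => Finset.range p, algebraMap k F l ^ ofDigits p t •
        ((∏ i, (-1) ^ t i * ((a i + t i).choose (t i) : F)) *
          mcoord F p m (fun i => a i + t i) 0 x) := by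
    rw [tprodDual_map]
    simp only [tcoord_comp_map_left (hm _)]
    rw [tprodDual_sum_smul, LinearMap.sum_apply]
    refine Finset.sum_congr rfl fun t _ => ?_
    rw [LinearMap.smul_apply, prod_pow_pow_eq, tprodDual_smul]
    rfl
  have h3 : PiTensorProduct.map (fun i => TensorProduct.map LinearMap.id
      (symAct (p - 1) (uni (μ i)))) x = PiTensorProduct.map (fun i => TensorProduct.map
        (symAct (m i) (uni (-(μ i)))) LinearMap.id) x := by
    conv_rhs => rw [← hx l]
    rw [multiAct, ← LinearMap.comp_apply, ← PiTensorProduct.map_comp]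
    simp only [tensorAct_uni_eq, hμ]
  rw [h3, h2] at h1
  simp only [smul_sub, Finset.sum_sub_distrib]
  rw [← h1, sub_self]

lemma eq_zero_of_invariant (hp : 0 < p) (hk : Fintype.card k = p ^ f) (hm : ∀ i, m i < p)
    {x : ⨂[F] i, (Sym F (m i) ⊗[F] Sym F (p - 1))}
    (hx : ∀ l : k, multiAct p m (fun i => uni (algebraMap k F l ^ p ^ (i : ℕ))) x = x)
    (h0 : ∀ a, mcoord F p m a 0 x = 0) : x = 0 :=
  eq_zero_of_mcoord (fun a b hb => by rw [mcoord_of_invariant hp hk hm hx a b hb, h0, mul_zero]) hp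

lemma multiAct_atIdx_casimir (μ : Fin f → F) (i : Fin f)
    (x : ⨂[F] i, (Sym F (m i) ⊗[F] Sym F (p - 1))) :
    atIdx i (casimir F (m i) (p - 1)) (multiAct p m (fun i => uni (μ i)) x)
      = multiAct p m (fun i => uni (μ i)) (atIdx i (casimir F (m i) (p - 1)) x) := by
  refine atIdx_map_comm i (LinearMap.ext fun y => ?_) x
  have := casimir_tensorAct_toMat (m i) (p - 1) (uniGL (μ i)) y
  rwa [toMat_uniGL] at this

/-- At (a, 0) the operator K involves only (a, 0) and (a - 1, 1), and invariance makes the latter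
coordinate -a times the former. As p - 1 = -1 in F, the eigenvalue is -a + a(m - a + 1). -/
lemma mcoord_casimir_of_invariant [Fact p.Prime] [CharP F p] (hk : Fintype.card k = p ^ f)
    (hm : ∀ i, m i < p) {x : ⨂[F] i, (Sym F (m i) ⊗[F] Sym F (p - 1))}
    (hx : ∀ l : k, multiAct p m (fun i => uni (algebraMap k F l ^ p ^ (i : ℕ))) x = x)
    (a : Fin f → ℕ) (i : Fin f) :
    mcoord F p m a 0 (atIdx i (casimir F (m i) (p - 1)) x)
      = (a i * ((m i : F) - a i)) * mcoord F p m a 0 x := by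
  have hp := (Fact.out : p.Prime).two_le
  have hn : ((p - 1 : ℕ) : F) = -1 := by
    rw [Nat.cast_sub (by omega), CharP.cast_eq_zero F p]
    simp
  rw [mcoord, tprodDual_atIdx]
  simp only [Pi.zero_apply]
  rw [tcoord_comp_casimir hn, tprodDual_update_add_smul, LinearMap.add_apply, LinearMap.smul_apply,
    LinearMap.smul_apply, Function.update_eq_self_iff.2 rfl]
  split_ifs with h
  · rw [h]; simp
  · have h1 : Function.update (fun j => tcoord F (m j) (p - 1) (a j) 0) i
        (tcoord F (m i) (p - 1) (a i - 1) 1) = fun j => tcoord F (m j) (p - 1)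
          (Function.update a i (a i - 1) j) (Function.update (0 : Fin f → ℕ) i 1 j) := by
      ext1 j
      by_cases hj : j = i
      · subst hj; simp
      · simp [hj]
    have h2 := mcoord_of_invariant (by omega) hk hm hx (Function.update a i (a i - 1))
      (Function.update (0 : Fin f → ℕ) i 1) (fun j => by
        by_cases hj : j = i
        · subst hj; simp; omega
        · simp [hj]; omega)
    rw [mcoord, ← h1] at h2
    rw [h2, Finset.prod_eq_single i (fun j _ hj => by simp [hj]) (by simp)]
    have h3 : (fun j => Function.update a i (a i - 1) j + Function.update (0 : Fin f → ℕ) i 1 j)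
        = a := by
      ext j
      by_cases hj : j = i
      · subst hj; simp; omega
      · simp [hj]
    rw [h3]
    simp only [Function.update_self, Nat.choose_one_right, Nat.sub_add_cancel (Nat.pos_of_ne_zero h),
      mcoord, smul_eq_mul, Pi.zero_apply]
    ring

/-- Unipotent invariants killed by the square of a Casimir operator. -/
lemma mcoord_eq_zero_of_invariant [Fact p.Prime] [CharP F p] (hk : Fintype.card k = p ^ f)
    (hm : ∀ i, m i < p) {x : ⨂[F] i, (Sym F (m i) ⊗[F] Sym F (p - 1))}
    (hx : ∀ l : k, multiAct p m (fun i => uni (algebraMap k F l ^ p ^ (i : ℕ))) x = x)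
    {i : Fin f} (hK : atIdx i (casimir F (m i) (p - 1)) (atIdx i (casimir F (m i) (p - 1)) x) = 0)
    {a : Fin f → ℕ} (h0 : a i ≠ 0) (h1 : a i ≠ m i) : mcoord F p m a 0 x = 0 := by
  by_cases ha : m i < a i
  · exact mcoord_eq_zero (Or.inl ha) x
  have h2 := mcoord_casimir_of_invariant hk hm (x := atIdx i (casimir F (m i) (p - 1)) x)
    (fun l => by rw [← multiAct_atIdx_casimir, hx]) a i
  rw [hK, map_zero, mcoord_casimir_of_invariant hk hm hx] at h2
  have h3 : ((a i : ℕ) : F) ≠ 0 := fun h =>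
    absurd (Nat.le_of_dvd (by omega) ((CharP.cast_eq_zero_iff F p _).1 h))
      (by have := hm i; omega)
  have h4 : (m i : F) - a i ≠ 0 := fun h => by
    rw [← Nat.cast_sub (by omega)] at h
    exact absurd (Nat.le_of_dvd (by omega) ((CharP.cast_eq_zero_iff F p _).1 h))
      (by have := hm i; omega)
  simpa [h3, h4] using h2.symm

end Invariants

/-! ### A vector contained in every nonzero subrepresentation of ⨂ R_{r_i}^{Fr^i}. -/

section Socle

variable (k F : Type*) [Field k] [Field F] [Algebra k F] (p : ℕ) [Fact p.Prime] [CharP k p]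
  {f : ℕ} (r : Fin f → ℕ)

/-- The representation `⨂ R_{r_i}^{Fr^i}`. -/
def multiRep : Representation F (GL (Fin 2) k) (⨂[F] i, RSpace k F p (r i)) :=
  piRep fun i => (RRep k F p (r i)).comp (Weight.frob k p i)

/-- The inclusion `⨂ R_{r_i} ⊆ ⨂ V_{p-1-r_i} ⊗ V_{p-1}`. -/
def multiIncl : (⨂[F] i, RSpace k F p (r i)) →ₗ[F]
    ⨂[F] i, (Sym F (p - 1 - r i) ⊗[F] Sym F (p - 1)) :=
  PiTensorProduct.map fun i => RSpace.incl k F p (r i)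

omit [Fact (Nat.Prime p)] [CharP k p] in
lemma multiIncl_injective : Function.Injective (multiIncl k F p r) :=
  map_injective fun i => RSpace.incl_injective k F p (r i)

variable {k} in
lemma toMat_frob_uniGL (i : ℕ) (l : k) :
    toMat F (Weight.frob k p i (uniGL l)) = uni (algebraMap k F l ^ p ^ i) := by
  have hp := (Fact.out : p.Prime).ne_zero
  change ((uni l).map (iterateFrobenius k p i)).map (algebraMap k F) = _
  ext a b
  fin_cases a <;> fin_cases b <;> simp [uni, iterateFrobenius_def, hp]

variable {k} in
lemma toMat_frob_torGL (i : ℕ) (t : kˣ) :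
    toMat F (Weight.frob k p i (torGL t)) = tor (algebraMap k F t ^ p ^ i) := by
  have hp := (Fact.out : p.Prime).ne_zero
  change ((tor (t : k)).map (iterateFrobenius k p i)).map (algebraMap k F) = _
  ext a b
  fin_cases a <;> fin_cases b <;> simp [tor, iterateFrobenius_def, hp]

lemma toMat_frob_weylGL (i : ℕ) : toMat F (Weight.frob k p i (weylGL k)) = weyl F := by
  change ((weyl k).map (iterateFrobenius k p i)).map (algebraMap k F) = _
  ext a b
  fin_cases a <;> fin_cases b <;> simp [weyl]

variable {k F p r}

lemma multiRep_tprod (g : GL (Fin 2) k) (x : ∀ i, RSpace k F p (r i)) :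
    multiRep k F p r g (PiTensorProduct.tprod F x)
      = PiTensorProduct.tprod F fun i => RRep k F p (r i) (Weight.frob k p i g) (x i) :=
  PiTensorProduct.map_tprod _ _

omit [Fact (Nat.Prime p)] [CharP k p] in
lemma multiIncl_tprod (x : ∀ i, RSpace k F p (r i)) :
    multiIncl k F p r (PiTensorProduct.tprod F x)
      = PiTensorProduct.tprod F fun i => RSpace.incl k F p (r i) (x i) :=
  PiTensorProduct.map_tprod _ _

lemma multiIncl_multiRep (g : GL (Fin 2) k) (x : ⨂[F] i, RSpace k F p (r i)) :
    multiIncl k F p r (multiRep k F p r g x)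
      = multiAct p (fun i => p - 1 - r i) (fun i => toMat F (Weight.frob k p i g))
        (multiIncl k F p r x) := by
  suffices h : multiIncl k F p r ∘ₗ multiRep k F p r g
      = multiAct p (fun i => p - 1 - r i) (fun i => toMat F (Weight.frob k p i g)) ∘ₗ
        multiIncl k F p r from LinearMap.congr_fun h x
  change PiTensorProduct.map _ ∘ₗ PiTensorProduct.map _ = PiTensorProduct.map _ ∘ₗ
    PiTensorProduct.map _
  rw [← PiTensorProduct.map_comp, ← PiTensorProduct.map_comp]
  rfl

lemma multiIncl_uniGL (l : k) (x : ⨂[F] i, RSpace k F p (r i)) :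
    multiIncl k F p r (multiRep k F p r (uniGL l) x)
      = multiAct p (fun i => p - 1 - r i) (fun i => uni (algebraMap k F l ^ p ^ (i : ℕ)))
        (multiIncl k F p r x) := by
  simp only [multiIncl_multiRep, toMat_frob_uniGL]

lemma multiIncl_torGL (t : kˣ) (x : ⨂[F] i, RSpace k F p (r i)) :
    multiIncl k F p r (multiRep k F p r (torGL t) x)
      = multiAct p (fun i => p - 1 - r i) (fun i => tor (algebraMap k F t ^ p ^ (i : ℕ)))
        (multiIncl k F p r x) := by
  simp only [multiIncl_multiRep, toMat_frob_torGL]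

omit [Fact (Nat.Prime p)] [CharP k p] in
lemma multiIncl_atIdx (i : Fin f) (x : ⨂[F] i, RSpace k F p (r i)) :
    multiIncl k F p r (atIdx i (casimirR k F p (r i)) x)
      = atIdx i (casimir F (p - 1 - r i) (p - 1)) (multiIncl k F p r x) :=
  (atIdx_map_comm i (LinearMap.ext fun y => (RSpace.incl_casimirR k F p (r i) y).symm) x).symm

lemma atIdx_multiRep (i : Fin f) (g : GL (Fin 2) k) (x : ⨂[F] i, RSpace k F p (r i)) :
    atIdx i (casimirR k F p (r i)) (multiRep k F p r g x)
      = multiRep k F p r g (atIdx i (casimirR k F p (r i)) x) := by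
  have h : casimirR k F p (r i) ∘ₗ RRep k F p (r i) (Weight.frob k p i g)
      = RRep k F p (r i) (Weight.frob k p i g) ∘ₗ casimirR k F p (r i) :=
    LinearMap.ext fun y => casimirR_RRep k F p (r i) _ y
  exact atIdx_map_comm (φ := fun j => RRep k F p (r j) (Weight.frob k p j g)) i h x

lemma uniGL_mul (a b : k) : uniGL a * uniGL b = uniGL (a + b) := by
  ext1
  exact uni_mul a b

lemma uniGL_zero : uniGL (0 : k) = 1 := by
  ext1
  exact uni_zero

lemma uniGL_mul_torGL (a : k) (t : kˣ) : uniGL a * torGL t = torGL t * uniGL (a * t) := by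
  have : uni a * tor (t : k) = tor (t : k) * uni (a * t) := by simp [uni, tor]
  ext1
  exact this

lemma uniGL_pow (a : k) (n : ℕ) : uniGL a ^ n = uniGL (n * a) := by
  induction n with
  | zero => simp [uniGL_zero]
  | succ n ih =>
    rw [pow_succ, ih, uniGL_mul]
    congr 1
    push_cast
    ring

omit [Algebra k F] in
-- In characteristic p, (u - 1)^p = u^p - 1, and u(a)^p = u(pa) = 1.
lemma sub_one_pow_eq_zero {V : Type*} [AddCommGroup V] [Module F V] [CharP F p]
    (ρ : Representation F (GL (Fin 2) k) V) (a : k) : (ρ (uniGL a) - 1) ^ p = 0 := by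
  have h1 : (Polynomial.X - 1 : Polynomial F) ^ p = Polynomial.X ^ p - 1 := by
    rw [sub_pow_char, one_pow]
  have h2 := congrArg (Polynomial.aeval (ρ (uniGL a))) h1
  simp only [map_pow, map_sub, Polynomial.aeval_X, map_one] at h2
  rw [h2, ← map_pow, uniGL_pow, CharP.cast_eq_zero k p, zero_mul, uniGL_zero, map_one, sub_self]

lemma exists_uniGL_fixed_vector [Finite k] [CharP F p]
    {N : Submodule F (⨂[F] i, RSpace k F p (r i))}
    (hN : ∀ g, ∀ x ∈ N, multiRep k F p r g x ∈ N) (h0 : N ≠ ⊥) :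
    ∃ x ∈ N, x ≠ 0 ∧ ∀ l : k, multiRep k F p r (uniGL l) x = x :=
  exists_fixed_vector (fun l : k => multiRep k F p r (uniGL l)) (fun a b => by
    change _ * _ = _ * _
    rw [← map_mul, ← map_mul, uniGL_mul, uniGL_mul, add_comm]) p
    (fun a => sub_one_pow_eq_zero _ a) N (fun l => hN _) h0

omit [Field k] [CharP k p] in
-- Some digit is below p - 1 because some r_i ≠ 0. The strict inequality keeps torus weights apart
-- modulo q - 1.
lemma ofDigits_lt_card_sub_one {a : Fin f → ℕ} [Fintype k] (hk : Fintype.card k = p ^ f)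
    (hex : ∃ i, r i ≠ 0) (hr : ∀ i, r i + 2 ≤ p) (ha : ∀ i, a i ≤ p - 1 - r i) :
    ofDigits p a < Fintype.card k - 1 := by
  obtain ⟨i, hi⟩ := hex
  have hp := (Fact.out : p.Prime).pos
  rw [hk, ← ofDigits_sub_one hp]
  refine ofDigits_lt hp (fun i => ?_) i ?_
  · have := ha i; omega
  · have := ha i; have := hr i; omega

variable [CharP F p] [Fintype k]

/-- The unipotent invariant of `R_r` with leading coordinate `a`. -/
def hwVector (D : ∀ i, CayleyData F (p - 1 - r i) (p - 1) (r i)) (a : Fin f → ℕ) (i : Fin f) :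
    Sym F (p - 1 - r i) ⊗[F] Sym F (p - 1) :=
  if a i = 0 then mon F (p - 1 - r i) 0 ⊗ₜ mon F (p - 1) 0 else (D i).iota (mon F (r i) 0)

omit [Fact (Nat.Prime p)] [CharP F p] in
lemma tensorAct_uni_hwVector (D : ∀ i, CayleyData F (p - 1 - r i) (p - 1) (r i)) (a : Fin f → ℕ)
    (i : Fin f) (μ : F) :
    tensorAct (p - 1 - r i) (p - 1) (uni μ) (hwVector D a i) = hwVector D a i := by
  rw [hwVector]
  split_ifs
  · exact tensorAct_uni_mon_zero _ _ _
  · have : symAct (r i) (uni μ) (mon F (r i) 0) = mon F (r i) 0 := by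
      apply Sym.val_injective
      simp [val_symAct, val_mon, subst_X, uni]
    rw [(D i).act_iota, det_uni, one_pow, one_smul, this]

omit [Fact (Nat.Prime p)] [CharP F p] in
lemma tcoord_hwVector (hr : ∀ i, r i + 2 ≤ p)
    (D : ∀ i, CayleyData F (p - 1 - r i) (p - 1) (r i)) {a : Fin f → ℕ} {i : Fin f}
    (ha : a i = 0 ∨ a i = p - 1 - r i) (b : ℕ) :
    tcoord F (p - 1 - r i) (p - 1) b 0 (hwVector D a i) = if b = a i then (-1) ^ a i else 0 := by
  have := hr i
  rw [hwVector]
  split_ifs with h0 h1 h1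
  · rw [tcoord_mon_tmul_mon, if_pos (by simp [h1, h0]), h0, pow_zero]
  · rw [tcoord_mon_tmul_mon, if_neg]
    rintro ⟨h, -⟩
    rw [Prod.mk.injEq] at h
    omega
  · rw [(D i).tcoord_iota, if_pos (by omega), h1, ha.resolve_left h0, Nat.choose_self, Nat.cast_one,
      mul_one]
  · rw [(D i).tcoord_iota, if_neg (by omega)]

/-- A nonzero subrepresentation of `⨂ R_{r_i}^{Fr^i}` contains one of the standard unipotent
invariants. -/
lemma exists_hwVector_mem (hk : Fintype.card k = p ^ f) (hex : ∃ i, r i ≠ 0)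
    (hr : ∀ i, r i + 2 ≤ p) (D : ∀ i, CayleyData F (p - 1 - r i) (p - 1) (r i))
    {N : Submodule F (⨂[F] i, RSpace k F p (r i))}
    (hN : ∀ g, ∀ x ∈ N, multiRep k F p r g x ∈ N) (h0 : N ≠ ⊥) :
    ∃ a : Fin f → ℕ, (∀ i, a i = 0 ∨ a i = p - 1 - r i) ∧
      ∃ x ∈ N, multiIncl k F p r x = PiTensorProduct.tprod F (hwVector D a) := by
  classical
  have hp := (Fact.out : p.Prime).pos
  have hm : ∀ i, p - 1 - r i < p := fun i => by omega
  obtain ⟨x, hxN, hx0, hx⟩ := exists_uniGL_fixed_vector hN h0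
  set y := multiIncl k F p r x with hy
  have hyu : ∀ l : k, multiAct p (fun i => p - 1 - r i)
      (fun i => uni (algebraMap k F l ^ p ^ (i : ℕ))) y = y := fun l => by
    rw [hy, ← multiIncl_uniGL, hx]
  have hyK : ∀ i, atIdx i (casimir F (p - 1 - r i) (p - 1))
      (atIdx i (casimir F (p - 1 - r i) (p - 1)) y) = 0 := fun i => by
    rw [hy, ← multiIncl_atIdx, ← multiIncl_atIdx, atIdx_atIdx,
      show casimirR k F p (r i) ∘ₗ casimirR k F p (r i) = 0 from
        LinearMap.ext fun z => (D i).casimirR_casimirR z, atIdx_zero, LinearMap.zero_apply, map_zero]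
  have hcoord : ∀ a : Fin f → ℕ, mcoord F p (fun i => p - 1 - r i) a 0 y ≠ 0 →
      ∀ i, a i = 0 ∨ a i = p - 1 - r i := fun a ha i => by
    by_contra! h
    exact ha (mcoord_eq_zero_of_invariant hk hm hyu (hyK i) h.1 h.2)
  obtain ⟨a, ha⟩ : ∃ a, mcoord F p (fun i => p - 1 - r i) a 0 y ≠ 0 := by
    by_contra! h
    exact hx0 (multiIncl_injective k F p r
      ((eq_zero_of_invariant hp hk hm hyu h).trans (map_zero _).symm))
  have hle : ∀ a : Fin f → ℕ, mcoord F p (fun i => p - 1 - r i) a 0 y ≠ 0 →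
      ofDigits p a < Fintype.card k - 1 := fun a ha =>
    ofDigits_lt_card_sub_one hk hex hr fun i => by have := hcoord a ha i; omega
  -- Projection to the torus weight of a. All leading exponents lie in [0, q - 1), so congruent ones
  -- are equal and have the same digits.
  set x' := ∑ t : kˣ, algebraMap k F t ^ (Fintype.card k - 1 - ofDigits p a) •
    multiRep k F p r (torGL t) x with hx'
  have hx'N : x' ∈ N := N.sum_mem fun t _ => N.smul_mem _ (hN _ _ hxN)
  have hx'u : ∀ l : k, multiRep k F p r (uniGL l) x' = x' := fun l => by
    rw [hx', map_sum]
    refine Finset.sum_congr rfl fun t _ => ?_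
    rw [map_smul, ← Module.End.mul_apply, ← map_mul, uniGL_mul_torGL, map_mul,
      Module.End.mul_apply, hx]
  have hx'c : ∀ b, mcoord F p (fun i => p - 1 - r i) b 0 (multiIncl k F p r x')
      = if b = a then -mcoord F p (fun i => p - 1 - r i) a 0 y else 0 := fun b => by
    have h1 : mcoord F p (fun i => p - 1 - r i) b 0 (multiIncl k F p r x')
        = (∑ t : kˣ, algebraMap k F t ^ (Fintype.card k - 1 - ofDigits p a + ofDigits p b)) *
          mcoord F p (fun i => p - 1 - r i) b 0 y := by
      rw [hx', map_sum, map_sum, Finset.sum_mul]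
      refine Finset.sum_congr rfl fun t _ => ?_
      rw [map_smul, map_smul, multiIncl_torGL, mcoord_tor, smul_eq_mul, pow_add, ← mul_assoc,
        ← hy]
      simp
    rw [h1, sum_units_algebraMap_pow]
    have hlea := hle a ha
    by_cases hba : b = a
    · subst hba
      rw [Nat.sub_add_cancel hlea.le, if_pos dvd_rfl, if_pos rfl, neg_one_mul]
    · rw [if_neg hba]
      by_cases hb : mcoord F p (fun i => p - 1 - r i) b 0 y = 0
      · rw [hb, mul_zero]
      · have hleb := hle b hb
        rw [if_neg, zero_mul]
        rintro ⟨c, hc⟩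
        have hc1 : c < 2 := by
          by_contra hc2
          have : (Fintype.card k - 1) * 2 ≤ (Fintype.card k - 1) * c :=
            Nat.mul_le_mul_left _ (by omega)
          omega
        have hab : ofDigits p b = ofDigits p a := by
          interval_cases c <;> omega
        refine hba (ofDigits_injective (fun i => ?_) (fun i => ?_) hab)
        · have := hcoord b hb i; omega
        · have := hcoord a ha i; omega
  have haN := hcoord a ha
  set v := PiTensorProduct.tprod F (hwVector D a) with hv
  have hvc : ∀ b, mcoord F p (fun i => p - 1 - r i) b 0 v
      = if b = a then (-1) ^ (∑ i, a i) else 0 := fun b => by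
    rw [hv, mcoord, tprodDual_tprod]
    simp only [Pi.zero_apply, tcoord_hwVector hr D (haN _)]
    split_ifs with h
    · simp [h, Finset.prod_pow_eq_pow_sum]
    · obtain ⟨i, hi⟩ := Function.ne_iff.1 h
      exact Finset.prod_eq_zero (Finset.mem_univ i) (if_neg hi)
  set c : F := -(mcoord F p (fun i => p - 1 - r i) a 0 y * (-1) ^ (∑ i, a i)) with hc
  have hc0 : c ≠ 0 := neg_ne_zero.2 (mul_ne_zero ha (pow_ne_zero _ (by simp)))
  -- Both vectors are unipotent invariants, so comparing the coordinates with b = 0 suffices.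
  have hfin : multiIncl k F p r x' - c • v = 0 := by
    refine eq_zero_of_invariant (k := k) hp hk hm (fun l => ?_) fun b => ?_
    · rw [map_sub, map_smul, ← multiIncl_uniGL, hx'u, hv, multiAct, PiTensorProduct.map_tprod]
      simp only [tensorAct_uni_hwVector]
    · rw [map_sub, map_smul, hx'c, hvc]
      split_ifs with h
      · rw [hc, smul_eq_mul, neg_mul, mul_assoc, ← pow_add, Even.neg_one_pow ⟨_, rfl⟩]
        ring
      · simp
  refine ⟨a, haN, c⁻¹ • x', N.smul_mem _ hx'N, ?_⟩
  rw [map_smul, sub_eq_zero.1 hfin, smul_smul, inv_mul_cancel₀ hc0, one_smul]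

/-- Every nonzero subrepresentation of `⨂ R_{r_i}^{Fr^i}` contains the highest weight vector of its
socle. -/
theorem tprod_iotaR_mem (hk : Fintype.card k = p ^ f) (hex : ∃ i, r i ≠ 0)
    (hr : ∀ i, r i + 2 ≤ p) (hq : ∀ i, p < Fintype.card k ∨ r i ≠ 0) (hqp : p ≤ Fintype.card k)
    (D : ∀ i, CayleyData F (p - 1 - r i) (p - 1) (r i))
    {N : Submodule F (⨂[F] i, RSpace k F p (r i))}
    (hN : ∀ g, ∀ x ∈ N, multiRep k F p r g x ∈ N) (h0 : N ≠ ⊥) :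
    PiTensorProduct.tprod F (fun i => (D i).iotaR k (mon F (r i) 0)) ∈ N := by
  classical
  have hp := (Fact.out : p.Prime).pos
  obtain ⟨a, ha, x, hxN, hx⟩ := exists_hwVector_mem hk hex hr D hN h0
  choose c hc hcP using fun i => (D i).exists_tdivPow_eq (k := k) (hr i) hqp (hq i)
  set P : ∀ i : Fin f, ℕ → Sym F (p - 1 - r i) ⊗[F] Sym F (p - 1) := fun i t =>
    if a i = 0 then tdivPow F (p - 1 - r i) (p - 1) t
      (mon F (p - 1 - r i) (p - 1 - r i) ⊗ₜ mon F (p - 1) (p - 1))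
    else (-1 : F) ^ (p - 1 - r i) • (D i).iota (divPow F (r i) t (mon F (r i) (r i))) with hP
  -- The Weyl element turns the factors into x₁^(p-1-r) y₁^(p-1) or ±ι(X₁^r). The divided powers of
  -- order p - 1 and r, respectively, then raise them to multiples of ι(X₀^r).
  set t₀ : Fin f → ℕ := fun i => if a i = 0 then p - 1 else r i with ht₀
  have ht₀p : ∀ i, t₀ i ≤ p - 1 := fun i => by
    have := hr i
    simp only [ht₀]
    split_ifs <;> omega
  have hwP : ∀ (i : Fin f) (μ : F), tensorAct (p - 1 - r i) (p - 1) (uni μ)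
      (tensorAct (p - 1 - r i) (p - 1) (weyl F) (hwVector D a i))
      = ∑ t ∈ Finset.range (2 * p), μ ^ t • P i t := fun i μ => by
    have := hr i
    simp only [hP, hwVector]
    split_ifs with h
    · rw [tensorAct_tmul, symAct_weyl_mon (Nat.zero_le _), symAct_weyl_mon (Nat.zero_le _),
        Nat.sub_zero, Nat.sub_zero, tensorAct_uni (N := 2 * p) (by omega)]
      simp
    · rw [(D i).act_iota, det_weyl, symAct_weyl_mon (Nat.zero_le _), Nat.sub_zero, map_smul,
        (D i).act_iota, det_uni, one_pow, one_smul, symAct_uni (N := 2 * p) (r i) _ (by omega),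
        LinearMap.sum_apply, map_sum, Finset.smul_sum]
      refine Finset.sum_congr rfl fun t _ => ?_
      rw [LinearMap.smul_apply, map_smul, smul_comm]
  have hPt₀ : ∀ i, ∃ d : F, d ≠ 0 ∧ P i (t₀ i) = d • (D i).iota (mon F (r i) 0) := fun i => by
    simp only [hP, ht₀]
    split_ifs with h
    · exact ⟨c i, hc i, hcP i⟩
    · refine ⟨(-1) ^ (p - 1 - r i), pow_ne_zero _ (by simp), ?_⟩
      rw [divPow_mon _ le_rfl]
      simp
  choose d hd hdP using hPt₀
  -- Nonzero terms exceed t₀ by at most p - 1 - r_i in each digit, hence by less than q - 1 in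
  -- total, so the term at t₀ can be extracted by a power sum.
  have hPne : ∀ t : Fin f → ℕ, PiTensorProduct.tprod F (fun i => P i (t i)) ≠ 0 →
      ∀ i, t i ≤ t₀ i + (p - 1 - r i) ∧ t i < t₀ i + p := fun t ht i => by
    have hPi : P i (t i) ≠ 0 := fun h => ht ((PiTensorProduct.tprod F).map_coord_zero i h)
    have := hr i
    simp only [ht₀]
    by_cases h : a i = 0
    · have : t i ≤ p - 1 - r i + (p - 1) := by
        by_contra h'
        refine hPi ?_
        simp only [hP]
        rw [if_pos h, tdivPow_eq_zero (by omega), LinearMap.zero_apply]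
      rw [if_pos h]
      omega
    · have : t i ≤ r i := by
        by_contra h'
        refine hPi ?_
        simp only [hP]
        rw [if_neg h, divPow_eq_zero (by omega), LinearMap.zero_apply, map_zero, smul_zero]
      rw [if_neg h]
      omega
  have hm : ofDigits p (fun i => p - 1 - r i) < Fintype.card k - 1 :=
    ofDigits_lt_card_sub_one hk hex hr fun i => le_rfl
  have key := sum_pow_smul_eq_neg (k := k) (F := F)
    (Fintype.piFinset fun _ : Fin f => Finset.range (2 * p)) (ofDigits p)
    (fun t => PiTensorProduct.tprod F fun i => P i (t i)) (t₀ := t₀)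
    (by
      rw [Fintype.mem_piFinset]
      intro i
      have := ht₀p i
      rw [Finset.mem_range]
      omega)
    (by
      rw [hk, ← ofDigits_sub_one hp]
      exact ofDigits_mono p ht₀p)
    (fun t _ hne ht => by
      have h1 := hPne t ht
      refine ⟨fun h => hne (ofDigits_injective (fun i => (h1 i).2) (fun i => ?_) h), ?_⟩
      · have := ht₀p i; omega
      · calc ofDigits p t ≤ ofDigits p fun i => t₀ i + (p - 1 - r i) :=
              ofDigits_mono p fun i => (h1 i).1
          _ = ofDigits p t₀ + ofDigits p fun i => p - 1 - r i := ofDigits_add p _ _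
          _ < _ := by omega)
  set z := ∑ l : k, algebraMap k F l ^ (Fintype.card k - 1 - ofDigits p t₀) •
    multiRep k F p r (uniGL l) (multiRep k F p r (weylGL k) x) with hz
  have hzN : z ∈ N := N.sum_mem fun l _ => N.smul_mem _ (hN _ _ (hN _ _ hxN))
  have hzJ : z = -((∏ i, d i) •
      PiTensorProduct.tprod F (fun i => (D i).iotaR k (mon F (r i) 0))) := by
    apply multiIncl_injective k F p r
    rw [map_neg, map_smul, multiIncl_tprod]
    simp only [CayleyData.incl_iotaR]
    rw [← MultilinearMap.map_smul_univ, ← show (fun i => P i (t₀ i)) =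
      fun i => d i • (D i).iota (mon F (r i) 0) from funext hdP, ← key, hz, map_sum]
    refine Finset.sum_congr rfl fun l _ => ?_
    rw [map_smul, multiIncl_uniGL, multiIncl_multiRep, hx]
    congr 1
    simp only [multiAct, PiTensorProduct.map_tprod, toMat_frob_weylGL, hwP]
    rw [tprod_sum_smul]
    simp only [prod_pow_pow_eq]
  have hd0 : ∏ i, d i ≠ 0 := Finset.prod_ne_zero_iff.2 fun i _ => hd i
  have := N.smul_mem (-(∏ i, d i)⁻¹) hzN
  rwa [hzJ, smul_neg, neg_smul, neg_neg, smul_smul, inv_mul_cancel₀ hd0, one_smul] at this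

end Socle

lemma subTensor_le {F : Type*} [Field F] {ι : Type*} {U : ι → Type*} [∀ i, AddCommGroup (U i)]
    [∀ i, Module F (U i)] {N : ∀ i, Submodule F (U i)} {B : Submodule F (⨂[F] i, U i)}
    (h : ∀ w, (∀ i, w i ∈ N i) → PiTensorProduct.tprod F w ∈ B) : subTensor N ≤ B := by
  rw [subTensor, LinearMap.range_eq_map, ← PiTensorProduct.span_tprod_eq_top, Submodule.map_span,
    Submodule.span_le]
  rintro _ ⟨_, ⟨w, rfl⟩, rfl⟩
  rw [PiTensorProduct.map_tprod]
  exact h _ fun i => (w i).2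

/-! ### Torus sums on ⨂ ker K and the lowest weight vector of the socle. -/

section SubspaceA

variable {k F : Type*} [Field k] [Field F] [Algebra k F] {p : ℕ}

instance (r : ℕ) : FiniteDimensional F (RSpace k F p r) :=
  FiniteDimensional.of_injective (RSpace.incl k F p r) (RSpace.incl_injective k F p r)

variable [Fact p.Prime] [CharP k p] {f : ℕ} {r : Fin f → ℕ}

lemma map_multiRep {φ : ∀ i, Module.End F (RSpace k F p (r i))}
    (hφ : ∀ i g x, φ i (RRep k F p (r i) g x) = RRep k F p (r i) g (φ i x)) (g : GL (Fin 2) k)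
    (x : ⨂[F] i, RSpace k F p (r i)) :
    PiTensorProduct.map φ (multiRep k F p r g x) = multiRep k F p r g (PiTensorProduct.map φ x) := by
  have h : PiTensorProduct.map φ ∘ₗ
      PiTensorProduct.map (fun i => RRep k F p (r i) (Weight.frob k p i g))
      = PiTensorProduct.map (fun i => RRep k F p (r i) (Weight.frob k p i g)) ∘ₗ
        PiTensorProduct.map φ := by
    rw [← PiTensorProduct.map_comp, ← PiTensorProduct.map_comp]
    exact congrArg _ (funext fun i => LinearMap.ext fun y => hφ i _ y)
  exact LinearMap.congr_fun h x

variable (D : ∀ i, CayleyData F (p - 1 - r i) (p - 1) (r i))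

variable (k) in
/-- The highest weight vector of the socle of `⨂ R_{r_i}^{Fr^i}`. -/
def highVector : ⨂[F] i, RSpace k F p (r i) :=
  PiTensorProduct.tprod F fun i => (D i).iotaR k (mon F (r i) 0)

variable (k) in
/-- The lowest weight vector of the socle of `⨂ R_{r_i}^{Fr^i}`. -/
def lowVector : ⨂[F] i, RSpace k F p (r i) :=
  PiTensorProduct.tprod F fun i => (D i).iotaR k (mon F (r i) (r i))

lemma multiRep_weylGL_highVector : multiRep k F p r (weylGL k) (highVector k D)
    = (∏ i, (-1 : F) ^ (p - 1 - r i)) • lowVector k D := by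
  rw [highVector, multiRep_tprod, lowVector, ← MultilinearMap.map_smul_univ]
  congr 1
  funext i
  rw [(D i).RRep_iotaR, toMat_frob_weylGL, det_weyl, symAct_weyl_mon (Nat.zero_le _), Nat.sub_zero]

lemma lowVector_eq : lowVector k D = (∏ i, (-1 : F) ^ (p - 1 - r i)) •
    multiRep k F p r (weylGL k) (highVector k D) := by
  rw [multiRep_weylGL_highVector, smul_smul, ← Finset.prod_mul_distrib]
  simp [← pow_add]

omit [Fact p.Prime] [CharP k p] in
lemma mcoord_highVector : mcoord F p (fun i => p - 1 - r i) (fun i => p - 1 - r i) 0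
    (multiIncl k F p r (highVector k D)) = ∏ i, (-1 : F) ^ (p - 1 - r i) := by
  rw [highVector, multiIncl_tprod, mcoord, tprodDual_tprod]
  refine Finset.prod_congr rfl fun i _ => ?_
  rw [(D i).incl_iotaR, (D i).tcoord_iota]
  simp

omit [Fact p.Prime] [CharP k p] in
lemma highVector_ne_zero : highVector k D ≠ 0 := fun h => by
  have := mcoord_highVector (k := k) D
  rw [h, map_zero, map_zero] at this
  exact Finset.prod_ne_zero_iff.2 (fun i _ => pow_ne_zero _ (by simp)) this.symm

lemma lowVector_ne_zero : lowVector k D ≠ 0 := fun h => by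
  have h1 := multiRep_weylGL_highVector (k := k) D
  rw [h, smul_zero] at h1
  have h2 := congrArg (multiRep k F p r (weylGL k)⁻¹) h1
  rw [Representation.inv_self_apply, map_zero] at h2
  exact highVector_ne_zero D h2

/-- The vector has weight n, whereas a coordinate with b = 0 has weight a ≤ m < n. -/
lemma tcoord_iota_mon_self {m n r : ℕ} (D : CayleyData F m n r) (hmn : m < n) (a : ℕ) :
    tcoord F m n a 0 (D.iota (mon F r r)) = 0 := by
  by_cases ha : a ≤ m
  · have h : tensorAct m n (weyl F) (D.iota (mon F r 0)) = (-1 : F) ^ m • D.iota (mon F r r) := by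
      rw [D.act_iota, det_weyl, symAct_weyl_mon (Nat.zero_le _), Nat.sub_zero]
    have h1 := congrArg (tcoord F m n a 0) h
    rw [tcoord_tensorAct_weyl ha (Nat.zero_le _), D.tcoord_iota, if_neg (by omega), map_smul] at h1
    exact (smul_eq_zero.1 h1.symm).resolve_left (pow_ne_zero _ (by simp))
  · exact tcoord_eq_zero (Or.inl (not_le.1 ha)) _

variable [Fintype k] [DecidableEq k]

omit [DecidableEq k] in
-- An invariant vector is determined by its coordinates with b = 0, and one index with r_i ≠ 0 makes
-- all of these vanish here.
lemma exists_uniGL_lowVector_ne (hk : Fintype.card k = p ^ f) (hex : ∃ i, r i ≠ 0) :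
    ∃ l : k, multiRep k F p r (uniGL l) (lowVector k D) ≠ lowVector k D := by
  have hp := (Fact.out : p.Prime).two_le
  by_contra! h
  refine lowVector_ne_zero D (multiIncl_injective k F p r ?_)
  rw [map_zero]
  refine eq_zero_of_invariant (k := k) (by omega) hk (fun i => by omega) (fun l => ?_) fun a => ?_
  · rw [← multiIncl_uniGL, h]
  · obtain ⟨i, hi⟩ := hex
    rw [lowVector, multiIncl_tprod, mcoord, tprodDual_tprod]
    refine Finset.prod_eq_zero (Finset.mem_univ i) ?_
    exact tcoord_iota_mon_self (D i) (by omega) _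

omit [DecidableEq k] in
-- Each factor has weight (p - 1 - r_i) + r_i = p - 1, and ∑ p^i (p - 1) = q - 1.
lemma multiRep_torGL_lowVector (hk : Fintype.card k = p ^ f) (hr : ∀ i, r i + 2 ≤ p) (t : kˣ) :
    multiRep k F p r (torGL t) (lowVector k D) = lowVector k D := by
  have hp := (Fact.out : p.Prime).pos
  have h1 : ∀ i : Fin f, RRep k F p (r i) (Weight.frob k p i (torGL t))
      ((D i).iotaR k (mon F (r i) (r i)))
      = (algebraMap k F t ^ p ^ (i : ℕ)) ^ (p - 1) • (D i).iotaR k (mon F (r i) (r i)) := fun i => by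
    have := hr i
    rw [(D i).RRep_iotaR, toMat_frob_torGL, det_tor, symAct_tor_mon, map_smul, smul_smul, ← pow_add]
    congr 2
    omega
  rw [lowVector, multiRep_tprod]
  simp only [h1]
  rw [MultilinearMap.map_smul_univ, prod_pow_pow_eq, ofDigits_sub_one hp, ← hk, ← map_pow,
    FiniteField.pow_card_sub_one_eq_one _ t.ne_zero, map_one, one_smul]

/-- On `⨂ W_{r_i}`, the invariants of the torus are spanned by a vector fixed by the unipotent
matrices and by the lowest weight vector of the socle. -/
lemma sum_torGL_mem (hk : Fintype.card k = p ^ f) (hex : ∃ i, r i ≠ 0) (hr : ∀ i, r i + 2 ≤ p)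
    {x : ⨂[F] i, RSpace k F p (r i)}
    (hx : x ∈ subTensor fun i => LinearMap.ker (casimirR k F p (r i))) :
    multiIncl k F p r (∑ t : kˣ, multiRep k F p r (torGL t) x) ∈ Submodule.span F
      {PiTensorProduct.tprod F (fun i => mon F (p - 1 - r i) 0 ⊗ₜ[F] mon F (p - 1) 0),
        multiIncl k F p r (lowVector k D)} := by
  classical
  have hp := (Fact.out : p.Prime).pos
  set B := Submodule.span F
      {PiTensorProduct.tprod F (fun i => mon F (p - 1 - r i) 0 ⊗ₜ[F] mon F (p - 1) 0),
        multiIncl k F p r (lowVector k D)} with hB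
  suffices h : (subTensor fun i => LinearMap.ker (casimirR k F p (r i))) ≤
      B.comap (multiIncl k F p r ∘ₗ ∑ t : kˣ, multiRep k F p r (torGL t)) by
    simpa using h hx
  refine subTensor_le fun w hw => ?_
  rw [Submodule.mem_comap, LinearMap.comp_apply, LinearMap.sum_apply, map_sum]
  have h1 : ∀ t : kˣ, multiIncl k F p r (multiRep k F p r (torGL t) (PiTensorProduct.tprod F w))
      = ∑ N ∈ Fintype.piFinset fun _ : Fin f => Finset.range (2 * p),
        algebraMap k F t ^ ofDigits p N • PiTensorProduct.tprod F fun i =>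
          wtProj F (p - 1 - r i) (p - 1) (N i) (RSpace.incl k F p (r i) (w i)) := fun t => by
    have h2 : ∀ i : Fin f, tensorAct (p - 1 - r i) (p - 1) (tor (algebraMap k F t ^ p ^ (i : ℕ)))
        (RSpace.incl k F p (r i) (w i)) = ∑ N ∈ Finset.range (2 * p),
          (algebraMap k F t ^ p ^ (i : ℕ)) ^ N •
            wtProj F (p - 1 - r i) (p - 1) N (RSpace.incl k F p (r i) (w i)) := fun i => by
      conv_lhs => rw [sum_wtProj (M := 2 * p) (by omega) (RSpace.incl k F p (r i) (w i)), map_sum]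
      exact Finset.sum_congr rfl fun N _ => tensorAct_tor_of_wt (wtProj_wtProj _ _ _ _) _
    rw [multiIncl_torGL, multiIncl_tprod, multiAct, PiTensorProduct.map_tprod]
    simp only [h2]
    rw [tprod_sum_smul]
    simp only [prod_pow_pow_eq]
  simp only [h1]
  rw [Finset.sum_comm]
  refine B.sum_mem fun N _ => ?_
  rw [← Finset.sum_smul, sum_units_algebraMap_pow]
  split_ifs with hN
  swap
  · simp
  refine B.smul_mem _ ?_
  by_cases hle : ∀ i, N i ≤ p - 1 - r i + (p - 1)
  swap
  · obtain ⟨i, hi⟩ := not_forall.1 hle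
    rw [(PiTensorProduct.tprod F).map_coord_zero i (wtProj_eq_zero (not_le.1 hi) _)]
    exact B.zero_mem
  -- So only the exponents 0 and q - 1 survive. The first forces weight 0 in every factor, the
  -- second weight p - 1 in every factor, where ker K is the line through ι(X₁^r).
  have hlt : ofDigits p N < (Fintype.card k - 1) + (Fintype.card k - 1) :=
    calc ofDigits p N ≤ ofDigits p fun i => p - 1 - r i + (p - 1) := ofDigits_mono p hle
      _ = ofDigits p (fun i => p - 1 - r i) + ofDigits p fun _ : Fin f => p - 1 := ofDigits_add p _ _
      _ < _ := by
        have := ofDigits_lt_card_sub_one hk hex hr fun i => le_rfl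
        rw [ofDigits_sub_one hp, ← hk]
        omega
  obtain ⟨c, hc⟩ := hN
  have hc2 : c < 2 := by
    by_contra h
    have : (Fintype.card k - 1) * 2 ≤ (Fintype.card k - 1) * c := Nat.mul_le_mul_left _ (by omega)
    omega
  interval_cases c
  · have hN0 : N = fun _ => 0 := ofDigits_injective (p := p)
      (fun i => by
        by_contra h
        have : ofDigits p (fun _ : Fin f => 0) < ofDigits p N :=
          ofDigits_lt hp (fun _ => Nat.zero_le _) i (by omega)
        omega) (fun i => by omega) (by rw [hc]; simp [ofDigits])
    simp only [hN0, wtProj_zero]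
    rw [MultilinearMap.map_smul_univ]
    exact B.smul_mem _ (Submodule.subset_span (Set.mem_insert _ _))
  · have hN1 : N = fun _ => p - 1 := ofDigits_injective (p := p)
      (fun i => by have := hle i; omega) (fun i => by omega)
      (by rw [hc, ofDigits_sub_one hp, hk, mul_one])
    have h3 : ∀ i, ∃ c : F, wtProj F (p - 1 - r i) (p - 1) (p - 1) (RSpace.incl k F p (r i) (w i))
        = c • (D i).iota (mon F (r i) (r i)) := fun i =>
      (D i).exists_eq_smul (wtProj_wtProj _ _ _ _) (by
        rw [casimir_wtProj, ← RSpace.incl_casimirR, LinearMap.mem_ker.1 (hw i), map_zero, map_zero])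
    choose c hc using h3
    simp only [hN1, hc]
    rw [MultilinearMap.map_smul_univ]
    refine B.smul_mem _ (Submodule.subset_span (Set.mem_insert_of_mem _ ?_))
    rw [Set.mem_singleton_iff, lowVector, multiIncl_tprod]
    rfl

/-- Hence the unipotent matrices move the torus invariants of `⨂ W_{r_i}` by elements of the
socle. -/
lemma exists_uniGL_sub_sum_torGL (hk : Fintype.card k = p ^ f) (hex : ∃ i, r i ≠ 0)
    (hr : ∀ i, r i + 2 ≤ p) {x : ⨂[F] i, RSpace k F p (r i)}
    (hx : x ∈ subTensor fun i => LinearMap.ker (casimirR k F p (r i))) (l : k) :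
    ∃ c : F, multiRep k F p r (uniGL l) (∑ t : kˣ, multiRep k F p r (torGL t) x)
      - ∑ t : kˣ, multiRep k F p r (torGL t) x
      = c • (multiRep k F p r (uniGL l) (lowVector k D) - lowVector k D) := by
  obtain ⟨b, c, hbc⟩ := Submodule.mem_span_pair.1 (sum_torGL_mem D hk hex hr hx)
  refine ⟨c, multiIncl_injective k F p r ?_⟩
  have h1 : multiAct p (fun i => p - 1 - r i) (fun i => uni (algebraMap k F l ^ p ^ (i : ℕ)))
      (PiTensorProduct.tprod F fun i => mon F (p - 1 - r i) 0 ⊗ₜ[F] mon F (p - 1) 0)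
      = PiTensorProduct.tprod F fun i => mon F (p - 1 - r i) 0 ⊗ₜ[F] mon F (p - 1) 0 := by
    rw [multiAct, PiTensorProduct.map_tprod]
    simp only [tensorAct_uni_mon_zero]
  rw [map_sub, multiIncl_uniGL, ← hbc, map_add, map_smul, map_smul, h1, map_smul, map_sub,
    multiIncl_uniGL, smul_sub]
  abel

end SubspaceA

/-! ### The minimal counterexample. -/

section Main

variable {k F : Type*} [Field k] [Field F] [Algebra k F] {p : ℕ} [Fact p.Prime] [CharP k p]
  [CharP F p] [Fintype k] {f : ℕ} {r : Fin f → ℕ}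

/-- A subrepresentation of `⨂ R_{r_i}^{Fr^i}` whose intersection with the sum of the
`R_{r_i}^{Fr^i} ⊗ ⨂_{j ≠ i} K(R_{r_j})^{Fr^j}` lies in `⨂ ker K` lies in `⨂ ker K`. -/
theorem le_subTensor_ker_casimirR (hk : Fintype.card k = p ^ f) (hex : ∃ i, r i ≠ 0)
    (hr : ∀ i, r i + 2 ≤ p) (hq : ∀ i, p < Fintype.card k ∨ r i ≠ 0) (hqp : p ≤ Fintype.card k)
    (D : ∀ i, CayleyData F (p - 1 - r i) (p - 1) (r i))
    {M : Submodule F (⨂[F] i, RSpace k F p (r i))}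
    (hM : ∀ g, ∀ x ∈ M, multiRep k F p r g x ∈ M)
    (hMA : M ⊓ (⨆ i, LinearMap.range (PiTensorProduct.map
      (Function.update (fun j => casimirR k F p (r j)) i LinearMap.id))) ≤
      subTensor fun i => LinearMap.ker (casimirR k F p (r i))) :
    M ≤ subTensor fun i => LinearMap.ker (casimirR k F p (r i)) := by
  classical
  set A := subTensor fun i => LinearMap.ker (casimirR k F p (r i)) with hA
  set φ : ∀ i j, Module.End F (RSpace k F p (r j)) := fun i =>
    Function.update (fun j => casimirR k F p (r j)) i LinearMap.id with hφ
  set T := fun i => LinearMap.range (PiTensorProduct.map (φ i)) with hT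
  set S := LinearMap.range (PiTensorProduct.map fun j => casimirR k F p (r j)) with hS
  set L : Fin f → Module.End F (⨂[F] i, RSpace k F p (r i)) := fun i =>
    atIdx (U := fun j => RSpace k F p (r j)) i (casimirR k F p (r i)) with hL
  have hAL : ∀ i, A ≤ LinearMap.ker (L i) := fun i => subTensor_le_ker_atIdx i le_rfl
  have hLφ : ∀ i y, L i (PiTensorProduct.map (φ i) y)
      = PiTensorProduct.map (fun j => casimirR k F p (r j)) y := fun i y => by
    rw [hL, ← LinearMap.comp_apply, atIdx_comp_map, hφ]
    simp
  have hLφ' : ∀ i j y, i ≠ j → L i (PiTensorProduct.map (φ j) y) = 0 := fun i j y hij => by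
    rw [hL, ← LinearMap.comp_apply, atIdx_comp_map, map_eq_zero_of_apply_eq_zero i,
      LinearMap.zero_apply]
    rw [Function.update_self, hφ]
    simp only [Function.update_of_ne hij]
    exact LinearMap.ext fun z => (D i).casimirR_casimirR z
  have hSg : ∀ g, ∀ x ∈ S, multiRep k F p r g x ∈ S := by
    rintro g _ ⟨y, rfl⟩
    exact ⟨multiRep k F p r g y, map_multiRep (fun i => casimirR_RRep k F p (r i)) g y⟩
  have hTg : ∀ i g, ∀ x ∈ T i, multiRep k F p r g x ∈ T i := by
    rintro i g _ ⟨y, rfl⟩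
    refine ⟨multiRep k F p r g y, map_multiRep (fun j h x => ?_) g y⟩
    by_cases hj : j = i
    · subst hj; simp [hφ]
    · simp [hφ, hj, casimirR_RRep]
  have hST : ∀ i, S ≤ T i := by
    rintro i _ ⟨y, rfl⟩
    refine ⟨L i y, ?_⟩
    rw [hL, ← LinearMap.comp_apply, map_comp_atIdx, hφ]
    simp
  have hhS : highVector k D ∈ S := by
    choose v hv using fun i => (D i).exists_casimirR_eq (k := k)
    exact ⟨PiTensorProduct.tprod F v, by rw [PiTensorProduct.map_tprod]; simp only [hv]; rfl⟩
  have hlow : ∀ N : Submodule F (⨂[F] i, RSpace k F p (r i)),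
      (∀ g, ∀ x ∈ N, multiRep k F p r g x ∈ N) → highVector k D ∈ N → lowVector k D ∈ N :=
    fun N hN h => by
      rw [lowVector_eq]
      exact N.smul_mem _ (hN _ _ h)
  have hLM : ∀ (i : Fin f) {N : Submodule F (⨂[F] i, RSpace k F p (r i))},
      (∀ g, ∀ x ∈ N, multiRep k F p r g x ∈ N) →
      ∀ g, ∀ x ∈ N.map (L i), multiRep k F p r g x ∈ N.map (L i) := by
    rintro i N hN g _ ⟨x, hx, rfl⟩
    exact ⟨multiRep k F p r g x, hN g x hx, atIdx_multiRep i g x⟩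
  by_contra hnot
  obtain ⟨N, ⟨hN, hNM, hNA⟩, hmin⟩ := (wellFounded_lt (α := Submodule F
      (⨂[F] i, RSpace k F p (r i)))).has_min
    {N | (∀ g, ∀ x ∈ N, multiRep k F p r g x ∈ N) ∧ N ≤ M ∧ ¬ N ≤ A} ⟨M, hM, le_rfl, hnot⟩
  -- A nonzero L_i N contains the highest weight vector, which lies in S. So N ∩ L_i⁻¹(S) has a
  -- vector not killed by L_i, is not inside A, and equals N by minimality.
  have hNS : ∀ i, N.map (L i) ≤ S := fun i => by
    by_cases h0 : N.map (L i) = ⊥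
    · rw [h0]; exact bot_le
    · obtain ⟨x, hx, hx'⟩ := tprod_iotaR_mem hk hex hr hq hqp D (hLM i hN) h0
      have h1 : ¬ N ⊓ S.comap (L i) < N := hmin _ ⟨fun g y hy => ⟨hN g y hy.1, ?_⟩,
        inf_le_left.trans hNM, fun h => highVector_ne_zero (k := k) D ?_⟩
      · rw [Submodule.map_le_iff_le_comap]
        exact inf_eq_left.1 (eq_of_le_of_not_lt inf_le_left h1)
      · change L i _ ∈ S
        rw [hL]
        simp only [atIdx_multiRep]
        exact hSg g _ hy.2
      · have h2 : x ∈ A := h ⟨hx, by change L i x ∈ S; rw [hx']; exact hhS⟩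
        exact hx'.symm.trans (LinearMap.mem_ker.1 (hAL i h2))
  obtain ⟨i, hi⟩ : ∃ i, N.map (L i) ≠ ⊥ := by
    by_contra! h
    refine hNA fun x hx => mem_subTensor_ker fun i => ?_
    have : L i x ∈ N.map (L i) := ⟨x, hx, rfl⟩
    rw [h i] at this
    exact (Submodule.mem_bot F).1 this
  obtain ⟨x, hxN, hx⟩ := hlow _ (hLM i hN) (tprod_iotaR_mem hk hex hr hq hqp D (hLM i hN) hi)
  choose y hy using fun j => hNS j ⟨x, hxN, rfl⟩
  -- L_j sends the j-th correction to L_j x and kills the others because K² = 0; hence every L_j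
  -- kills a.
  set a := x - ∑ j, PiTensorProduct.map (φ j) (y j) with ha
  have haA : a ∈ A := mem_subTensor_ker fun j => by
    change L j a = 0
    rw [ha, map_sub, map_sum, Finset.sum_eq_single j (fun l _ hl => hLφ' j l _ hl.symm) (by simp),
      hLφ, hy, sub_self]
  obtain ⟨l, hl⟩ := exists_uniGL_lowVector_ne (k := k) D hk hex
  set E : Module.End F (⨂[F] i, RSpace k F p (r i)) := ∑ t : kˣ, multiRep k F p r (torGL t) with hE
  set u := multiRep k F p r (uniGL l) with hu
  have hEN : ∀ N' : Submodule F (⨂[F] i, RSpace k F p (r i)),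
      (∀ g, ∀ x ∈ N', multiRep k F p r g x ∈ N') → ∀ x ∈ N', u (E x) - E x ∈ N' :=
    fun N' hN' x hx => by
      have h1 : E x ∈ N' := by
        rw [hE, LinearMap.sum_apply]
        exact N'.sum_mem fun t _ => hN' _ _ hx
      exact N'.sub_mem (hN' _ _ h1) h1
  -- Nothing places a itself in the sum of the T_i, but u - 1 applied to its torus sum is a multiple
  -- of (u - 1)ℓ, with ℓ the lowest weight vector, which lies in S.
  have hEa : u (E a) - E a ∈ ⨆ i, T i := by
    obtain ⟨c, hc⟩ := exists_uniGL_sub_sum_torGL D hk hex hr haA l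
    rw [hE, LinearMap.sum_apply, hu, hc]
    have h1 := hlow S hSg hhS
    exact Submodule.mem_iSup_of_mem i (hST i (S.smul_mem _ (S.sub_mem (hSg _ _ h1) h1)))
  have hEx : u (E x) - E x ∈ ⨆ i, T i := by
    have h1 : x = a + ∑ j, PiTensorProduct.map (φ j) (y j) := by rw [ha]; abel
    have h2 : u (E x) - E x = (u (E a) - E a) + ∑ j, (u (E (PiTensorProduct.map (φ j) (y j)))
        - E (PiTensorProduct.map (φ j) (y j))) := by
      rw [Finset.sum_sub_distrib, ← map_sum, ← map_sum]
      conv_lhs => rw [h1, map_add, map_add]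
      abel
    rw [h2]
    exact Submodule.add_mem _ hEa (Submodule.sum_mem _ fun j _ => Submodule.mem_iSup_of_mem j
      (hEN _ (hTg j) _ ⟨y j, rfl⟩))
  -- The only use of the hypothesis on M: the vector lies both in N and in the sum of the T_j.
  have h1 : L i (u (E x) - E x) = 0 :=
    LinearMap.mem_ker.1 (hAL i (hMA ⟨hNM (hEN N hN x hxN), hEx⟩))
  -- L_i commutes with the torus, which fixes the lowest weight vector, so the sum consists of q - 1
  -- = -1 equal terms.
  have h2 : L i (E x) = -lowVector k D := by
    have h3 : ∀ t : kˣ, L i (multiRep k F p r (torGL t) x) = lowVector k D := fun t => by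
      rw [hL]
      simp only [atIdx_multiRep]
      rw [show atIdx i (casimirR k F p (r i)) x = lowVector k D from hx,
        multiRep_torGL_lowVector D hk hr]
    have h4 : ((Fintype.card kˣ : ℕ) : F) = -1 := by
      have := sum_units_algebraMap_pow (k := k) (F := F) 0
      simpa using this
    rw [hE, LinearMap.sum_apply, map_sum]
    simp only [h3]
    rw [Finset.sum_const, Finset.card_univ, ← Nat.cast_smul_eq_nsmul F, h4, neg_one_smul]
  have h3 : L i (u (E x)) = u (L i (E x)) := atIdx_multiRep i _ _
  rw [map_sub, h3, h2, map_neg, neg_sub_neg, sub_eq_zero] at h1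
  exact hl h1.symm

end Main

end SerreWeights

end

/-- If all r_i were 0, the tensor product of the constants 1 would span σ. -/
lemma SerreWeights.exists_r_ne_zero {p f : ℕ} {F : Type*} [Field F] {σ : SerreWeights.Weight p f}
    (h : 2 ≤ σ.dim F) : ∃ i, σ.r i ≠ 0 := by
  by_contra! h0
  have h1 : Module.finrank F (⨂[F] i, SerreWeights.Sym F (σ.r i)) ≤ 1 := by
    refine finrank_le_one (PiTensorProduct.tprod F fun i => SerreWeights.mon F (σ.r i) 0)
      fun x => ?_
    induction x using PiTensorProduct.induction_on with
    | smul_tprod c v =>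
      refine ⟨c * ∏ i, SerreWeights.coord F (σ.r i) 0 (v i), ?_⟩
      rw [mul_smul, ← MultilinearMap.map_smul_univ]
      congr 2
      funext i
      refine SerreWeights.Sym.ext_coord fun j hj => ?_
      obtain rfl : j = 0 := by rw [h0 i] at hj; omega
      rw [map_smul, SerreWeights.coord_mon (Nat.zero_le _)]
      simp
    | add x y hx hy =>
      obtain ⟨a, rfl⟩ := hx
      obtain ⟨b, rfl⟩ := hy
      exact ⟨a + b, add_smul _ _ _⟩
  exact absurd (h.trans h1) (by norm_num)

theorem mainTheorem4 (p f : ℕ) [Fact p.Prime] (hp : 3 ≤ p)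
    (k : Type*) [Field k] [Finite k] [CharP k p] (hk : Nat.card k = p ^ f)
    (F : Type*) [Field F] [Algebra k F]
    (σ : SerreWeights.Weight p f) (hreg : σ.IsRegular) (hdim : 2 ≤ σ.dim F)
    (M : Subrepresentation (σ.R k F))
    (hM : M.toSubmodule ⊓ σ.A' k F ≤ σ.A k F) :
    M.toSubmodule ≤ σ.A k F := by
  classical
  have := Fintype.ofFinite k
  have : CharP F p := charP_of_injective_algebraMap (algebraMap k F).injective p
  have hk' : Fintype.card k = p ^ f := by rw [← Nat.card_eq_fintype_card, hk]
  have hex := SerreWeights.exists_r_ne_zero hdim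
  have hr : ∀ i, σ.r i + 2 ≤ p := fun i => by
    have h1 := σ.r_le i
    have h2 := hreg i
    omega
  have hf : f ≠ 0 := by
    obtain ⟨i, -⟩ := hex
    exact i.pos.ne'
  have hqp : p ≤ Fintype.card k := hk' ▸ Nat.le_self_pow hf p
  -- For f = 1 the only index carries the nonzero r_i, and for f ≥ 2 one has q > p. This is the
  -- condition under which W_r = ker K is available.
  have hq : ∀ i, p < Fintype.card k ∨ σ.r i ≠ 0 := fun i => by
    by_cases hf1 : f = 1
    · subst hf1
      obtain ⟨j, hj⟩ := hex
      exact Or.inr (Subsingleton.elim j i ▸ hj)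
    · left
      rw [hk']
      exact lt_self_pow₀ (by omega) (by omega)
  have D : ∀ i, SerreWeights.CayleyData F (p - 1 - σ.r i) (p - 1) (σ.r i) := fun i =>
    (SerreWeights.nonempty_cayleyData (p := p) (by have := hr i; omega) (by have := hr i; omega)
      (by omega)).some
  have hA : σ.A k F = SerreWeights.subTensor fun i =>
      LinearMap.ker (SerreWeights.casimirR k F p (σ.r i)) := by
    rw [SerreWeights.Weight.A]
    exact congrArg _ (funext fun i => (D i).WSub_eq (hr i) hqp (hq i))
  rw [hA] at hM ⊢
  refine SerreWeights.le_subTensor_ker_casimirR hk' hex hr hq hqp D (fun g x hx => ?_)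
    (le_trans (inf_le_inf_left _ (iSup_mono fun i => ?_)) hM)
  -- The determinant twist multiplies by units, so stability under the group does not depend on it.
  · have h1 := M.apply_mem_toSubmodule g hx
    change ((SerreWeights.detPow k F _ g : Fˣ) : F) • SerreWeights.multiRep k F p σ.r g x ∈ _ at h1
    exact (Submodule.smul_mem_iff _ (Units.ne_zero _)).1 h1
  · refine SerreWeights.range_map_le_subTensor fun j => ?_
    by_cases hj : j = i
    · subst hj; simp
    · simp only [Function.update_of_ne hj]
      exact (D j).range_casimirR_le (hr j)
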